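/- **Conventions.** $S^n$ is the space of rays of $\mathbb R^{n+1}$ (the double cover of $\mathbb{RP}^n$), on which $\mathrm{SL}$, the group of real matrices of determinant $\pm1$, acts. A properly convex domain $\Omega\subset S^n$ is a non-empty open set whose cone is convex and whose closure lies in an open hemisphere; $\mathrm{SL}(\Omega)$ is its stabilizer. An element of $\mathrm{SL}(\Omega)$ is hyperbolic if it fixes no point of $\Omega$ and has a (complex) eigenvalue of modulus $\neq 1$. For $p\in\partial\overline\Omega$ and a supporting hyperplane $H$ to $\Omega$ at $p$, $\mathrm{SL}(\Omega,H,p)\subset \mathrm{SL}(\Omega)$ is the subgroup preserving $H$ and $p$. Let $\mathcal S_0$ be $\partial\overline\Omega$ with $p$ and all segments in $\partial\overline\Omega$ with endpoint $p$ deleted; an algebraic horosphere centred on $(H,p)$ is an image of $\mathcal S_0$ under some $\mathrm{Id}+\phi\otimes p$ with $\phi|_H=0$ that is contained in $\Omega$. A cusp group $\Gamma\subset\mathrm{SL}(\Omega,H,p)$ is an infinite discrete group without hyperbolics that preserves some algebraic horosphere centred on $(H,p)$. A properly convex manifold is $N=\Omega/\Gamma'$ with $\Omega$ properly convex and $\Gamma'\subset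 \mathrm{SL}(\Omega)$ discrete and torsion-free. An open cusp in $N$ with parabolic fixed point $p\in\partial\overline\Omega$ is a connected open set $M\subset N$ for which there is a component $\tilde M$ of its preimage in $\Omega$, with stabilizer $\Gamma$ in $\Gamma'$ (the holonomy of $M$, so $M=\tilde M/\Gamma$), such that * $\tilde M$ is starshaped at $p$: $p\in\overline{\tilde M}$, and for each $x\in\tilde M$ the half-open segment $[x,p)$ is in $\tilde M$; * $\tilde M$ contains a properly convex domain $\Omega_0$, with $p\in\partial\overline{\Omega_0}$, for which $\Gamma\subset\mathrm{SL}(\Omega_0,H_0,p)$ is a cusp group for some supporting hyperplane $H_0$ to $\Omega_0$ at $p$ (so $\Omega_0/\Gamma$ is a convex core of $M$). The rays in $M$ asymptotic to $p$ are the images of the non-empty sets $\ell\cap\tilde M$, with $\ell$ a line through $p$. A closed cusp in $N$ (with fixed point $p$ and holonomy $\Gamma$) is a smooth codimension-$0$ submanifold $P\subset N$ with non-empty boundary $\partial P=P\cap\overline{N\setminus P}$, whose interior is an open cusp with fixed point $p$ and holonomy $\Gamma$, such that each ray asymptotic to $p$ through a point of (a fixed component of the preimage of) $P$ meets its boundary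 transversally in exactly one point. **Theorem (structure of open cusps).** Let $M=\tilde M/\Gamma$ be an open cusp with parabolic fixed point $p$ in a properly convex $n$-manifold $N=\Omega/\Gamma'$, $n\ge 1$, with $\Gamma\subset\mathrm{SL}(\Omega,H,p)$ for some supporting hyperplane $H$ to $\Omega$ at $p$. Then there are an affine $(n-1)$-manifold $X$ (the cusp cross-section) and a map $h_2:M\to X$ such that: 1. There is $h_1:M\to\mathbb R$ such that $h=(h_1,h_2):M\to\mathbb R\times X$ is a diffeomorphism. 2. The fibres of $h_2$ are the rays in $M$ asymptotic to $p$, and $h_1\to-\infty$ along each of them moving toward $p$. 3. $M$ is an affine manifold: it has an affine atlas compatible with its projective structure, with respect to which $h_2$ is an affine map. 4. $h_1$ can be chosen, with 1 and 2, such that $P=h_1^{-1}(-\infty,0]$ is a closed cusp with fixed point $p$ and holonomy $\Gamma$, and $h_2|:\partial P\to X$ is a diffeomorphism. 5. If $V\subset M$ is an open cusp in $N$ with the same parabolic fixed point $p$ (more precisely, as seen from a component of the preimage of $V$ that lies in $\tilde M$), and $h_2(M\setminus\overline V)=X$, then $h_1$ can be chosen as in 4 and such that moreover $V\subset h_1^{-1}(-\infty,0]$.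 6. The holonomy group $\Gamma$ of $M$ is virtually nilpotent; in particular, if $\tilde M$ is simply connected, then $\pi_1M$ is virtually nilpotent. -/

import Mathlib

open Set Filter Topology Manifold
open scoped ContDiff

noncomputable section

namespace ConvexCusp

/-- Euclidean space of dimension `n`. -/
abbrev E (n : ℕ) := EuclideanSpace ℝ (Fin n)

/-- The sphere `S^n`, the space of rays of `ℝ^(n+1)` and the double cover of projective space. -/
abbrev S (n : ℕ) := Metric.sphere (0 : E (n + 1)) 1

/-- The ray through a non-zero vector, as a point of the sphere (junk value at `0`). -/
def toSphere {n : ℕ} (v : E (n + 1)) : S n :=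
  if h : v = 0 then ⟨EuclideanSpace.single 0 1, by simp⟩
  else ⟨‖v‖⁻¹ • v, by simp [norm_smul, h]⟩

/-- The linear action of an invertible matrix. -/
def lin {n : ℕ} (A : GL (Fin (n + 1)) ℝ) : E (n + 1) →ₗ[ℝ] E (n + 1) :=
  Matrix.toEuclideanLin (A : Matrix (Fin (n + 1)) (Fin (n + 1)) ℝ)

/-- The action of an invertible matrix on the sphere of rays. -/
def act {n : ℕ} (A : GL (Fin (n + 1)) ℝ) (x : S n) : S n := toSphere (lin A (x : E (n + 1)))

lemma S.ne_zero {n : ℕ} (x : S n) : (x : E (n + 1)) ≠ 0 := by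
  intro h
  have := x.2
  simp [h] at this

lemma toSphere_smul {n : ℕ} {t : ℝ} (ht : 0 < t) (v : E (n + 1)) :
    toSphere (t • v) = toSphere v := by
  by_cases hv : v = 0
  · simp [hv]
  · have h2 : t • v ≠ 0 := smul_ne_zero ht.ne' hv
    simp only [toSphere, hv, h2, dif_neg, not_false_eq_true, Subtype.mk.injEq]
    rw [norm_smul, Real.norm_of_nonneg ht.le, smul_smul]
    congr 1
    field_simp

lemma toSphere_coe {n : ℕ} (x : S n) : toSphere (x : E (n + 1)) = x := by
  have h1 : ‖(x : E (n + 1))‖ = 1 := by simp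
  apply Subtype.ext
  simp [toSphere, S.ne_zero x, h1]

lemma lin_one {n : ℕ} (v : E (n + 1)) : lin 1 v = v := by
  simp [lin]

lemma lin_mul {n : ℕ} (A B : GL (Fin (n + 1)) ℝ) (v : E (n + 1)) :
    lin (A * B) v = lin A (lin B v) := by
  simp [lin]

lemma act_one {n : ℕ} (x : S n) : act 1 x = x := by
  rw [act, lin_one, toSphere_coe]

lemma act_mul {n : ℕ} (A B : GL (Fin (n + 1)) ℝ) (x : S n) :
    act (A * B) x = act A (act B x) := by
  have h0 : lin B (x : E (n + 1)) ≠ 0 := by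
    intro h
    have h1 : lin (B⁻¹ * B) (x : E (n + 1)) = 0 := by rw [lin_mul, h, map_zero]
    rw [inv_mul_cancel, lin_one] at h1
    exact S.ne_zero x h1
  have h2 : ((act B x : S n) : E (n + 1)) = ‖lin B (x : E (n + 1))‖⁻¹ • lin B (x : E (n + 1)) := by
    simp [act, toSphere, h0]
  have h3 : 0 < ‖lin B (x : E (n + 1))‖⁻¹ := by positivity
  rw [act, act, h2, map_smul, toSphere_smul h3, lin_mul]

/-- The cone `ℝ_{>0} · U` over a set `U` of rays. -/
def cone {n : ℕ} (U : Set (S n)) : Set (E (n + 1)) := {v | v ≠ 0 ∧ toSphere v ∈ U}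

/-- The (great circle) line through the points `x` and `p` of the sphere. -/
def line {n : ℕ} (p x : S n) : Set (S n) :=
  {y | (y : E (n + 1)) ∈ Submodule.span ℝ {(x : E (n + 1)), (p : E (n + 1))}}

/-- `Ω` is a (non-empty, open) properly convex domain: it is convex and its closure lies in an
open hemisphere, that is, in an affine patch. -/
structure IsProperlyConvex {n : ℕ} (Ω : Set (S n)) : Prop where
  nonempty : Ω.Nonempty
  isOpen : IsOpen Ω
  convex : Convex ℝ (cone Ω)
  patch : ∃ f : E (n + 1) →ₗ[ℝ] ℝ, ∀ x ∈ closure Ω, 0 < f (x : E (n + 1))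

/-- `Γ` is a discrete subgroup of `SL(Ω)`, the group of matrices of determinant `±1` that
preserve `Ω`. -/
structure IsDiscreteIn {n : ℕ} (Γ : Subgroup (GL (Fin (n + 1)) ℝ)) (Ω : Set (S n)) : Prop where
  det : ∀ A ∈ Γ, (A : Matrix (Fin (n + 1)) (Fin (n + 1)) ℝ).det = 1 ∨
    (A : Matrix (Fin (n + 1)) (Fin (n + 1)) ℝ).det = -1
  preserves : ∀ A ∈ Γ, act A '' Ω = Ω
  discrete : DiscreteTopology Γ

/-- The pair `(Ω, Γ)` defines a properly convex projective manifold `Ω / Γ`. -/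
structure IsConvexManifold {n : ℕ} (Ω : Set (S n)) (Γ : Subgroup (GL (Fin (n + 1)) ℝ)) :
    Prop where
  properlyConvex : IsProperlyConvex Ω
  discrete : IsDiscreteIn Γ Ω
  torsionFree : ∀ A ∈ Γ, IsOfFinOrder A → A = 1

/-- Two points of `Ω` are equivalent if they lie in one `Γ`-orbit. -/
def orbitSetoid {n : ℕ} (Ω : Set (S n)) (Γ : Subgroup (GL (Fin (n + 1)) ℝ)) : Setoid Ω where
  r x y := ∃ A ∈ Γ, act A (x : S n) = y
  iseqv :=
    { refl := fun x => ⟨1, Γ.one_mem, act_one _⟩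
      symm := by
        rintro x y ⟨A, hA, h⟩
        exact ⟨A⁻¹, Γ.inv_mem hA, by rw [← h, ← act_mul, inv_mul_cancel, act_one]⟩
      trans := by
        rintro x y z ⟨A, hA, h⟩ ⟨B, hB, h'⟩
        exact ⟨B * A, Γ.mul_mem hB hA, by rw [act_mul, h, h']⟩ }

/-- The quotient `Ω / Γ`, with the quotient topology. -/
abbrev OrbitSpace {n : ℕ} (Ω : Set (S n)) (Γ : Subgroup (GL (Fin (n + 1)) ℝ)) :=
  Quotient (orbitSetoid Ω Γ)

/-- The preimage in `Ω` of a subset of `Ω / Γ`, as a subset of the sphere. -/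
def lift {n : ℕ} {Ω : Set (S n)} {Γ : Subgroup (GL (Fin (n + 1)) ℝ)} (M : Set (OrbitSpace Ω Γ)) :
    Set (S n) :=
  {x | ∃ hx : x ∈ Ω, (Quotient.mk (orbitSetoid Ω Γ) ⟨x, hx⟩) ∈ M}

/-- `A` is a connected component of `B`. -/
def IsComponentOf {n : ℕ} (A B : Set (S n)) : Prop := ∃ x ∈ B, A = connectedComponentIn B x

/-- `H` is (the linear hyperplane defining) a supporting hyperplane at `p` of the open convex
set `Ω`. -/
structure IsSupportingHyperplane {n : ℕ} (Ω : Set (S n)) (H : Submodule ℝ (E (n + 1))) (p : S n) :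
    Prop where
  finrank : Module.finrank ℝ H = n
  mem : (p : E (n + 1)) ∈ H
  disjoint : ∀ x ∈ Ω, (x : E (n + 1)) ∉ H

/-- The group `Γ` preserves both `H` and `p`. -/
structure Preserves {n : ℕ} (Γ : Subgroup (GL (Fin (n + 1)) ℝ)) (H : Submodule ℝ (E (n + 1)))
    (p : S n) : Prop where
  point : ∀ A ∈ Γ, act A p = p
  hyperplane : ∀ A ∈ Γ, H.map (lin A) = H

/-- `A ∈ SL(Ω)` is hyperbolic: it has no fixed point in `Ω`, and some eigenvalue does not have
modulus one. -/
def IsHyperbolic {n : ℕ} (Ω : Set (S n)) (A : GL (Fin (n + 1)) ℝ) : Prop :=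
  (∀ x ∈ Ω, act A x ≠ x) ∧
  ∃ μ : ℂ, Module.End.HasEigenvalue (Matrix.toLin'
    ((A : Matrix (Fin (n + 1)) (Fin (n + 1)) ℝ).map (algebraMap ℝ ℂ))) μ ∧ ‖μ‖ ≠ 1

/-- The frontier of `Ω` with `p` and all segments in the frontier with endpoint `p` deleted. -/
def radialBoundary {n : ℕ} (Ω : Set (S n)) (p : S n) : Set (S n) :=
  {x | x ∈ frontier Ω ∧ x ≠ p ∧
    ¬ ∀ a b : ℝ, 0 ≤ a → 0 ≤ b → 0 < a + b →
      toSphere (a • (x : E (n + 1)) + b • (p : E (n + 1))) ∈ frontier Ω}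

/-- An algebraic horosphere of `Ω` centred on `(H, p)`: the image of `radialBoundary Ω p` under
some `Id + φ ⊗ p` with `φ` vanishing on `H`, if this image is contained in `Ω`. -/
def IsHorosphere {n : ℕ} (Ω : Set (S n)) (H : Submodule ℝ (E (n + 1))) (p : S n)
    (T : Set (S n)) : Prop :=
  ∃ φ : E (n + 1) →ₗ[ℝ] ℝ, (∀ v ∈ H, φ v = 0) ∧
    T = (fun x : S n => toSphere ((x : E (n + 1)) + φ (x : E (n + 1)) • (p : E (n + 1)))) ''
      radialBoundary Ω p ∧
    T ⊆ Ω

/-- `Γ ⊆ SL(Ω, H, p)` is a cusp group: an infinite discrete group without hyperbolics which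
preserves some algebraic horosphere centred on `(H, p)`. Thus `Ω / Γ` is a full cusp with
parabolic fixed point `p`. -/
structure IsCuspGroup {n : ℕ} (Γ : Subgroup (GL (Fin (n + 1)) ℝ)) (Ω : Set (S n))
    (H : Submodule ℝ (E (n + 1))) (p : S n) : Prop where
  properlyConvex : IsProperlyConvex Ω
  discrete : IsDiscreteIn Γ Ω
  infinite : Infinite Γ
  nonhyperbolic : ∀ A ∈ Γ, ¬ IsHyperbolic Ω A
  mem_frontier : p ∈ frontier Ω
  supporting : IsSupportingHyperplane Ω H p
  preserves : Preserves Γ H p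
  horosphere : ∃ T, IsHorosphere Ω H p T ∧ ∀ A ∈ Γ, act A '' T = T

/-- The open set `U` is starshaped at `p`: `p` is in its closure and, with each of its points `x`,
it contains the open segment from `x` to `p`. -/
def IsStarshaped {n : ℕ} (U : Set (S n)) (p : S n) : Prop :=
  p ∈ closure U ∧
    ∀ v ∈ cone U, ∀ s : ℝ, 0 ≤ s → v + s • (p : E (n + 1)) ∈ cone U

/-- `M` is an open cusp in `N = Ω / Γ'`, with parabolic fixed point `p` and holonomy `Γ`, where
`M = Mt / Γ` for the component `Mt` of the preimage of `M` in `Ω`. Here `Ω'` covers a convex core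
of `M`: a convex cusp `W = Ω' / Γ` in `N` of which `M` is a thickening. -/
structure IsOpenCusp {n : ℕ} {Ω : Set (S n)} {Γ' : Subgroup (GL (Fin (n + 1)) ℝ)}
    (M : Set (OrbitSpace Ω Γ')) (Mt : Set (S n)) (Γ : Subgroup (GL (Fin (n + 1)) ℝ)) (p : S n) :
    Prop where
  isOpen : IsOpen M
  connected : IsConnected M
  component : IsComponentOf Mt (lift M)
  holonomy : ∀ A, A ∈ Γ ↔ A ∈ Γ' ∧ act A '' Mt = Mt
  mem_frontier : p ∈ frontier Ω
  starshaped : IsStarshaped Mt p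
  core : ∃ Ω' ⊆ Mt, ∃ H', IsCuspGroup Γ Ω' H' p

lemma IsOpenCusp.subset_lift {n : ℕ} {Ω : Set (S n)} {Γ' : Subgroup (GL (Fin (n + 1)) ℝ)}
    {M : Set (OrbitSpace Ω Γ')} {Mt : Set (S n)} {Γ : Subgroup (GL (Fin (n + 1)) ℝ)} {p : S n}
    (h : IsOpenCusp M Mt Γ p) : Mt ⊆ lift M := by
  obtain ⟨x, _, hx⟩ := h.component
  rw [hx]
  exact connectedComponentIn_subset _ _

/-- The covering projection `Mt → M`. -/
def IsOpenCusp.proj {n : ℕ} {Ω : Set (S n)} {Γ' : Subgroup (GL (Fin (n + 1)) ℝ)}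
    {M : Set (OrbitSpace Ω Γ')} {Mt : TopologicalSpace.Opens (S n)}
    {Γ : Subgroup (GL (Fin (n + 1)) ℝ)} {p : S n} (h : IsOpenCusp M Mt Γ p) (x : Mt) : M :=
  ⟨Quotient.mk (orbitSetoid Ω Γ') ⟨x, (h.subset_lift x.2).1⟩, (h.subset_lift x.2).2⟩

/-- The boundary of a codimension-zero submanifold `P` of a manifold. -/
def bdry {N : Type*} [TopologicalSpace N] (P : Set N) : Set N := P ∩ closure Pᶜ

/-- `P` is a (closed) cusp in `N = Ω / Γ'`, with parabolic fixed point `p` and holonomy `Γ`, and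
`Pt` is a component of its preimage in `Ω`: the boundary of `P` is non-empty, the interior is an
open cusp, every ray asymptotic to `p` that contains a point of `P` meets the boundary in one
point, and at its boundary points `P` is given by an inequality `g ≤ 0` with `g` smooth, regular,
and of non-zero derivative along the ray to `p`. -/
structure IsClosedCusp {n : ℕ} {Ω : Set (S n)} {Γ' : Subgroup (GL (Fin (n + 1)) ℝ)}
    (P : Set (OrbitSpace Ω Γ')) (Pt : Set (S n)) (Γ : Subgroup (GL (Fin (n + 1)) ℝ)) (p : S n) :
    Prop where
  component : IsComponentOf Pt (lift P)
  nonempty : (bdry P).Nonempty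
  interior : IsOpenCusp (interior P) (interior Pt) Γ p
  meets : ∀ x ∈ Pt, ∃! y, y ∈ Pt ∧ y ∈ lift (bdry P) ∧ y ∈ line p x
  smooth_transverse : ∀ y ∈ Pt, y ∈ lift (bdry P) →
    ∃ g : E (n + 1) → ℝ, ContDiffAt ℝ ∞ g (y : E (n + 1)) ∧
      (∀ᶠ v in 𝓝 (y : E (n + 1)), toSphere v ∈ lift P ↔ g v ≤ 0) ∧
      fderiv ℝ g (y : E (n + 1)) (p : E (n + 1)) ≠ 0

/-- The maps that are locally affine on a set. -/
def affinePregroupoid (k : ℕ) : Pregroupoid (E k) where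
  property f u := ∀ x ∈ u, ∃ A : E k →ᵃ[ℝ] E k, ∀ᶠ y in 𝓝 x, y ∈ u → f y = A y
  comp := by
    intro f g u v hf hg hu hv huv x hx
    obtain ⟨A, hA⟩ := hf x hx.1
    obtain ⟨B, hB⟩ := hg (f x) hx.2
    refine ⟨B.comp A, ?_⟩
    have hu' : ∀ᶠ y in 𝓝 x, y ∈ u := hu.mem_nhds hx.1
    have hfx : f x = A x := hA.self_of_nhds hx.1
    have hc : Tendsto A (𝓝 x) (𝓝 (f x)) := by
      rw [hfx]; exact A.continuous_of_finiteDimensional.tendsto x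
    filter_upwards [hA, hu', hc.eventually hB] with y h1 h2 h3 hy
    have h4 : f y = A y := h1 h2
    rw [← h4] at h3
    simpa [h4] using h3 hy.2
  id_mem := fun x _ => ⟨AffineMap.id ℝ (E k), Eventually.of_forall fun y _ => rfl⟩
  locality := by
    intro f u hu h x hx
    obtain ⟨v, hv, hxv, hfv⟩ := h x hx
    obtain ⟨A, hA⟩ := hfv x ⟨hx, hxv⟩
    refine ⟨A, ?_⟩
    filter_upwards [hA, hv.mem_nhds hxv] with y h1 h2 hy
    exact h1 ⟨hy, h2⟩
  congr := by
    intro f g u hu h hf x hx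
    obtain ⟨A, hA⟩ := hf x hx
    refine ⟨A, ?_⟩
    filter_upwards [hA] with y h1 hy
    rw [h y hy, h1 hy]

/-- `Y`, with its given atlas, is an affine `k`-manifold: it is Hausdorff and second countable
and its changes of charts are locally affine. -/
structure IsAffineManifold (k : ℕ) (Y : Type*) [TopologicalSpace Y] [ChartedSpace (E k) Y] :
    Prop where
  t2 : T2Space Y
  secondCountable : SecondCountableTopology Y
  hasGroupoid : HasGroupoid Y (affinePregroupoid k).groupoid

/-- The atlas of `Y` is compatible with the projective structure that `q` transports from the
open subset `U` of the sphere: in each chart, `q` is locally a projective map. -/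
def IsProjectiveAtlas {n : ℕ} {U : TopologicalSpace.Opens (S n)} {Y : Type*} [TopologicalSpace Y]
    [ChartedSpace (E n) Y] (q : U → Y) : Prop :=
  ∀ c ∈ atlas (E n) Y, ∀ x : U, q x ∈ c.source →
    ∃ (L : E (n + 1) →ₗ[ℝ] E n) (l : E (n + 1) →ₗ[ℝ] ℝ),
      ∀ᶠ y : U in 𝓝 x, 0 < l ((y : S n) : E (n + 1)) ∧
        c (q y) = (l ((y : S n) : E (n + 1)))⁻¹ • L ((y : S n) : E (n + 1))

/-- The map `f` is locally affine in the charts of `Y` and `Z`. -/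
def IsAffine {k l : ℕ} {Y Z : Type*} [TopologicalSpace Y] [TopologicalSpace Z]
    [ChartedSpace (E k) Y] [ChartedSpace (E l) Z] (f : Y → Z) : Prop :=
  ∀ c ∈ atlas (E k) Y, ∀ d ∈ atlas (E l) Z, ∀ y ∈ c.source, f y ∈ d.source →
    ∃ A : E k →ᵃ[ℝ] E l, ∀ᶠ z in 𝓝 (c y), d (f (c.symm z)) = A z

/-- The subset `h₁ ≤ 0` of `M`, as a subset of `N`, for a map `h = (h₁, h₂)` on `M`. -/
def sublevel {N : Type*} {M : Set N} {X : Type*} (h : M → ℝ × X) : Set N :=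
  Subtype.val '' {x : M | (h x).1 ≤ 0}

/-- The diffeomorphism `h = (h₁, h₂)` has the given second component `h₂`, its first component
tends to `-∞` along each ray of `M` towards `p`, the set `h₁ ≤ 0` is a closed cusp in `N` (with
parabolic fixed point `p` and holonomy `Γ`), and `h₂` restricts to a diffeomorphism from the
boundary of this cusp onto `X`. -/
structure IsCuspSplitting {n m : ℕ} {Ω : Set (S n)} {Γ' : Subgroup (GL (Fin (n + 1)) ℝ)}
    {M : Set (OrbitSpace Ω Γ')} {Mt : TopologicalSpace.Opens (S n)}
    {Γ : Subgroup (GL (Fin (n + 1)) ℝ)} {p : S n} (hM : IsOpenCusp M Mt Γ p)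
    {X : Type*} [TopologicalSpace X] [ChartedSpace (E m) X] [ChartedSpace (E n) M]
    (h₂ : M → X) (h : M ≃ₘ^∞⟮𝓡 n, 𝓘(ℝ, ℝ).prod (𝓡 m)⟯ (ℝ × X)) : Prop where
  snd : ∀ x, (h x).2 = h₂ x
  tendsto : ∀ x : Mt, Tendsto (fun y : Mt => (h (hM.proj y)).1)
    (comap (fun y : Mt => (y : S n)) (𝓝 p) ⊓ 𝓟 {y : Mt | (y : S n) ∈ line p x}) atBot
  closedCusp : ∃ Pt ⊆ (Mt : Set (S n)), IsClosedCusp (sublevel h) Pt Γ p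
  bdry_subset : bdry (sublevel h) ⊆ M
  bijOn : BijOn h₂ {x : M | (x : OrbitSpace Ω Γ') ∈ bdry (sublevel h)} univ
  smooth_inverse : ∃ σ : X → M, ContMDiff (𝓡 m) (𝓡 n) ∞ σ ∧ ∀ x, h₂ (σ x) = x ∧
    (σ x : OrbitSpace Ω Γ') ∈ bdry (sublevel h)

end ConvexCusp

end

/-! Choose linear coordinates in which `p` is the vertical direction and `H` is the hyperplane at
infinity. Non-trivial elements of a torsion-free discrete group have no fixed point in a properly
convex domain (`eq_one_of_fixed`), so the absence of hyperbolics in the core forces every eigenvalue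
of the holonomy to have modulus one. Hence `Γ` fixes the vector `p` and the functional with kernel
`H`, not merely up to scale, and acts on the affine patch by `(z, t) ↦ (a z, t + b z)` with `a`, `b`
affine. Starshapedness says that `Mt` is the region above the graph of an upper semicontinuous
function τ (`lowerBoundary`) over an open `base`, and the lines through `p` are the vertical lines.

The action on the base is already free and properly discontinuous (`IsCuspCover.isDomain`). Proper
convexity bounds τ from below by a continuous function, and semicontinuity bounds it from above on
compact sets. An element that returns a compact part of the base therefore has a bounded vertical
shift. A map that preserves a properly convex cone is controlled by its value at one interior point
(`norm_lin_le`), so its norm is bounded and discreteness leaves finitely many such elements. The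
quotient of the base is `X`, and vertical projection is an affine map `M → X` with the required
fibres.

For the product structure, call a smooth `s` on the base with `s (a z) = s z + b z` a section. A
partition of unity on `X` produces sections between τ and any invariant obstacle that locally stays
away from τ. A decreasing sequence of sections that converges to τ, with a smooth unit step between
consecutive terms, gives an invariant height function that maps every vertical ray diffeomorphically
onto `ℝ` and vanishes on the first section (`exists_height`). Together with the projection to `X` it
is the diffeomorphism, and its sublevel set is the region on or above that section.

This region is a closed cusp only if its interior contains a convex core, so the core has to be an
obstacle. The given core may touch the lower boundary. It is replaced by the cone on the hull of the
orbit of a small ball together with `p`; away from `H`, the closure of this smaller core lies in the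
old one (`exists_core`). For item 5 the whole preimage of `V` in `Mt` is a second obstacle, and `h₂
(M \ closure V) = X` supplies a point below it on every ray.

For nilpotency, Burnside's theorem puts a group with eigenvalues of modulus at most one into block
triangular form with bounded diagonal blocks. Conjugation by a diagonal scaling makes the blocks off
the diagonal small, so commutators of elements with diagonal part near one contract to the identity,
and discreteness ends the iteration. Boundedness upgrades this Engel condition: each further
commutator moves one block diagonal away from the diagonal. The elements with diagonal part near one
thus generate a nilpotent subgroup, which has finite index by total boundedness of the diagonal
parts. -/

/-! ### Nilpotency from iterated commutators of generators. -/

section Nilpotency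

open scoped commutatorElement

universe u

/-- The left-normed iterated commutators of a set of elements. -/
def iteratedCommutators {G : Type u} [Group G] (S : Set G) : ℕ → Set G
  | 0 => S
  | k + 1 => {x | ∃ s ∈ S, ∃ c ∈ iteratedCommutators S k, x = ⁅s, c⁆}

/-- A group generated by a set whose iterated commutators of some weight are trivial is
nilpotent. -/
theorem isNilpotent_of_iteratedCommutators_trivial (k : ℕ) :
    ∀ {G : Type u} [Group G] (S : Set G), Subgroup.closure S = ⊤ →
      iteratedCommutators S k ⊆ {1} → Group.IsNilpotent G := by
  induction k with
  | zero =>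
    intro G _ S hS h
    have h2 : (⊤ : Subgroup G) = ⊥ := by
      rw [← hS, Subgroup.closure_eq_bot_iff]; exact h
    have : Subsingleton G := by
      constructor
      intro a b
      have ha : a ∈ (⊥ : Subgroup G) := h2 ▸ Subgroup.mem_top a
      have hb : b ∈ (⊥ : Subgroup G) := h2 ▸ Subgroup.mem_top b
      rw [Subgroup.mem_bot] at ha hb
      rw [ha, hb]
    infer_instance
  | succ k ih =>
    intro G _ S hS h
    -- The last possibly non-trivial commutators commute with every generator, hence are central;
    -- the induction hypothesis applies modulo the centre.
    have hc : iteratedCommutators S k ⊆ Subgroup.center G := by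
      intro c hc
      have h1 : S ⊆ Subgroup.centralizer {c} := by
        intro s hs
        have h2 : ⁅s, c⁆ = 1 := h ⟨s, hs, c, hc, rfl⟩
        rw [SetLike.mem_coe, Subgroup.mem_centralizer_singleton_iff]
        exact commutatorElement_eq_one_iff_mul_comm.1 h2
      rw [SetLike.mem_coe, Subgroup.mem_center_iff]
      intro g
      have h3 : g ∈ Subgroup.closure S := hS ▸ Subgroup.mem_top g
      have h4 := (Subgroup.closure_le _).2 h1 h3
      exact Subgroup.mem_centralizer_singleton_iff.1 h4
    have hq : ∀ j, iteratedCommutators (QuotientGroup.mk' (Subgroup.center G) '' S) j ⊆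
        QuotientGroup.mk' (Subgroup.center G) '' iteratedCommutators S j := by
      intro j
      induction j with
      | zero => exact subset_rfl
      | succ j ihj =>
        rintro x ⟨s, ⟨s, hs, rfl⟩, c, hc', rfl⟩
        obtain ⟨c', hc2, rfl⟩ := ihj hc'
        exact ⟨⁅s, c'⁆, ⟨s, hs, c', hc2, rfl⟩, map_commutatorElement _ _ _⟩
    have hn : Group.IsNilpotent (G ⧸ Subgroup.center G) := by
      refine ih (QuotientGroup.mk' (Subgroup.center G) '' S) ?_ ?_
      · rw [← MonoidHom.map_closure, hS, Subgroup.map_top_of_surjective]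
        exact QuotientGroup.mk'_surjective _
      · intro x hx
        obtain ⟨c, hc', rfl⟩ := hq k hx
        exact (QuotientGroup.eq_one_iff c).2 (hc hc')
    exact Subgroup.isNilpotent_of_ker_le_center (QuotientGroup.mk' (Subgroup.center G))
      (by rw [QuotientGroup.ker_mk'])

/-! ### Burnside's theorem and block triangular form. -/

section Flag

variable {V : Type*} [AddCommGroup V] [Module ℂ V] [FiniteDimensional ℂ V]

/-- The trace is the sum of the roots of the characteristic polynomial, of which there are at most
`finrank ℂ V`. -/
theorem norm_trace_le_of_eigenvalues (f : Module.End ℂ V)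
    (h : ∀ μ, f.HasEigenvalue μ → ‖μ‖ ≤ 1) :
    ‖LinearMap.trace ℂ V f‖ ≤ Module.finrank ℂ V := by
  have hs : f.charpoly.Splits := IsAlgClosed.splits _
  rw [Module.End.trace_eq_sum_roots_charpoly_of_splits hs]
  have h1 : ∀ s : Multiset ℂ, (∀ μ ∈ s, ‖μ‖ ≤ 1) → ‖s.sum‖ ≤ s.card := by
    intro s
    induction s using Multiset.induction with
    | empty => simp
    | cons a s ih =>
      intro hs
      rw [Multiset.sum_cons, Multiset.card_cons]
      have h1 := ih fun μ hμ => hs μ (Multiset.mem_cons_of_mem hμ)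
      have h2 := hs a (Multiset.mem_cons_self a s)
      push_cast
      linarith [norm_add_le a s.sum]
  have h2 := h1 f.charpoly.roots fun μ hμ => h μ <|
    (Module.End.hasEigenvalue_iff_isRoot_charpoly f μ).2 (Polynomial.isRoot_of_mem_roots hμ)
  have h3 : (f.charpoly.roots.card : ℝ) ≤ Module.finrank ℂ V := by
    rw [← LinearMap.charpoly_natDegree f]
    exact_mod_cast Polynomial.card_roots' _
  exact h2.trans h3

/-- **Burnside**: if a set of endomorphisms has no invariant subspaces, it generates the algebra
of endomorphisms. -/
theorem adjoin_eq_top_of_irreducible [Nontrivial V] (T : Set (Module.End ℂ V))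
    (h : ∀ W : Submodule ℂ V, (∀ f ∈ T, ∀ w ∈ W, f w ∈ W) → W = ⊥ ∨ W = ⊤) :
    Algebra.adjoin ℂ T = ⊤ := by
  set A := Algebra.adjoin ℂ T with hA
  have hsimple : IsSimpleModule A V := by
    rw [isSimpleModule_iff]
    refine ⟨fun W => ?_⟩
    have h1 := h (W.restrictScalars ℂ) fun f hf w hw =>
      W.smul_mem ⟨f, Algebra.subset_adjoin hf⟩ hw
    simpa using h1
  have hfin : Module.Finite (Module.End A V) V := by
    have : IsScalarTower ℂ (Module.End A V) V := inferInstance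
    exact Module.Finite.of_restrictScalars_finite ℂ _ _
  -- Jacobson density: `A` maps onto the endomorphisms that commute with `End_A V`. By Schur's lemma
  -- `End_A V = ℂ`, so every ℂ-linear `f` is one of these.
  have hsurj := Module.Finite.toModuleEnd_moduleEnd_surjective (R := A) (M := V)
  have hbij := IsSimpleModule.algebraMap_end_bijective_of_isAlgClosed ℂ (A := A) (V := V)
  rw [eq_top_iff]
  intro f _
  let f' : Module.End (Module.End A V) V :=
    { toFun := f
      map_add' := map_add f
      map_smul' := by
        intro c v
        obtain ⟨t, rfl⟩ := hbij.2 c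
        simp }
  obtain ⟨r, hr⟩ := hsurj f'
  have : f = r.1 := by
    ext v
    exact (congrArg (fun q : Module.End (Module.End A V) V => q v) hr).symm
  rw [this]
  exact r.2

/-- A group of endomorphisms whose eigenvalues have modulus at most one is block triangular in some
basis, with bounded diagonal blocks. -/
theorem exists_basis_block_triangular {G : Type*} [Group G] (k : ℕ) :
    ∀ {V : Type u} [AddCommGroup V] [Module ℂ V] [FiniteDimensional ℂ V],
      Module.finrank ℂ V ≤ k → ∀ (ρ : G →* Module.End ℂ V),
      (∀ g μ, (ρ g).HasEigenvalue μ → ‖μ‖ ≤ 1) →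
      ∃ (r : ℕ) (b : Module.Basis (Fin r) ℂ V) (d : Fin r → ℕ) (C : ℝ),
        (∀ g i j, d j < d i → b.repr (ρ g (b j)) i = 0) ∧
        (∀ g i j, d i = d j → ‖b.repr (ρ g (b j)) i‖ ≤ C) := by
  induction k with
  | zero =>
    intro V _ _ _ hk ρ hρ
    have h0 : Module.finrank ℂ V = 0 := by omega
    exact ⟨0, Module.finBasisOfFinrankEq ℂ V h0, fun _ => 0, 0, fun _ i => i.elim0,
      fun _ i => i.elim0⟩
  | succ k ih =>
    intro V _ _ _ hk ρ hρ
    by_cases hnt : Nontrivial V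
    swap
    · rw [not_nontrivial_iff_subsingleton] at hnt
      have h0 : Module.finrank ℂ V = 0 := Module.finrank_zero_of_subsingleton
      exact ⟨0, Module.finBasisOfFinrankEq ℂ V h0, fun _ => 0, 0, fun _ i => i.elim0,
        fun _ i => i.elim0⟩
    by_cases hirr : ∀ W : Submodule ℂ V, (∀ f ∈ range ρ, ∀ w ∈ W, f w ∈ W) → W = ⊥ ∨ W = ⊤
    · let b := Module.finBasis ℂ V
      have htop := adjoin_eq_top_of_irreducible (range ρ) hirr
      -- The image of a group is closed under products, so the algebra it generates is its linear
      -- span.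
      have hspan : Submodule.span ℂ (range ρ) = ⊤ := by
        have h1 : Submonoid.closure (range ρ) = MonoidHom.mrange ρ := by
          rw [← MonoidHom.coe_mrange, Submonoid.closure_eq]
        have h2 := Algebra.adjoin_eq_span ℂ (range ρ)
        rw [h1, MonoidHom.coe_mrange, htop] at h2
        rw [← h2]
        exact Algebra.top_toSubmodule
      -- For `X` in the image, `ρ g * X` is again in the image and its trace is at most the
      -- dimension; linearity extends a bound to all `X`. Matrix entries are such traces, against
      -- maps of rank one.
      have hbd : ∀ X : Module.End ℂ V, ∃ C : ℝ, ∀ g, ‖LinearMap.trace ℂ V (ρ g * X)‖ ≤ C := by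
        intro X
        have hX : X ∈ Submodule.span ℂ (range ρ) := hspan ▸ Submodule.mem_top
        induction hX using Submodule.span_induction with
        | mem x hx =>
          obtain ⟨h, rfl⟩ := hx
          refine ⟨Module.finrank ℂ V, fun g => ?_⟩
          rw [← map_mul]
          exact norm_trace_le_of_eigenvalues _ (hρ _)
        | zero => exact ⟨0, fun g => by simp⟩
        | add x y _ _ hx hy =>
          obtain ⟨C, hC⟩ := hx
          obtain ⟨D, hD⟩ := hy
          refine ⟨C + D, fun g => ?_⟩
          rw [mul_add, map_add]
          exact (norm_add_le _ _).trans (add_le_add (hC g) (hD g))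
        | smul c x _ hx =>
          obtain ⟨C, hC⟩ := hx
          refine ⟨‖c‖ * C, fun g => ?_⟩
          rw [mul_smul_comm, map_smul, norm_smul]
          exact mul_le_mul_of_nonneg_left (hC g) (norm_nonneg c)
      choose C hC using hbd
      refine ⟨_, b, fun _ => 0, ∑ i, ∑ j, |C ((b.coord i).smulRight (b j))|,
        fun g i j h => absurd h (lt_irrefl _), fun g i j _ => ?_⟩
      have h1 : b.repr (ρ g (b j)) i =
          LinearMap.trace ℂ V (ρ g * (b.coord i).smulRight (b j)) := by
        have : ρ g * (b.coord i).smulRight (b j) = (b.coord i).smulRight (ρ g (b j)) := by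
          ext v; simp
        rw [this, LinearMap.trace_smulRight]
        simp
      rw [h1]
      refine (hC _ g).trans ((le_abs_self _).trans ?_)
      refine (Finset.single_le_sum (f := fun j => |C ((b.coord i).smulRight (b j))|)
        (fun _ _ => abs_nonneg _) (Finset.mem_univ j)).trans ?_
      exact Finset.single_le_sum (f := fun i => ∑ j, |C ((b.coord i).smulRight (b j))|)
        (fun _ _ => Finset.sum_nonneg fun _ _ => abs_nonneg _) (Finset.mem_univ i)
    · push Not at hirr
      obtain ⟨W, hW, hbot, htop⟩ := hirr
      have hW' : ∀ g, W ≤ W.comap (ρ g) := fun g w hw => hW _ ⟨g, rfl⟩ w hw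
      let ρ₁ : G →* Module.End ℂ W :=
        { toFun := fun g => (ρ g).restrict (hW' g)
          map_one' := by ext; simp
          map_mul' := by intro g h; ext; simp }
      let ρ₂ : G →* Module.End ℂ (V ⧸ W) :=
        { toFun := fun g => W.mapQ W (ρ g) (hW' g)
          map_one' := by ext; simp
          map_mul' := by intro g h; ext; simp }
      have hf := Submodule.finrank_quotient_add_finrank W
      have hl1 : Module.finrank ℂ W < Module.finrank ℂ V := Submodule.finrank_lt htop
      have hl2 : 0 < Module.finrank ℂ W := by
        rw [Module.finrank_pos_iff, Submodule.nontrivial_iff_ne_bot]; exact hbot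
      have he1 : ∀ g μ, (ρ₁ g).HasEigenvalue μ → ‖μ‖ ≤ 1 := by
        intro g μ hμ
        obtain ⟨v, hv⟩ := hμ.exists_hasEigenvector
        refine hρ g μ (Module.End.hasEigenvalue_of_hasEigenvector (x := (v : V)) ⟨?_, ?_⟩)
        · rw [Module.End.mem_eigenspace_iff]
          exact congrArg Subtype.val hv.apply_eq_smul
        · simpa using hv.2
      -- If `ρ g - μ` is injective it is onto, hence onto on `V ⧸ W`, hence injective there: the
      -- quotient has no new eigenvalues.
      have he2 : ∀ g μ, (ρ₂ g).HasEigenvalue μ → ‖μ‖ ≤ 1 := by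
        intro g μ hμ
        by_contra hcon
        have hne : ¬ (ρ g).HasEigenvalue μ := fun h => hcon (hρ g μ h)
        have hker : LinearMap.ker (ρ g - algebraMap ℂ (Module.End ℂ V) μ) = ⊥ := by
          rw [Module.End.hasEigenvalue_iff, not_not, Module.End.eigenspace_def] at hne
          exact hne
        have hsurj := LinearMap.ker_eq_bot_iff_range_eq_top.1 hker
        have hsurj2 : LinearMap.range (ρ₂ g - algebraMap ℂ (Module.End ℂ (V ⧸ W)) μ) = ⊤ := by
          rw [LinearMap.range_eq_top] at hsurj ⊢
          intro y
          obtain ⟨y, rfl⟩ := W.mkQ_surjective y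
          obtain ⟨x, rfl⟩ := hsurj y
          exact ⟨W.mkQ x, by simp [ρ₂]⟩
        have hker2 := LinearMap.ker_eq_bot_iff_range_eq_top.2 hsurj2
        rw [Module.End.hasEigenvalue_iff, Module.End.eigenspace_def] at hμ
        exact hμ hker2
      obtain ⟨r₁, b₁, d₁, C₁, h11, h12⟩ := ih (by omega) ρ₁ he1
      obtain ⟨r₂, b₂, d₂, C₂, h21, h22⟩ := ih (by omega) ρ₂ he2
      -- Larger than every degree on `W`, so that the shifted degrees of the quotient come after all
      -- of them.
      let K := ∑ i, d₁ i + 1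
      have hK : ∀ i, d₁ i < K := fun i => Nat.lt_succ_of_le
        (Finset.single_le_sum (fun _ _ => Nat.zero_le _) (Finset.mem_univ i))
      let b := Module.Basis.sumQuot b₁ b₂
      let d : Fin r₁ ⊕ Fin r₂ → ℕ := Sum.elim d₁ fun j => K + d₂ j
      have e11 : ∀ g i j, b.repr (ρ g (b (Sum.inl j))) (Sum.inl i) = b₁.repr (ρ₁ g (b₁ j)) i := by
        intro g i j
        have hm : ρ g (b (Sum.inl j)) ∈ W := by
          rw [Module.Basis.sumQuot_inl]; exact hW' g (b₁ j).2
        rw [Module.Basis.sumQuot_repr_inl_of_mem _ _ _ hm]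
        congr 2
        apply Subtype.ext
        simp [ρ₁, b]
      have e21 : ∀ g i j, b.repr (ρ g (b (Sum.inl j))) (Sum.inr i) = 0 := by
        intro g i j
        have hm : ρ g (b (Sum.inl j)) ∈ W := by
          rw [Module.Basis.sumQuot_inl]; exact hW' g (b₁ j).2
        exact Module.Basis.sumQuot_repr_inr_of_mem _ _ _ hm _
      have e22 : ∀ g i j, b.repr (ρ g (b (Sum.inr j))) (Sum.inr i) = b₂.repr (ρ₂ g (b₂ j)) i := by
        intro g i j
        rw [Module.Basis.sumQuot_repr_inr, ← Module.Basis.sumQuot_inr b₁ b₂ j]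
        rfl
      have hmain : (∀ g i j, d j < d i → b.repr (ρ g (b j)) i = 0) ∧
          (∀ g i j, d i = d j → ‖b.repr (ρ g (b j)) i‖ ≤ max C₁ C₂) := by
        constructor
        · rintro g (i | i) (j | j) h
          · rw [e11]; exact h11 g i j h
          · have := hK i
            simp only [d, Sum.elim_inl, Sum.elim_inr] at h
            omega
          · exact e21 g i j
          · rw [e22]
            simp only [d, Sum.elim_inr] at h
            exact h21 g i j (by omega)
        · rintro g (i | i) (j | j) h
          · rw [e11]; exact (h12 g i j h).trans (le_max_left _ _)
          · have := hK i
            simp only [d, Sum.elim_inl, Sum.elim_inr] at h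
            omega
          · have := hK j
            simp only [d, Sum.elim_inl, Sum.elim_inr] at h
            omega
          · rw [e22]
            simp only [d, Sum.elim_inr] at h
            exact (h22 g i j (by omega)).trans (le_max_right _ _)
      let e : Fin r₁ ⊕ Fin r₂ ≃ Fin (r₁ + r₂) := finSumFinEquiv
      refine ⟨r₁ + r₂, b.reindex e, d ∘ e.symm, max C₁ C₂, fun g i j h => ?_, fun g i j h => ?_⟩
      · rw [Module.Basis.repr_reindex_apply, Module.Basis.reindex_apply]
        exact hmain.1 _ _ _ h
      · rw [Module.Basis.repr_reindex_apply, Module.Basis.reindex_apply]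
        exact hmain.2 _ _ _ h

end Flag

end Nilpotency

/-! ### The block filtration on matrices, scaling, and contraction of commutators. -/

section BlockMatrices

set_option linter.unusedSectionVars false

open scoped commutatorElement Matrix.Norms.Operator

variable {ι : Type*} [Fintype ι] [DecidableEq ι]

/-- The `k`-th block diagonal of a matrix whose indices have degrees. -/
def blockPart (d : ι → ℕ) (k : ℕ) (A : Matrix ι ι ℂ) : Matrix ι ι ℂ :=
  fun i j => if d j = d i + k then A i j else 0

/-- The matrix vanishes below its `k`-th block diagonal. -/
def BlockOrder (d : ι → ℕ) (k : ℕ) (A : Matrix ι ι ℂ) : Prop :=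
  ∀ i j, d j < d i + k → A i j = 0

variable {d : ι → ℕ} {k l : ℕ} {A B : Matrix ι ι ℂ}

lemma BlockOrder.mul (hA : BlockOrder d k A) (hB : BlockOrder d l B) :
    BlockOrder d (k + l) (A * B) := by
  intro i j h
  rw [Matrix.mul_apply]
  refine Finset.sum_eq_zero fun m _ => ?_
  by_cases h1 : d m < d i + k
  · rw [hA i m h1, zero_mul]
  · rw [hB m j (by omega), mul_zero]

lemma BlockOrder.sub (hA : BlockOrder d k A) (hB : BlockOrder d k B) :
    BlockOrder d k (A - B) := fun i j h => by
  rw [Matrix.sub_apply, hA i j h, hB i j h, sub_zero]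

lemma BlockOrder.one : BlockOrder d 0 (1 : Matrix ι ι ℂ) := fun i j h => by
  rw [Matrix.one_apply_ne]
  rintro rfl
  omega

lemma BlockOrder.succ (hA : BlockOrder d k A) (h0 : blockPart d k A = 0) :
    BlockOrder d (k + 1) A := by
  intro i j h
  by_cases h1 : d j < d i + k
  · exact hA i j h1
  · have := congrFun (congrFun h0 i) j
    rwa [blockPart, if_pos (by omega)] at this

/-- The leading part is multiplicative: if the total degree jump is exactly `k + l`, an intermediate
index whose first jump exceeds `k` leaves less than `l` for the second factor. -/
lemma blockPart_mul (hA : BlockOrder d k A) (hB : BlockOrder d l B) :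
    blockPart d (k + l) (A * B) = blockPart d k A * blockPart d l B := by
  ext i j
  rw [blockPart, Matrix.mul_apply, Matrix.mul_apply]
  by_cases h : d j = d i + (k + l)
  · rw [if_pos h]
    refine Finset.sum_congr rfl fun m _ => ?_
    rw [blockPart, blockPart]
    by_cases h1 : d m = d i + k
    · rw [if_pos h1, if_pos (by omega)]
    · rw [if_neg h1, zero_mul]
      by_cases h2 : d m < d i + k
      · rw [hA i m h2, zero_mul]
      · rw [hB m j (by omega), mul_zero]
  · rw [if_neg h]
    symm
    refine Finset.sum_eq_zero fun m _ => ?_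
    rw [blockPart, blockPart]
    by_cases h1 : d m = d i + k
    · rw [if_neg (by omega : ¬ d j = d m + l), mul_zero]
    · rw [if_neg h1, zero_mul]

lemma blockPart_sub : blockPart d k (A - B) = blockPart d k A - blockPart d k B := by
  ext i j
  simp only [blockPart, Matrix.sub_apply]
  split_ifs <;> simp

lemma blockPart_zero_one : blockPart d 0 (1 : Matrix ι ι ℂ) = 1 := by
  ext i j
  rw [blockPart]
  by_cases h : i = j
  · subst h; simp
  · rw [Matrix.one_apply_ne h]; simp

lemma norm_entry_le (A : Matrix ι ι ℂ) (i j : ι) : ‖A i j‖ ≤ ‖A‖ := by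
  rw [Matrix.linfty_opNorm_def]
  have h1 : ‖A i j‖₊ ≤ ∑ j, ‖A i j‖₊ :=
    Finset.single_le_sum (f := fun j => ‖A i j‖₊) (fun _ _ => zero_le) (Finset.mem_univ j)
  have h2 : ∑ j, ‖A i j‖₊ ≤ Finset.univ.sup fun i => ∑ j, ‖A i j‖₊ :=
    Finset.le_sup (f := fun i => ∑ j, ‖A i j‖₊) (Finset.mem_univ i)
  exact_mod_cast h1.trans h2

lemma norm_le_of_entry_le (A : Matrix ι ι ℂ) (C : ℝ) (hC : 0 ≤ C) (h : ∀ i j, ‖A i j‖ ≤ C) :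
    ‖A‖ ≤ Fintype.card ι * C := by
  lift C to NNReal using hC
  rw [Matrix.linfty_opNorm_def]
  have : (Finset.univ.sup fun i => ∑ j, ‖A i j‖₊) ≤ Fintype.card ι * C := by
    refine Finset.sup_le fun i _ => ?_
    refine (Finset.sum_le_card_nsmul _ _ C fun j _ => ?_).trans ?_
    · exact_mod_cast h i j
    · simp [nsmul_eq_mul]
  exact_mod_cast this

lemma norm_one_matrix_le : ‖(1 : Matrix ι ι ℂ)‖ ≤ 1 := by
  rw [← Matrix.diagonal_one, Matrix.linfty_opNorm_diagonal]
  exact (pi_norm_le_iff_of_nonneg zero_le_one).2 fun i => by simp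

/-- The conjugate of a matrix by the diagonal matrix with entries `t ^ d i`. -/
noncomputable def blockScale (d : ι → ℕ) (t : ℝ) (A : Matrix ι ι ℂ) : Matrix ι ι ℂ :=
  Matrix.diagonal (fun i => (t : ℂ) ^ d i) * A * Matrix.diagonal (fun i => ((t : ℂ) ^ d i)⁻¹)

lemma blockScale_apply (t : ℝ) (i j : ι) :
    blockScale d t A i j = (t : ℂ) ^ d i * A i j * ((t : ℂ) ^ d j)⁻¹ := by
  simp [blockScale, Matrix.mul_diagonal, Matrix.diagonal_mul]

lemma diagonal_inv_mul_diagonal {t : ℝ} (ht : t ≠ 0) :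
    Matrix.diagonal (fun i => ((t : ℂ) ^ d i)⁻¹) * Matrix.diagonal (fun i => (t : ℂ) ^ d i) =
      (1 : Matrix ι ι ℂ) := by
  rw [Matrix.diagonal_mul_diagonal, ← Matrix.diagonal_one]
  congr 1
  ext i
  have : (t : ℂ) ^ d i ≠ 0 := pow_ne_zero _ (by exact_mod_cast ht)
  field_simp

lemma diagonal_mul_diagonal_inv {t : ℝ} (ht : t ≠ 0) :
    Matrix.diagonal (fun i => (t : ℂ) ^ d i) * Matrix.diagonal (fun i => ((t : ℂ) ^ d i)⁻¹) =
      (1 : Matrix ι ι ℂ) := by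
  rw [Matrix.diagonal_mul_diagonal, ← Matrix.diagonal_one]
  congr 1
  ext i
  have : (t : ℂ) ^ d i ≠ 0 := pow_ne_zero _ (by exact_mod_cast ht)
  field_simp

lemma blockScale_mul {t : ℝ} (ht : t ≠ 0) :
    blockScale d t (A * B) = blockScale d t A * blockScale d t B := by
  simp only [blockScale]
  calc _ = Matrix.diagonal (fun i => (t : ℂ) ^ d i) * A * 1 * B *
        Matrix.diagonal (fun i => ((t : ℂ) ^ d i)⁻¹) := by simp only [mul_one, mul_assoc]
    _ = _ := by rw [← diagonal_inv_mul_diagonal (d := d) ht]; simp only [mul_assoc]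

lemma blockScale_one {t : ℝ} (ht : t ≠ 0) : blockScale d t (1 : Matrix ι ι ℂ) = 1 := by
  rw [blockScale, mul_one, diagonal_mul_diagonal_inv ht]

/-- For a fixed scale the distortion of norms is bounded, so discreteness survives the conjugation.
-/
lemma norm_le_blockScale {t : ℝ} (ht : t ≠ 0) (A : Matrix ι ι ℂ) :
    ‖A‖ ≤ ‖Matrix.diagonal (fun i => ((t : ℂ) ^ d i)⁻¹)‖ * ‖blockScale d t A‖ *
      ‖Matrix.diagonal (fun i => (t : ℂ) ^ d i)‖ := by
  have h : A = Matrix.diagonal (fun i => ((t : ℂ) ^ d i)⁻¹) * blockScale d t A *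
      Matrix.diagonal (fun i => (t : ℂ) ^ d i) := by
    simp only [blockScale]
    calc A = 1 * A * 1 := by simp
      _ = _ := by rw [← diagonal_inv_mul_diagonal (d := d) ht]; simp only [mul_assoc]
  conv_lhs => rw [h]
  exact (norm_mul_le _ _).trans (mul_le_mul_of_nonneg_right (norm_mul_le _ _) (norm_nonneg _))

/-- The entry `(i, j)` is multiplied by `t ^ (d i - d j)`: the diagonal blocks stay fixed and the
blocks above them die out as `t → ∞`. -/
lemma tendsto_blockScale (hA : BlockOrder d 0 A) :
    Tendsto (fun t : ℝ => blockScale d t A) atTop (𝓝 (blockPart d 0 A)) := by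
  have hcont : ∀ i j, Tendsto (fun t : ℝ => blockScale d t A i j) atTop
      (𝓝 (blockPart d 0 A i j)) := by
    intro i j
    simp only [blockScale_apply, blockPart, add_zero]
    rcases lt_trichotomy (d j) (d i) with h | h | h
    · rw [if_neg h.ne, hA i j h]; simp
    · rw [if_pos h]
      refine tendsto_const_nhds.congr' ?_
      filter_upwards [eventually_gt_atTop 0] with t ht
      have : (t : ℂ) ^ d i ≠ 0 := pow_ne_zero _ (by exact_mod_cast ht.ne')
      rw [h]; field_simp
    · rw [if_neg h.ne']
      obtain ⟨c, hc⟩ := Nat.exists_eq_add_of_lt h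
      have h1 : Tendsto (fun t : ℝ => ((t ^ (c + 1))⁻¹ : ℝ)) atTop (𝓝 0) :=
        tendsto_inv_atTop_zero.comp (tendsto_pow_atTop (by omega))
      have h2 : Tendsto (fun t : ℝ => A i j * (((t ^ (c + 1))⁻¹ : ℝ) : ℂ)) atTop (𝓝 0) := by
        have := (Complex.continuous_ofReal.tendsto 0).comp h1
        simpa using this.const_mul (A i j)
      refine h2.congr' ?_
      filter_upwards [eventually_gt_atTop 0] with t ht
      have h3 : (t : ℂ) ≠ 0 := by exact_mod_cast ht.ne'
      rw [hc]
      push_cast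
      field_simp
      ring
  exact tendsto_pi_nhds.2 fun i => tendsto_pi_nhds.2 fun j => hcont i j

/-- Conjugating by a matrix near one contracts towards the identity. -/
lemma norm_matrix_commutator_sub_one_le {a a' b b' : Matrix ι ι ℂ} (ha : a * a' = 1) (hb : b * b' = 1)
    (h1 : ‖a - 1‖ ≤ 1 / 8) (h2 : ‖b - 1‖ ≤ 1 / 8) :
    ‖a * b * a' * b' - 1‖ ≤ ‖b - 1‖ / 2 := by
  have hinv : ∀ x x' : Matrix ι ι ℂ, x * x' = 1 → ‖x - 1‖ ≤ 1 / 8 → ‖x'‖ ≤ 8 / 7 := by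
    intro x x' hx h
    -- This identity gives `‖x'‖ ≤ 1 + ‖x'‖ / 8`, whence the bound `8 / 7`.
    have h3 : x' = 1 - (x - 1) * x' := by rw [sub_mul, hx]; simp
    have h4 : ‖x'‖ ≤ 1 + 1 / 8 * ‖x'‖ := by
      conv_lhs => rw [h3]
      refine (norm_sub_le _ _).trans (add_le_add norm_one_matrix_le ?_)
      exact (norm_mul_le _ _).trans (mul_le_mul_of_nonneg_right h (norm_nonneg _))
    linarith
  have ha' := hinv a a' ha h1
  have hb' := hinv b b' hb h2
  have e1 : b * a * a' * b' = 1 := by rw [mul_assoc b, ha, mul_one, hb]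
  -- Up to the factor `a' * b'`, the deviation from one is the additive commutator of `a - 1` and `b
  -- - 1`, which is of second order. The constants work because `1/4 * (8/7)^2 < 1/2`.
  have e2 : a * b * a' * b' - 1 = ((a - 1) * (b - 1) - (b - 1) * (a - 1)) * a' * b' := by
    have e3 : ((a - 1) * (b - 1) - (b - 1) * (a - 1)) * a' * b' =
        a * b * a' * b' - b * a * a' * b' := by noncomm_ring
    rw [e3, e1]
  rw [e2]
  set x := ‖b - 1‖ with hx
  have hx0 : 0 ≤ x := norm_nonneg _
  have h5 : ‖(a - 1) * (b - 1) - (b - 1) * (a - 1)‖ ≤ 1 / 4 * x := by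
    refine (norm_sub_le _ _).trans ?_
    have h6 := norm_mul_le (a - 1) (b - 1)
    have h7 := norm_mul_le (b - 1) (a - 1)
    rw [← hx] at h6 h7
    nlinarith
  calc _ ≤ ‖(a - 1) * (b - 1) - (b - 1) * (a - 1)‖ * ‖a'‖ * ‖b'‖ :=
        (norm_mul_le _ _).trans (mul_le_mul_of_nonneg_right (norm_mul_le _ _) (norm_nonneg _))
    _ ≤ (1 / 4 * x) * (8 / 7) * (8 / 7) := by gcongr
    _ ≤ x / 2 := by linarith

end BlockMatrices

/-! ### Discrete block triangular groups with bounded diagonal are virtually nilpotent. -/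

section BlockGroups

open scoped commutatorElement Matrix.Norms.Operator

variable {ι : Type*} [Fintype ι] [DecidableEq ι] {d : ι → ℕ}
  {G : Type*} [Group G] {φ : G →* Matrix ι ι ℂ}

lemma map_mul_map_inv (φ : G →* Matrix ι ι ℂ) (g : G) : φ g * φ g⁻¹ = 1 := by
  rw [← map_mul, mul_inv_cancel, map_one]

lemma map_inv_mul_map (φ : G →* Matrix ι ι ℂ) (g : G) : φ g⁻¹ * φ g = 1 := by
  rw [← map_mul, inv_mul_cancel, map_one]

/-- The diagonal blocks of a block triangular group of matrices. -/
def diagonalHom (d : ι → ℕ) (φ : G →* Matrix ι ι ℂ) (hφ : ∀ g, BlockOrder d 0 (φ g)) :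
    G →* Matrix ι ι ℂ where
  toFun g := blockPart d 0 (φ g)
  map_one' := by rw [map_one, blockPart_zero_one]
  map_mul' g h := by
    rw [map_mul]
    exact blockPart_mul (hφ g) (hφ h)

/-- In a discrete block triangular group, iterated commutators with a fixed element are
eventually trivial, if the diagonal blocks are near the identity. -/
lemma exists_iterate_commutator_eq_one (hφ : ∀ g, BlockOrder d 0 (φ g))
    (hinj : Function.Injective φ) (hdisc : ∀ R : ℝ, {g : G | ‖φ g‖ ≤ R}.Finite) {s c : G}
    (hs : ‖blockPart d 0 (φ s) - 1‖ < 1 / 8) (hc : ‖blockPart d 0 (φ c) - 1‖ < 1 / 8) :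
    ∃ k, (fun x => ⁅s, x⁆)^[k] c = 1 := by
  have hev : ∀ g, ‖blockPart d 0 (φ g) - 1‖ < 1 / 8 →
      ∀ᶠ t : ℝ in atTop, ‖blockScale d t (φ g) - 1‖ < 1 / 8 := by
    intro g hg
    exact (((tendsto_blockScale (hφ g)).sub_const 1).norm).eventually_lt_const hg
  -- A large scale brings both elements within `1/8` of one, however large their blocks off the
  -- diagonal are.
  obtain ⟨t, ht1, ht2, ht0⟩ := ((hev s hs).and ((hev c hc).and (eventually_gt_atTop 0))).exists
  set ψ : G → Matrix ι ι ℂ := fun g => blockScale d t (φ g) with hψ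
  have hψm : ∀ g h, ψ (g * h) = ψ g * ψ h := fun g h => by
    simp only [hψ]; rw [map_mul, blockScale_mul ht0.ne']
  have hψ1 : ψ 1 = 1 := by simp only [hψ]; rw [map_one, blockScale_one ht0.ne']
  have hψi : ∀ g, ψ g * ψ g⁻¹ = 1 := fun g => by rw [← hψm, mul_inv_cancel, hψ1]
  have hψinj : ∀ g, ψ g = 1 → g = 1 := by
    intro g hg
    apply hinj
    have h1 := norm_le_blockScale (d := d) ht0.ne' (φ g - φ 1)
    have h2 : blockScale d t (φ g - φ 1) = ψ g - ψ 1 := by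
      simp only [hψ, blockScale, mul_sub, sub_mul]
    rw [h2, hg, hψ1, sub_self, norm_zero, mul_zero, zero_mul] at h1
    exact sub_eq_zero.1 (norm_eq_zero.1 (le_antisymm h1 (norm_nonneg _)))
  have hfin : {g : G | ‖ψ g - 1‖ ≤ 1 / 8}.Finite := by
    refine (hdisc (‖Matrix.diagonal (fun i => ((t : ℂ) ^ d i)⁻¹)‖ * 2 *
      ‖Matrix.diagonal (fun i => (t : ℂ) ^ d i)‖)).subset fun g hg => ?_
    refine (norm_le_blockScale (d := d) ht0.ne' (φ g)).trans ?_
    have h1 : ‖ψ g‖ ≤ 2 := by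
      have h2 : ψ g = (ψ g - 1) + 1 := by abel
      rw [h2]
      refine (norm_add_le _ _).trans ?_
      have h3 : ‖ψ g - 1‖ ≤ 1 / 8 := hg
      have h4 := norm_one_matrix_le (ι := ι)
      linarith
    gcongr
  have hiter : ∀ k, ‖ψ ((fun x => ⁅s, x⁆)^[k] c) - 1‖ ≤ (1 / 2) ^ k * (1 / 8) := by
    intro k
    induction k with
    | zero => simpa using ht2.le
    | succ k ih =>
      rw [Function.iterate_succ_apply']
      set x := (fun x => ⁅s, x⁆)^[k] c
      have h8 : ‖ψ x - 1‖ ≤ 1 / 8 := ih.trans (by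
        have : (1 / 2 : ℝ) ^ k ≤ 1 := pow_le_one₀ (by norm_num) (by norm_num)
        linarith)
      have := norm_matrix_commutator_sub_one_le (hψi s) (hψi x) ht1.le h8
      rw [commutatorElement_def, hψm, hψm, hψm]
      rw [pow_succ]
      linarith
  -- Only finitely many elements are that near to one, so their distances to one are zero or bounded
  -- below. Iterates whose distance halves at every step must reach the identity.
  have hpos : ∃ ε > 0, ∀ g, ‖ψ g - 1‖ ≤ 1 / 8 → ‖ψ g - 1‖ < ε → ψ g = 1 := by
    have hfin2 := (hfin.image fun g => ‖ψ g - 1‖).sdiff (t := {0})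
    have hopen := hfin2.isClosed.isOpen_compl.mem_nhds (x := (0 : ℝ)) (by simp)
    obtain ⟨ε, hε, hb⟩ := Metric.mem_nhds_iff.1 hopen
    refine ⟨ε, hε, fun g hg1 hg2 => ?_⟩
    by_contra hne
    have h1 : ‖ψ g - 1‖ ∈ Metric.ball (0 : ℝ) ε := by simpa using hg2
    refine hb h1 ⟨⟨g, hg1, rfl⟩, ?_⟩
    simpa [sub_eq_zero] using hne
  obtain ⟨ε, hε, hgap⟩ := hpos
  have hlim : Tendsto (fun k : ℕ => (1 / 2 : ℝ) ^ k * (1 / 8)) atTop (𝓝 0) := by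
    have h := (tendsto_pow_atTop_nhds_zero_of_lt_one (r := (1 / 2 : ℝ)) (by norm_num)
      (by norm_num)).mul_const (1 / 8)
    rwa [zero_mul] at h
  obtain ⟨k, hk⟩ := (hlim.eventually_lt_const hε).exists
  refine ⟨k, hψinj _ (hgap _ ((hiter k).trans ?_) ((hiter k).trans_lt hk))⟩
  have : (1 / 2 : ℝ) ^ k ≤ 1 := pow_le_one₀ (by norm_num) (by norm_num)
  linarith

/-- If a commuting pair `a`, `[a, b]` is power bounded and `b` is near one, then `[a, b] = 1`. -/
lemma commutator_eq_one_of_commute (φ : G →* Matrix ι ι ℂ) {C : ℝ} (hC : ∀ g, ‖φ g‖ ≤ C)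
    {a b : G} (hb : C * C * ‖φ b - 1‖ < 1) (h : φ ⁅a, ⁅a, b⁆⁆ = 1) : φ ⁅a, b⁆ = 1 := by
  set c := ⁅a, b⁆ with hc
  have hC0 : 0 ≤ C := (norm_nonneg _).trans (hC 1)
  have hcomm : φ a * φ c = φ c * φ a := by
    have h1 : φ (⁅a, c⁆ * (c * a)) = φ (c * a) := by rw [map_mul, h, one_mul]
    rw [commutatorElement_def] at h1
    rw [← map_mul, ← map_mul, ← h1]
    congr 1
    group
  have hab : φ a * φ b = φ c * φ b * φ a := by
    rw [← map_mul, ← map_mul, ← map_mul, hc, commutatorElement_def]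
    congr 1
    group
  have hpow : ∀ k : ℕ, φ a ^ k * φ b = φ c ^ k * φ b * φ a ^ k := by
    intro k
    induction k with
    | zero => simp
    | succ k ih =>
      have h2 : φ a * φ c ^ k = φ c ^ k * φ a := (Commute.pow_right hcomm k).eq
      calc φ a ^ (k + 1) * φ b = φ a * (φ a ^ k * φ b) := by rw [pow_succ', mul_assoc]
        _ = φ a * φ c ^ k * φ b * φ a ^ k := by rw [ih]; simp only [mul_assoc]
        _ = φ c ^ k * (φ a * φ b) * φ a ^ k := by rw [h2]; simp only [mul_assoc]
        _ = φ c ^ (k + 1) * φ b * φ a ^ (k + 1) := by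
          rw [hab, pow_succ (φ c), pow_succ' (φ a)]; simp only [mul_assoc]
  -- `φ c ^ k * φ b` is the conjugate of `φ b` by `φ (a ^ k)`, so it stays near one uniformly in
  -- `k`.
  have hterm : ∀ k : ℕ, ‖φ c ^ k * φ b - 1‖ ≤ C * C * ‖φ b - 1‖ := by
    intro k
    have h1 : φ c ^ k * φ b - 1 = φ (a ^ k) * (φ b - 1) * φ (a ^ k)⁻¹ := by
      rw [mul_sub, sub_mul, mul_one, map_mul_map_inv]
      congr 1
      calc φ c ^ k * φ b = φ c ^ k * φ b * (φ (a ^ k) * φ (a ^ k)⁻¹) := by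
            rw [map_mul_map_inv, mul_one]
        _ = φ (a ^ k) * φ b * φ (a ^ k)⁻¹ := by
            rw [map_pow φ a k, hpow k]; simp only [mul_assoc]
    rw [h1]
    calc _ ≤ ‖φ (a ^ k)‖ * ‖φ b - 1‖ * ‖φ (a ^ k)⁻¹‖ :=
          (norm_mul_le _ _).trans (mul_le_mul_of_nonneg_right (norm_mul_le _ _) (norm_nonneg _))
      _ ≤ C * ‖φ b - 1‖ * C := by
          have := hC (a ^ k); have := hC (a ^ k)⁻¹
          gcongr
      _ = _ := by ring
  have hsum : ∀ n : ℕ, ‖(∑ k ∈ Finset.range n, φ c ^ k) * φ b - (n : ℂ) • (1 : Matrix ι ι ℂ)‖ ≤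
      n * (C * C * ‖φ b - 1‖) := by
    intro n
    have h1 : (∑ k ∈ Finset.range n, φ c ^ k) * φ b - (n : ℂ) • (1 : Matrix ι ι ℂ) =
        ∑ k ∈ Finset.range n, (φ c ^ k * φ b - 1) := by
      rw [Finset.sum_sub_distrib, Finset.sum_mul]
      simp [← Nat.cast_smul_eq_nsmul ℂ]
    rw [h1]
    refine (norm_sum_le_of_le _ fun k _ => hterm k).trans ?_
    simp
  -- With this `y` the geometric sum telescopes: `(∑ φ c ^ k) * φ b * y = φ c ^ n - 1` is bounded,
  -- while `(∑ φ c ^ k) * φ b` is `n` up to an error `n * δ` with `δ < 1`. Hence `n * (1 - δ) * ‖y‖`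
  -- is bounded in `n`, and `y = 0`.
  set y := φ b⁻¹ * (φ c - 1) with hy
  set δ := C * C * ‖φ b - 1‖ with hδ
  have hbound : ∀ n : ℕ, n * ‖y‖ ≤ n * δ * ‖y‖ + 2 * C := by
    intro n
    have h1 : (n : ℂ) • y = (∑ k ∈ Finset.range n, φ c ^ k) * φ b * y -
        ((∑ k ∈ Finset.range n, φ c ^ k) * φ b - (n : ℂ) • (1 : Matrix ι ι ℂ)) * y := by
      rw [sub_mul, smul_mul_assoc, one_mul]; abel
    have h2 : (∑ k ∈ Finset.range n, φ c ^ k) * φ b * y = φ (c ^ n) - φ 1 := by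
      rw [hy, mul_assoc, ← mul_assoc (φ b), map_mul_map_inv, one_mul, geom_sum_mul, map_pow,
        map_one]
    have h3 : ‖(n : ℂ) • y‖ = n * ‖y‖ := by rw [norm_smul]; simp
    rw [← h3, h1, h2]
    refine (norm_sub_le _ _).trans ?_
    have h4 : ‖φ (c ^ n) - φ 1‖ ≤ 2 * C := by
      refine (norm_sub_le _ _).trans ?_
      linarith [hC (c ^ n), hC 1]
    have h5 := (norm_mul_le ((∑ k ∈ Finset.range n, φ c ^ k) * φ b -
      (n : ℂ) • (1 : Matrix ι ι ℂ)) y).trans (mul_le_mul_of_nonneg_right (hsum n) (norm_nonneg y))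
    linarith
  have hy0 : ‖y‖ = 0 := by
    by_contra hne
    have hpos : 0 < ‖y‖ := lt_of_le_of_ne (norm_nonneg _) (Ne.symm hne)
    obtain ⟨n, hn⟩ := exists_nat_gt (2 * C / ((1 - δ) * ‖y‖))
    rw [div_lt_iff₀ (mul_pos (by linarith) hpos)] at hn
    have := hbound n
    nlinarith
  have h6 : φ c - 1 = φ b * y := by rw [hy, ← mul_assoc, map_mul_map_inv, one_mul]
  rw [norm_eq_zero.1 hy0, mul_zero] at h6
  exact sub_eq_zero.1 h6

/-- Leading terms of commutators. -/
lemma blockPart_commutator (hφ : ∀ g, BlockOrder d 0 (φ g)) {j : ℕ} {s c : G}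
    (hc : BlockOrder d j (φ c - 1)) (hc0 : blockPart d 0 (φ c⁻¹) = 1) :
    BlockOrder d j (φ ⁅s, c⁆ - 1) ∧ blockPart d j (φ ⁅s, c⁆ - 1) =
      blockPart d 0 (φ s) * blockPart d j (φ c - 1) * blockPart d 0 (φ s⁻¹) -
        blockPart d j (φ c - 1) := by
  -- The right factor `φ c⁻¹` has diagonal part one and does not affect the leading part.
  have e : φ ⁅s, c⁆ - 1 = (φ s * (φ c - 1) * φ s⁻¹ - (φ c - 1)) * φ c⁻¹ := by
    rw [commutatorElement_def, map_mul, map_mul, map_mul, sub_mul, mul_sub, sub_mul, mul_one,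
      map_mul_map_inv, sub_mul, sub_mul, map_mul_map_inv, one_mul]
    abel
  have h1 : BlockOrder d j (φ s * (φ c - 1)) := by simpa using (hφ s).mul hc
  have h2 : BlockOrder d j (φ s * (φ c - 1) * φ s⁻¹) := h1.mul (hφ s⁻¹)
  have h3 := h2.sub hc
  rw [e]
  refine ⟨h3.mul (hφ c⁻¹), ?_⟩
  rw [show j = j + 0 from rfl, blockPart_mul h3 (hφ c⁻¹), hc0, mul_one]
  simp only [add_zero]
  rw [blockPart_sub]
  congr 1
  have e1 := blockPart_mul (k := j) (l := 0) h1 (hφ s⁻¹)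
  rw [add_zero] at e1
  have e2 := blockPart_mul (k := 0) (l := j) (hφ s) hc
  rw [zero_add] at e2
  rw [e1, e2]

/-- A discrete block triangular group with bounded diagonal blocks is virtually nilpotent. -/
theorem isVirtuallyNilpotent_of_block (hφ : ∀ g, BlockOrder d 0 (φ g))
    (hinj : Function.Injective φ) (hdisc : ∀ R : ℝ, {g : G | ‖φ g‖ ≤ R}.Finite) {C : ℝ}
    (hC : ∀ g, ‖blockPart d 0 (φ g)‖ ≤ C) : Group.IsVirtuallyNilpotent G := by
  set ρ := diagonalHom d φ hφ with hρ
  have hρC : ∀ g, ‖ρ g‖ ≤ max C 1 := fun g => (hC g).trans (le_max_left _ _)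
  set D := max C 1 with hD
  have hD1 : 1 ≤ D := le_max_right _ _
  -- Then `D * D * δ < 1`, as `commutator_eq_one_of_commute` requires, and `δ ≤ 1/8`, as the
  -- contraction requires.
  set δ := 1 / (8 * (D * D)) with hδ
  have hδ0 : 0 < δ := by positivity
  have hDδ : D * D * δ = 1 / 8 := by rw [hδ]; field_simp
  have hδ8 : δ ≤ 1 / 8 := by
    have h1 : 1 ≤ D * D := by nlinarith
    nlinarith
  set S : Set G := {g | ‖ρ g - 1‖ < δ} with hS
  -- The iterated commutators `x k` of `c` with `s` reach `1`. Since `x (k + 2) = ⁅s, ⁅s, x k⁆⁆`,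
  -- triviality of `ρ` descends one index at a time, down to `x 1 = ⁅s, c⁆`.
  have hiter0 : ∀ s ∈ S, ∀ c ∈ S, ρ ⁅s, c⁆ = 1 := by
    intro s hs c hc
    obtain ⟨k, hk⟩ := exists_iterate_commutator_eq_one hφ hinj hdisc (s := s) (c := c)
      (lt_of_lt_of_le hs hδ8) (lt_of_lt_of_le hc hδ8)
    set x : ℕ → G := fun k => (fun x => ⁅s, x⁆)^[k] c with hx
    have hxs : ∀ k, x (k + 1) = ⁅s, x k⁆ := fun k => Function.iterate_succ_apply' _ _ _
    have hx8 : ∀ k, ‖ρ (x k) - 1‖ < δ := by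
      intro k
      induction k with
      | zero => exact hc
      | succ k ih =>
        rw [hxs, commutatorElement_def, map_mul, map_mul, map_mul]
        have := norm_matrix_commutator_sub_one_le (map_mul_map_inv ρ s)
          (map_mul_map_inv ρ (x k)) (le_of_lt (lt_of_lt_of_le hs hδ8))
          (le_of_lt (lt_of_lt_of_le ih hδ8))
        have := norm_nonneg (ρ (x k) - 1)
        linarith
    have hdown : ∀ k, ρ (x (k + 2)) = 1 → ρ (x (k + 1)) = 1 := by
      intro k h
      rw [hxs]
      refine commutator_eq_one_of_commute ρ hρC ?_ (by rw [← hxs, ← hxs]; exact h)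
      calc D * D * ‖ρ (x k) - 1‖ ≤ D * D * δ := by
            have := (hx8 k).le
            gcongr
        _ < 1 := by rw [hDδ]; norm_num
    have hall : ∀ k, ρ (x (k + 1)) = 1 → ρ (x 1) = 1 := by
      intro k
      induction k with
      | zero => exact id
      | succ k ih => exact fun h => ih (hdown k h)
    refine hall k ?_
    rw [hxs]
    have : x k = 1 := hk
    rw [this, commutatorElement_one_right, map_one]
  -- On leading parts, taking the commutator with `s` is `X ↦ ρ s * X * ρ s⁻¹ - X`. Some iterate of
  -- it kills the leading part `X 0` of `c`, and boundedness of `ρ` shows that the first one already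
  -- does.
  have hlevel : ∀ j ≥ 1, ∀ s ∈ S, ∀ c, BlockOrder d j (φ c - 1) →
      BlockOrder d (j + 1) (φ ⁅s, c⁆ - 1) := by
    intro j hj s hs c hc
    have hone : ∀ c, BlockOrder d j (φ c - 1) → ρ c = 1 := by
      intro c hc
      have h1 : blockPart d 0 (φ c - 1) = 0 := by
        ext i m
        rw [blockPart]
        split_ifs with h
        · exact hc i m (by omega)
        · rfl
      rw [blockPart_sub, blockPart_zero_one, sub_eq_zero] at h1
      exact h1
    have hone' : ∀ c, BlockOrder d j (φ c - 1) → blockPart d 0 (φ c⁻¹) = 1 := by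
      intro c hc
      have h1 : ρ c⁻¹ = 1 := by
        have h2 := map_mul_map_inv ρ c
        rwa [hone c hc, one_mul] at h2
      exact h1
    obtain ⟨k, hk⟩ := exists_iterate_commutator_eq_one hφ hinj hdisc (s := s) (c := c)
      (lt_of_lt_of_le hs hδ8) (by
        have : blockPart d 0 (φ c) = 1 := hone c hc
        rw [this]; simp)
    set x : ℕ → G := fun k => (fun x => ⁅s, x⁆)^[k] c with hx
    have hxs : ∀ k, x (k + 1) = ⁅s, x k⁆ := fun k => Function.iterate_succ_apply' _ _ _
    have hord : ∀ k, BlockOrder d j (φ (x k) - 1) := by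
      intro k
      induction k with
      | zero => exact hc
      | succ k ih => rw [hxs]; exact (blockPart_commutator hφ ih (hone' _ ih)).1
    set X : ℕ → Matrix ι ι ℂ := fun k => blockPart d j (φ (x k) - 1) with hX
    have hXs : ∀ k, X (k + 1) = ρ s * X k * ρ s⁻¹ - X k := by
      intro k
      simp only [hX]
      rw [hxs]
      exact (blockPart_commutator hφ (hord k) (hone' _ (hord k))).2
    have hdown : ∀ k, X (k + 2) = 0 → X (k + 1) = 0 := by
      intro k h
      have h1 : ρ s * X (k + 1) * ρ s⁻¹ = X (k + 1) := by
        rw [hXs (k + 1), sub_eq_zero] at h; exact h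
      -- Conjugation by `ρ s` acts unipotently on `X k` and `X (k + 1)`, so its powers grow linearly
      -- unless `X (k + 1) = 0`; boundedness of `ρ` excludes growth.
      have h2 : ∀ n : ℕ, ρ (s ^ n) * X k * ρ (s ^ n)⁻¹ = X k + (n : ℂ) • X (k + 1) := by
        intro n
        induction n with
        | zero => simp
        | succ n ih =>
          have e1 : ρ (s ^ (n + 1)) = ρ s * ρ (s ^ n) := by rw [← map_mul, pow_succ']
          have e2 : ρ (s ^ (n + 1))⁻¹ = ρ (s ^ n)⁻¹ * ρ s⁻¹ := by
            rw [← map_mul, pow_succ', mul_inv_rev]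
          have e3 : ρ s * X k * ρ s⁻¹ = X k + X (k + 1) := by rw [hXs k]; abel
          calc _ = ρ s * (ρ (s ^ n) * X k * ρ (s ^ n)⁻¹) * ρ s⁻¹ := by
                rw [e1, e2]; simp only [mul_assoc]
            _ = _ := by
                rw [ih, mul_add, add_mul, e3, mul_smul_comm, smul_mul_assoc, h1]
                push_cast
                rw [add_smul, one_smul]
                abel
      have h3 : ∀ n : ℕ, n * ‖X (k + 1)‖ ≤ D * ‖X k‖ * D + ‖X k‖ := by
        intro n
        have e1 : (n : ℂ) • X (k + 1) = ρ (s ^ n) * X k * ρ (s ^ n)⁻¹ - X k := by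
          rw [h2]; abel
        have e2 : ‖(n : ℂ) • X (k + 1)‖ = n * ‖X (k + 1)‖ := by rw [norm_smul]; simp
        rw [← e2, e1]
        refine (norm_sub_le _ _).trans (add_le_add_left ?_ _)
        refine (norm_mul_le _ _).trans ?_
        have := norm_mul_le (ρ (s ^ n)) (X k)
        have := hρC (s ^ n); have := hρC (s ^ n)⁻¹
        calc _ ≤ (‖ρ (s ^ n)‖ * ‖X k‖) * ‖ρ (s ^ n)⁻¹‖ := by gcongr
          _ ≤ _ := by gcongr
      by_contra hne
      have hpos : 0 < ‖X (k + 1)‖ := norm_pos_iff.2 hne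
      obtain ⟨n, hn⟩ := exists_nat_gt ((D * ‖X k‖ * D + ‖X k‖) / ‖X (k + 1)‖)
      rw [div_lt_iff₀ hpos] at hn
      linarith [h3 n]
    have hall : ∀ k, X (k + 1) = 0 → X 1 = 0 := by
      intro k
      induction k with
      | zero => exact id
      | succ k ih => exact fun h => ih (hdown k h)
    have hX1 : X 1 = 0 := by
      refine hall k ?_
      have h1 : x k = 1 := hk
      simp only [hX]
      rw [hxs, h1, commutatorElement_one_right, map_one, sub_self]
      ext i m
      simp [blockPart]
    exact (hord 1).succ hX1
  have hW : ∀ j, iteratedCommutators S (j + 1) ⊆ {g | BlockOrder d (j + 1) (φ g - 1)} := by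
    intro j
    induction j with
    | zero =>
      rintro x ⟨s, hs, c, hc, rfl⟩
      refine BlockOrder.succ ((hφ _).sub BlockOrder.one) ?_
      rw [blockPart_sub, blockPart_zero_one, sub_eq_zero]
      exact hiter0 s hs c hc
    | succ j ih =>
      rintro x ⟨s, hs, c, hc, rfl⟩
      exact hlevel (j + 1) (by omega) s hs c (ih hc)
  -- No degree exceeds `K`, so a matrix of block order `K + 1` is zero.
  set K := ∑ i, d i with hK
  have htriv : iteratedCommutators S (K + 1) ⊆ {1} := by
    intro g hg
    have h1 := hW K hg
    apply hinj
    rw [map_one, ← sub_eq_zero]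
    ext i j
    refine h1 i j ?_
    have : d j ≤ K := Finset.single_le_sum (fun _ _ => Nat.zero_le _) (Finset.mem_univ j)
    omega
  refine ⟨Subgroup.closure S, ?_, ?_⟩
  · refine isNilpotent_of_iteratedCommutators_trivial (K + 1)
      (((↑) : Subgroup.closure S → G) ⁻¹' S) Subgroup.closure_closure_coe_preimage ?_
    have hsub : ∀ j, iteratedCommutators (((↑) : Subgroup.closure S → G) ⁻¹' S) j ⊆
        ((↑) : Subgroup.closure S → G) ⁻¹' iteratedCommutators S j := by
      intro j
      induction j with
      | zero => exact subset_rfl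
      | succ j ih =>
        rintro x ⟨s, hs, c, hc, rfl⟩
        exact ⟨s, hs, c, ih hc, rfl⟩
    intro x hx
    exact Subtype.ext (htriv (hsub _ hx))
  -- Finite index: the bounded set `range ρ` has a finite net of mesh `δ / D / 2`. Elements near the
  -- same net point differ by an element of `S`, because `ρ (g⁻¹ * h) - 1 = ρ g⁻¹ * (ρ h - ρ g)`.
  · have htb : TotallyBounded (range ρ) := by
      have : range ρ ⊆ Metric.closedBall 0 D := by
        rintro _ ⟨g, rfl⟩
        simpa using hρC g
      have hproper : ProperSpace (Matrix ι ι ℂ) := FiniteDimensional.proper ℂ _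
      exact (isCompact_closedBall _ _).totallyBounded.subset this
    have hε : 0 < δ / D := by positivity
    obtain ⟨t, htfin, ht⟩ := Metric.totallyBounded_iff.1 htb (δ / D / 2) (by positivity)
    have hch : ∀ g, ∃ y ∈ t, dist (ρ g) y < δ / D / 2 := by
      intro g
      have := ht (mem_range_self g)
      simpa using this
    choose y hyt hyd using hch
    have key : ∀ g h, y g = y h → g⁻¹ * h ∈ Subgroup.closure S := by
      intro g h hgh
      apply Subgroup.subset_closure
      have h1 : ‖ρ h - ρ g‖ < δ / D := by
        rw [← dist_eq_norm]
        have e1 := hyd g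
        have e2 := hyd h
        rw [← hgh] at e2
        have := dist_triangle_right (ρ h) (ρ g) (y g)
        linarith
      have h2 : ρ (g⁻¹ * h) - 1 = ρ g⁻¹ * (ρ h - ρ g) := by
        rw [mul_sub, map_inv_mul_map, map_mul]
      change ‖ρ (g⁻¹ * h) - 1‖ < δ
      rw [h2]
      calc _ ≤ ‖ρ g⁻¹‖ * ‖ρ h - ρ g‖ := norm_mul_le _ _
        _ ≤ D * ‖ρ h - ρ g‖ := by gcongr; exact hρC _
        _ < D * (δ / D) := by gcongr
        _ = δ := by field_simp
    rw [Subgroup.finiteIndex_iff_finite_quotient]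
    have : Finite t := htfin
    refine Finite.of_injective
      (fun q : G ⧸ Subgroup.closure S => (⟨y q.out, hyt _⟩ : t)) fun q q' hqq => ?_
    have h1 := key _ _ (congrArg Subtype.val hqq)
    rw [← QuotientGroup.out_eq' q, ← QuotientGroup.out_eq' q']
    exact QuotientGroup.eq.2 h1

end BlockGroups

open scoped Matrix.Norms.Operator in
/-- A discrete group of matrices all of whose eigenvalues have modulus at most one is virtually
nilpotent. -/
theorem isVirtuallyNilpotent_of_eigenvalues {ι : Type} [Fintype ι] [DecidableEq ι]
    {G : Type*} [Group G] (φ : G →* Matrix ι ι ℂ) (hinj : Function.Injective φ)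
    (hdisc : ∀ R : ℝ, {g : G | ∀ i j, ‖φ g i j‖ ≤ R}.Finite)
    (heig : ∀ g μ, Module.End.HasEigenvalue (Matrix.toLin' (φ g)) μ → ‖μ‖ ≤ 1) :
    Group.IsVirtuallyNilpotent G := by
  let ρ : G →* Module.End ℂ (ι → ℂ) :=
    (Matrix.toLinAlgEquiv' : Matrix ι ι ℂ ≃ₐ[ℂ] _).toAlgHom.toMonoidHom.comp φ
  have hρ : ∀ g, ρ g = Matrix.toLin' (φ g) := fun g => rfl
  obtain ⟨r, b, d, C, h1, h2⟩ := exists_basis_block_triangular _ (le_refl _) ρ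
    fun g μ hμ => heig g μ (hρ g ▸ hμ)
  let ψ : G →* Matrix (Fin r) (Fin r) ℂ :=
    (LinearMap.toMatrixAlgEquiv b).toAlgHom.toMonoidHom.comp ρ
  have hψ : ∀ g i j, ψ g i j = b.repr (ρ g (b j)) i := fun g i j =>
    LinearMap.toMatrixAlgEquiv_apply b (ρ g) i j
  have hρinj : Function.Injective ρ :=
    (Matrix.toLinAlgEquiv' : Matrix ι ι ℂ ≃ₐ[ℂ] _).injective.comp hinj
  refine isVirtuallyNilpotent_of_block (d := d) (φ := ψ) (C := r * max C 0) ?_ ?_ ?_ ?_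
  · intro g i j h
    rw [hψ]
    exact h1 g i j (by omega)
  · exact (LinearMap.toMatrixAlgEquiv b).injective.comp hρinj
  · intro R
    -- `T` undoes the change of basis. It is linear, hence bounded, and carries the finiteness
    -- hypothesis to the new basis.
    let T : Matrix (Fin r) (Fin r) ℂ →ₗ[ℂ] Matrix ι ι ℂ :=
      LinearMap.toMatrix'.toLinearMap ∘ₗ (LinearMap.toMatrixAlgEquiv b).symm.toLinearMap
    have hT : ∀ g, T (ψ g) = φ g := by
      intro g
      have : (LinearMap.toMatrixAlgEquiv b).symm (ψ g) = ρ g :=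
        (LinearMap.toMatrixAlgEquiv b).symm_apply_apply (ρ g)
      change LinearMap.toMatrix' ((LinearMap.toMatrixAlgEquiv b).symm (ψ g)) = φ g
      rw [this, hρ, LinearMap.toMatrix'_toLin']
    have hTb : ∀ X, ‖T X‖ ≤ (∑ k, ∑ l, ‖T (Matrix.single k l 1)‖) * ‖X‖ := by
      intro X
      have h1 : T X = ∑ k, ∑ l, X k l • T (Matrix.single k l 1) := by
        conv_lhs => rw [Matrix.matrix_eq_sum_single X]
        rw [map_sum]
        refine Finset.sum_congr rfl fun k _ => ?_
        rw [map_sum]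
        refine Finset.sum_congr rfl fun l _ => ?_
        rw [← map_smul, Matrix.smul_single, smul_eq_mul, mul_one]
      rw [h1, Finset.sum_mul]
      refine norm_sum_le_of_le _ fun k _ => ?_
      rw [Finset.sum_mul]
      refine norm_sum_le_of_le _ fun l _ => ?_
      rw [norm_smul, mul_comm]
      exact mul_le_mul_of_nonneg_left (norm_entry_le X k l) (norm_nonneg _)
    refine (hdisc ((∑ k, ∑ l, ‖T (Matrix.single k l 1)‖) * R)).subset fun g hg i j => ?_
    rw [← hT g]
    refine (norm_entry_le _ i j).trans ((hTb (ψ g)).trans ?_)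
    exact mul_le_mul_of_nonneg_left hg (Finset.sum_nonneg fun _ _ =>
      Finset.sum_nonneg fun _ _ => norm_nonneg _)
  · intro g
    refine (norm_le_of_entry_le _ (max C 0) (le_max_right _ _) fun i j => ?_).trans (by simp)
    rw [blockPart]
    split_ifs with h
    · rw [hψ]
      exact (h2 g i j (by omega)).trans (le_max_left _ _)
    · simp

/-! ### Properly convex cones and discrete groups that preserve them. -/

namespace ConvexCusp

section Cones

variable {n : ℕ} {U : Set (S n)} {A : GL (Fin (n + 1)) ℝ} {v w : E (n + 1)}

lemma coe_toSphere (hv : v ≠ 0) : (toSphere v : E (n + 1)) = ‖v‖⁻¹ • v := by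
  simp [toSphere, hv]

lemma continuousAt_toSphere (hv : v ≠ 0) : ContinuousAt (toSphere (n := n)) v := by
  rw [Topology.IsInducing.subtypeVal.continuousAt_iff]
  have h1 : ContinuousAt (fun w : E (n + 1) => ‖w‖⁻¹ • w) v :=
    (continuousAt_id.norm.inv₀ (norm_ne_zero_iff.2 hv)).smul continuousAt_id
  refine h1.congr ?_
  filter_upwards [isOpen_ne.mem_nhds hv] with w hw
  exact (coe_toSphere hw).symm

lemma isOpen_cone (hU : IsOpen U) : IsOpen (cone U) := by
  rw [isOpen_iff_mem_nhds]
  rintro v ⟨hv, hvU⟩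
  filter_upwards [isOpen_ne.mem_nhds hv,
    (continuousAt_toSphere hv).preimage_mem_nhds (hU.mem_nhds hvU)] with w h1 h2
  exact ⟨h1, h2⟩

lemma coe_mem_cone_iff {x : S n} : (x : E (n + 1)) ∈ cone U ↔ x ∈ U := by
  constructor
  · rintro ⟨_, h⟩
    rwa [toSphere_coe] at h
  · intro h
    exact ⟨S.ne_zero x, by rwa [toSphere_coe]⟩

lemma smul_mem_cone (hv : v ∈ cone U) {r : ℝ} (hr : 0 < r) : r • v ∈ cone U :=
  ⟨smul_ne_zero hr.ne' hv.1, by rw [toSphere_smul hr]; exact hv.2⟩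

lemma smul_mem_cone_iff {r : ℝ} (hr : 0 < r) : r • v ∈ cone U ↔ v ∈ cone U := by
  refine ⟨fun h => ?_, fun h => smul_mem_cone h hr⟩
  have := smul_mem_cone h (inv_pos.2 hr)
  rwa [inv_smul_smul₀ hr.ne'] at this

lemma add_mem_cone (hU : Convex ℝ (cone U)) (hv : v ∈ cone U) (hw : w ∈ cone U) :
    v + w ∈ cone U := by
  have h := hU hv hw (by norm_num : (0 : ℝ) ≤ 1 / 2) (by norm_num : (0 : ℝ) ≤ 1 / 2) (by norm_num)
  have h2 := smul_mem_cone h (by norm_num : (0 : ℝ) < 2)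
  rwa [smul_add, smul_smul, smul_smul, show (2 : ℝ) * (1 / 2) = 1 by norm_num, one_smul,
    one_smul] at h2

lemma lin_inv_lin (A : GL (Fin (n + 1)) ℝ) (v : E (n + 1)) : lin A⁻¹ (lin A v) = v := by
  rw [← lin_mul, inv_mul_cancel, lin_one]

lemma lin_lin_inv (A : GL (Fin (n + 1)) ℝ) (v : E (n + 1)) : lin A (lin A⁻¹ v) = v := by
  rw [← lin_mul, mul_inv_cancel, lin_one]

lemma lin_ne_zero (hv : v ≠ 0) : lin A v ≠ 0 := by
  intro h
  have := lin_inv_lin A v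
  rw [h, map_zero] at this
  exact hv this.symm

lemma act_toSphere (hv : v ≠ 0) : act A (toSphere v) = toSphere (lin A v) := by
  have h : 0 < ‖v‖⁻¹ := inv_pos.2 (norm_pos_iff.2 hv)
  rw [act, coe_toSphere hv, map_smul, toSphere_smul h]

lemma act_inv_act (A : GL (Fin (n + 1)) ℝ) (x : S n) : act A⁻¹ (act A x) = x := by
  rw [← act_mul, inv_mul_cancel, act_one]

lemma act_act_inv (A : GL (Fin (n + 1)) ℝ) (x : S n) : act A (act A⁻¹ x) = x := by
  rw [← act_mul, mul_inv_cancel, act_one]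

lemma continuous_lin (A : GL (Fin (n + 1)) ℝ) : Continuous (lin A) :=
  LinearMap.continuous_of_finiteDimensional _

lemma continuous_act (A : GL (Fin (n + 1)) ℝ) : Continuous (act (n := n) A) := by
  rw [continuous_iff_continuousAt]
  intro x
  have h1 : ContinuousAt (fun x : S n => lin A (x : E (n + 1))) x :=
    ((continuous_lin A).comp continuous_subtype_val).continuousAt
  exact ContinuousAt.comp (g := toSphere) (continuousAt_toSphere (lin_ne_zero (S.ne_zero x))) h1

lemma act_mem_iff (h : act A '' U = U) {x : S n} : act A x ∈ U ↔ x ∈ U := by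
  constructor
  · intro hx
    rw [← h] at hx
    obtain ⟨y, hy, hyx⟩ := hx
    have := congrArg (act A⁻¹) hyx
    rw [act_inv_act, act_inv_act] at this
    rwa [← this]
  · intro hx
    rw [← h]
    exact mem_image_of_mem _ hx

lemma act_image_eq (h : ∀ x ∈ U, act A x ∈ U) (h' : ∀ x ∈ U, act A⁻¹ x ∈ U) :
    act A '' U = U := by
  apply subset_antisymm
  · rintro _ ⟨x, hx, rfl⟩
    exact h x hx
  · intro x hx
    exact ⟨act A⁻¹ x, h' x hx, act_act_inv A x⟩

lemma lin_mem_cone_iff (h : act A '' U = U) : lin A v ∈ cone U ↔ v ∈ cone U := by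
  constructor
  · rintro ⟨h1, h2⟩
    have hv : v ≠ 0 := by rintro rfl; exact h1 (map_zero _)
    rw [← act_toSphere hv, act_mem_iff h] at h2
    exact ⟨hv, h2⟩
  · rintro ⟨h1, h2⟩
    exact ⟨lin_ne_zero h1, by rwa [← act_toSphere h1, act_mem_iff h]⟩

/-- A linear functional on a properly convex cone bounds the norm. -/
lemma IsProperlyConvex.exists_functional (hU : IsProperlyConvex U) :
    ∃ (g : E (n + 1) →ₗ[ℝ] ℝ) (c : ℝ), 0 < c ∧ (∀ v ∈ cone U, c * ‖v‖ ≤ g v) ∧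
      ∀ x ∈ closure U, 0 < g (x : E (n + 1)) := by
  obtain ⟨g, hg⟩ := hU.patch
  have hcont : Continuous fun x : S n => g (x : E (n + 1)) :=
    (LinearMap.continuous_of_finiteDimensional g).comp continuous_subtype_val
  obtain ⟨x₀, hx₀, hmin⟩ := (isClosed_closure (s := U)).isCompact.exists_isMinOn
    hU.nonempty.closure hcont.continuousOn
  refine ⟨g, g x₀, hg x₀ hx₀, fun v hv => ?_, hg⟩
  have h1 : g x₀ ≤ g (toSphere v : E (n + 1)) := hmin (subset_closure hv.2)
  rw [coe_toSphere hv.1, map_smul, smul_eq_mul] at h1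
  have h2 : 0 < ‖v‖ := norm_pos_iff.2 hv.1
  rw [inv_mul_eq_div, le_div_iff₀ h2] at h1
  exact h1

/-- The norm of a map that preserves a properly convex cone is bounded by its value at an interior
point. -/
lemma norm_lin_le {g : E (n + 1) →ₗ[ℝ] ℝ} {c : ℝ} (hc : 0 < c)
    (hg : ∀ v ∈ cone U, c * ‖v‖ ≤ g v) (hA : act A '' U = U) {x : E (n + 1)} {ε : ℝ} (hε : 0 < ε)
    (hx : Metric.closedBall x ε ⊆ cone U) (v : E (n + 1)) :
    ‖lin A v‖ ≤ (c * ε)⁻¹ * g (lin A x) * ‖v‖ := by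
  by_cases hv : v = 0
  · simp [hv]
  have hn : 0 < ‖v‖ := norm_pos_iff.2 hv
  set u := (ε / ‖v‖) • v with hu
  have hun : ‖u‖ = ε := by
    rw [hu, norm_smul, Real.norm_of_nonneg (by positivity)]
    field_simp
  -- The images of `x ± u` stay in the cone, where `g` bounds the norm, and the values of `g` at
  -- these two images add up to `2 * g (lin A x)`.
  have h1 : x + u ∈ cone U := hx (by simp [hun])
  have h2 : x - u ∈ cone U := hx (by simp [hun])
  have h3 := hg _ ((lin_mem_cone_iff hA).2 h1)
  have h4 := hg _ ((lin_mem_cone_iff hA).2 h2)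
  rw [map_add, map_add] at h3
  rw [map_sub, map_sub] at h4
  have h5 : 2 * ‖lin A u‖ ≤ ‖lin A x + lin A u‖ + ‖lin A x - lin A u‖ := by
    have h6 : (2 : ℝ) • lin A u = (lin A x + lin A u) - (lin A x - lin A u) := by
      rw [two_smul]; abel
    have h7 : ‖(2 : ℝ) • lin A u‖ = 2 * ‖lin A u‖ := by rw [norm_smul]; simp
    rw [← h7, h6]
    exact norm_sub_le _ _
  have h8 : c * ‖lin A u‖ ≤ g (lin A x) := by nlinarith
  have h9 : ‖lin A u‖ = ε / ‖v‖ * ‖lin A v‖ := by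
    rw [hu, map_smul, norm_smul, Real.norm_of_nonneg (by positivity)]
  rw [h9] at h8
  have h10 : c * ε * ‖lin A v‖ ≤ g (lin A x) * ‖v‖ := by
    have := mul_le_mul_of_nonneg_right h8 hn.le
    calc c * ε * ‖lin A v‖ = c * (ε / ‖v‖ * ‖lin A v‖) * ‖v‖ := by field_simp
      _ ≤ _ := this
  calc ‖lin A v‖ = (c * ε)⁻¹ * (c * ε * ‖lin A v‖) := by field_simp
    _ ≤ (c * ε)⁻¹ * (g (lin A x) * ‖v‖) := by gcongr
    _ = _ := by ring

lemma abs_entry_le (A : GL (Fin (n + 1)) ℝ) {R : ℝ} (h : ∀ v, ‖lin A v‖ ≤ R * ‖v‖)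
    (i j : Fin (n + 1)) : |(A : Matrix (Fin (n + 1)) (Fin (n + 1)) ℝ) i j| ≤ R := by
  have h1 := h (EuclideanSpace.single j 1)
  have h2 : lin A (EuclideanSpace.single j 1) i =
      (A : Matrix (Fin (n + 1)) (Fin (n + 1)) ℝ) i j := by
    simp [lin, Matrix.toLpLin_apply]
  rw [← h2, ← Real.norm_eq_abs]
  refine (PiLp.norm_apply_le _ i).trans (h1.trans (by simp))

/-- A discrete group of matrices of determinant `±1` has finitely many elements of bounded norm. -/
lemma finite_of_bounded_entries {Γ : Subgroup (GL (Fin (n + 1)) ℝ)} (hd : DiscreteTopology Γ)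
    (hdet : ∀ A ∈ Γ, (A : Matrix (Fin (n + 1)) (Fin (n + 1)) ℝ).det = 1 ∨
      (A : Matrix (Fin (n + 1)) (Fin (n + 1)) ℝ).det = -1) (R : ℝ) :
    {A : GL (Fin (n + 1)) ℝ | A ∈ Γ ∧
      ∀ i j, |(A : Matrix (Fin (n + 1)) (Fin (n + 1)) ℝ) i j| ≤ R}.Finite := by
  have hclosed : IsClosed (Γ : Set (GL (Fin (n + 1)) ℝ)) := Subgroup.isClosed_of_discrete
  set K' : Set (Matrix (Fin (n + 1)) (Fin (n + 1)) ℝ) :=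
    {M | (∀ i j, M i j ∈ Icc (-R) R) ∧ |M.det| = 1} with hK'
  have hK'c : IsCompact K' := by
    have h1 : IsCompact {M : Matrix (Fin (n + 1)) (Fin (n + 1)) ℝ | ∀ i j, M i j ∈ Icc (-R) R} := by
      have h0 := isCompact_univ_pi (fun _ : Fin (n + 1) =>
        isCompact_univ_pi (fun _ : Fin (n + 1) => isCompact_Icc (a := -R) (b := R)))
      have h2 : {M : Matrix (Fin (n + 1)) (Fin (n + 1)) ℝ | ∀ i j, M i j ∈ Icc (-R) R} =
          Set.pi univ fun _ => Set.pi univ fun _ => Icc (-R) R := by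
        ext M
        exact ⟨fun h i _ j _ => h i j, fun h i j => h i (mem_univ i) j (mem_univ j)⟩
      rw [h2]
      exact h0
    refine h1.inter_right (t := {M | |M.det| = 1}) ?_
    exact isClosed_eq (continuous_abs.comp (continuous_id.matrix_det)) continuous_const
  set K : Set (GL (Fin (n + 1)) ℝ) :=
    {A | (A : Matrix (Fin (n + 1)) (Fin (n + 1)) ℝ) ∈ K'} with hK
  have hKc : IsCompact K := by
    rw [Units.isEmbedding_embedProduct.isCompact_iff]
    -- The topology of the units also sees the inverse. For determinant `±1` the inverse is `det •
    -- adjugate`, which is continuous in the matrix, so compactness of `K'` passes to `K`.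
    have h2 : Units.embedProduct _ '' K =
        (fun M => (M, MulOpposite.op (M.det • M.adjugate))) '' K' := by
      ext ⟨M, N⟩
      constructor
      · rintro ⟨A, hA, h⟩
        refine ⟨A, hA, ?_⟩
        rw [← h]
        have hd1 : (A : Matrix (Fin (n + 1)) (Fin (n + 1)) ℝ).det = 1 ∨
            (A : Matrix (Fin (n + 1)) (Fin (n + 1)) ℝ).det = -1 := eq_or_eq_neg_of_abs_eq hA.2
        have : ((A⁻¹ : GL (Fin (n + 1)) ℝ) : Matrix (Fin (n + 1)) (Fin (n + 1)) ℝ) =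
            (A : Matrix (Fin (n + 1)) (Fin (n + 1)) ℝ).det •
              (A : Matrix (Fin (n + 1)) (Fin (n + 1)) ℝ).adjugate := by
          rw [Matrix.coe_units_inv, Matrix.inv_def]
          congr 1
          rcases hd1 with h | h <;> rw [h] <;> simp
        exact Prod.ext rfl (congrArg MulOpposite.op this.symm)
      · rintro ⟨M, hM, h⟩
        have hne : M.det ≠ 0 := by
          intro h0
          have := hM.2
          rw [h0] at this
          simp at this
        have hd1 : M.det = 1 ∨ M.det = -1 := eq_or_eq_neg_of_abs_eq hM.2
        refine ⟨Matrix.GeneralLinearGroup.mkOfDetNeZero M hne, hM, ?_⟩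
        rw [← h]
        have : ((Matrix.GeneralLinearGroup.mkOfDetNeZero M hne)⁻¹ : GL (Fin (n + 1)) ℝ) =
            M.det • M.adjugate := by
          rw [Matrix.coe_units_inv]
          change M⁻¹ = _
          rw [Matrix.inv_def]
          congr 1
          rcases hd1 with h | h <;> rw [h] <;> simp
        refine Prod.ext rfl ?_
        exact congrArg MulOpposite.op this
    rw [h2]
    refine hK'c.image ?_
    exact continuous_id.prodMk (MulOpposite.continuous_op.comp
      ((continuous_id.matrix_det).smul (continuous_id.matrix_adjugate)))
  have hfin : ((Γ : Set (GL (Fin (n + 1)) ℝ)) ∩ K).Finite := by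
    refine (hKc.inter_left hclosed).finite ?_
    have : IsDiscrete (Γ : Set (GL (Fin (n + 1)) ℝ)) := ⟨hd⟩
    exact this.mono inter_subset_left
  refine hfin.subset ?_
  rintro A ⟨hA, hb⟩
  refine ⟨hA, fun i j => abs_le.1 (hb i j), ?_⟩
  rcases hdet A hA with h | h <;> rw [h] <;> simp

lemma IsDiscreteIn.finite {Γ : Subgroup (GL (Fin (n + 1)) ℝ)} (h : IsDiscreteIn Γ U) (R : ℝ) :
    {A : GL (Fin (n + 1)) ℝ | A ∈ Γ ∧ ∀ v, ‖lin A v‖ ≤ R * ‖v‖}.Finite :=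
  (finite_of_bounded_entries h.discrete h.det R).subset
    fun A hA => ⟨hA.1, abs_entry_le A hA.2⟩

lemma lin_pow {A : GL (Fin (n + 1)) ℝ} {x : E (n + 1)} {μ : ℝ} (h : lin A x = μ • x) (k : ℕ) :
    lin (A ^ k) x = μ ^ k • x := by
  induction k with
  | zero => simp [lin_one]
  | succ k ih => rw [pow_succ', lin_mul, ih, map_smul, h, smul_smul, pow_succ]

lemma act_eq_iff {x : S n} : act A x = x ↔ ∃ μ : ℝ, 0 < μ ∧ lin A (x : E (n + 1)) = μ • (x : E (n + 1)) := by
  have h0 := lin_ne_zero (A := A) (S.ne_zero x)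
  constructor
  · intro h
    refine ⟨‖lin A (x : E (n + 1))‖, norm_pos_iff.2 h0, ?_⟩
    have h1 := congrArg Subtype.val h
    rw [act, coe_toSphere h0] at h1
    rw [← h1, smul_smul]
    simp only [h1]
    rw [mul_inv_cancel₀ (norm_ne_zero_iff.2 h0), one_smul]
  · rintro ⟨μ, hμ, h⟩
    rw [act, h, toSphere_smul hμ, toSphere_coe]

/-- A torsion-free discrete group acts freely on a properly convex domain. -/
theorem eq_one_of_fixed {Γ : Subgroup (GL (Fin (n + 1)) ℝ)} (hU : IsProperlyConvex U)
    (hΓ : IsDiscreteIn Γ U) (htf : ∀ A ∈ Γ, IsOfFinOrder A → A = 1) (hA : A ∈ Γ) {x : S n}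
    (hx : x ∈ U) (hfix : act A x = x) : A = 1 := by
  obtain ⟨g, c, hc, hg, -⟩ := hU.exists_functional
  have hxc : (x : E (n + 1)) ∈ cone U := coe_mem_cone_iff.2 hx
  obtain ⟨ε, hε, hball⟩ := Metric.nhds_basis_closedBall.mem_iff.1
    ((isOpen_cone hU.isOpen).mem_nhds hxc)
  have hK : 0 ≤ (c * ε)⁻¹ * g x :=
    mul_nonneg (by positivity) ((mul_nonneg hc.le (norm_nonneg _)).trans (hg _ hxc))
  set K := (c * ε)⁻¹ * g x with hKdef
  have hbound : ∀ B ∈ Γ, ∀ μ : ℝ, 0 < μ → lin B (x : E (n + 1)) = μ • (x : E (n + 1)) →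
      ∀ k : ℕ, ∀ v, ‖lin (B ^ k) v‖ ≤ (K * μ ^ k) * ‖v‖ := by
    intro B hB μ hμ h k v
    have := norm_lin_le hc hg (hΓ.preserves _ (Γ.pow_mem hB k)) hε hball v
    rw [lin_pow h, map_smul, smul_eq_mul] at this
    calc _ ≤ _ := this
      _ = _ := by rw [hKdef]; ring
  -- If `μ < 1`, the powers of `B` tend to zero in norm although their determinants have modulus
  -- one. Applied to `A` and to `A⁻¹`, this gives `μ = 1`.
  have hge : ∀ B ∈ Γ, ∀ μ : ℝ, 0 < μ → lin B (x : E (n + 1)) = μ • (x : E (n + 1)) → 1 ≤ μ := by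
    intro B hB μ hμ h
    by_contra hlt
    push Not at hlt
    have h1 : ∀ k : ℕ, (1 : ℝ) ≤ (n + 1).factorial • (K * μ ^ k) ^ (n + 1) := by
      intro k
      have h2 := Matrix.det_le (A := ((B ^ k : GL (Fin (n + 1)) ℝ) :
        Matrix (Fin (n + 1)) (Fin (n + 1)) ℝ)) (abv := AbsoluteValue.abs)
        (x := K * μ ^ k) fun i j => abs_entry_le _ (hbound B hB μ hμ h k) i j
      rw [Fintype.card_fin] at h2
      refine le_trans (le_of_eq ?_) h2
      rcases hΓ.det _ (Γ.pow_mem hB k) with h | h <;> rw [h] <;> simp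
    have h3 : Tendsto (fun k : ℕ => (n + 1).factorial • (K * μ ^ k) ^ (n + 1)) atTop
        (𝓝 ((n + 1).factorial • (K * 0) ^ (n + 1))) :=
      (((tendsto_pow_atTop_nhds_zero_of_lt_one hμ.le hlt).const_mul K).pow (n + 1)).const_smul _
    have h4 := ge_of_tendsto' h3 h1
    norm_num at h4
  obtain ⟨μ, hμ, h⟩ := act_eq_iff.1 hfix
  have hinv : lin A⁻¹ (x : E (n + 1)) = μ⁻¹ • (x : E (n + 1)) := by
    have := congrArg (lin A⁻¹) h
    rw [lin_inv_lin, map_smul] at this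
    conv_rhs => rw [this]
    rw [inv_smul_smul₀ hμ.ne']
  have h1 := hge A hA μ hμ h
  have h2 := hge _ (Γ.inv_mem hA) μ⁻¹ (inv_pos.2 hμ) hinv
  have h3 : μ = 1 := le_antisymm (by
    have := (one_le_inv₀ hμ).1 h2
    exact this) h1
  subst h3
  -- Now all powers of `A` are bounded by `K`, so only finitely many of them are distinct.
  apply htf A hA
  by_contra hnot
  have hinj := injective_pow_iff_not_isOfFinOrder.2 hnot
  have hfin := hΓ.finite K
  refine Set.infinite_range_of_injective hinj (hfin.subset ?_)
  rintro _ ⟨k, rfl⟩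
  refine ⟨Γ.pow_mem hA k, fun v => ?_⟩
  have := hbound A hA 1 one_pos h k v
  rwa [one_pow, mul_one] at this

/-- The eigenvalues of the elements of a torsion-free cusp group have modulus one. -/
lemma IsCuspGroup.norm_eigenvalue {Γ : Subgroup (GL (Fin (n + 1)) ℝ)}
    {H : Submodule ℝ (E (n + 1))} {p : S n} (h : IsCuspGroup Γ U H p)
    (htf : ∀ A ∈ Γ, IsOfFinOrder A → A = 1) (hA : A ∈ Γ) {μ : ℂ}
    (hμ : Module.End.HasEigenvalue (Matrix.toLin'
      ((A : Matrix (Fin (n + 1)) (Fin (n + 1)) ℝ).map (algebraMap ℝ ℂ))) μ) : ‖μ‖ = 1 := by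
  by_cases h1 : A = 1
  · subst h1
    obtain ⟨v, hv⟩ := hμ.exists_hasEigenvector
    have h2 := hv.apply_eq_smul
    simp only [Units.val_one, map_zero, map_one, Matrix.map_one, Matrix.toLin'_one,
      LinearMap.id_coe, id_eq] at h2
    have h3 : (1 - μ) • v = 0 := by rw [sub_smul, one_smul, ← h2, sub_self]
    rcases smul_eq_zero.1 h3 with h4 | h4
    · rw [← sub_eq_zero.1 h4, norm_one]
    · exact absurd h4 hv.2
  -- A non-trivial element has no fixed point in `U`, so an eigenvalue off the unit circle would
  -- make it hyperbolic.
  · by_contra hne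
    refine h.nonhyperbolic A hA ⟨fun x hx hfix => h1 ?_, μ, hμ, hne⟩
    exact eq_one_of_fixed h.properlyConvex h.discrete htf hA hx hfix

/-- A real eigenvalue is an eigenvalue of the complexification. -/
lemma hasEigenvalue_complexification {μ : ℝ} (hv : v ≠ 0) (h : lin A v = μ • v) :
    Module.End.HasEigenvalue (Matrix.toLin'
      ((A : Matrix (Fin (n + 1)) (Fin (n + 1)) ℝ).map (algebraMap ℝ ℂ))) (μ : ℂ) := by
  refine Module.End.hasEigenvalue_of_hasEigenvector (x := fun i => ((v i : ℝ) : ℂ)) ⟨?_, ?_⟩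
  · rw [Module.End.mem_eigenspace_iff]
    ext i
    have h1 : (lin A v) i = μ * v i := by rw [h]; simp
    have h2 : (lin A v) i = ∑ j, (A : Matrix (Fin (n + 1)) (Fin (n + 1)) ℝ) i j * v j := by
      simp [lin, Matrix.toLpLin_apply, Matrix.mulVec, dotProduct]
    rw [h2] at h1
    simp only [Matrix.toLin'_apply, Matrix.mulVec, dotProduct, Matrix.map_apply, Pi.smul_apply,
      smul_eq_mul]
    have h3 := congrArg (algebraMap ℝ ℂ) h1
    simpa using h3
  · intro h0
    apply hv
    ext i
    have := congrFun h0 i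
    simpa using this

/-- Elements of a torsion-free cusp group fix the vectors that they rescale. -/
lemma IsCuspGroup.lin_eq {Γ : Subgroup (GL (Fin (n + 1)) ℝ)}
    {H : Submodule ℝ (E (n + 1))} {p : S n} (h : IsCuspGroup Γ U H p)
    (htf : ∀ A ∈ Γ, IsOfFinOrder A → A = 1) (hA : A ∈ Γ) {q : S n} (hq : act A q = q) :
    lin A (q : E (n + 1)) = q := by
  obtain ⟨μ, hμ, h1⟩ := act_eq_iff.1 hq
  have h2 := h.norm_eigenvalue htf hA (hasEigenvalue_complexification (S.ne_zero q) h1)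
  rw [Complex.norm_real, Real.norm_of_nonneg hμ.le] at h2
  rw [h1, h2, one_smul]

/-- Elements of a torsion-free cusp group fix the functionals that they rescale. -/
lemma IsCuspGroup.functional_eq {Γ : Subgroup (GL (Fin (n + 1)) ℝ)}
    {H : Submodule ℝ (E (n + 1))} {p : S n} (h : IsCuspGroup Γ U H p)
    (htf : ∀ A ∈ Γ, IsOfFinOrder A → A = 1) (hA : A ∈ Γ) {f : E (n + 1) →ₗ[ℝ] ℝ} (hf : f ≠ 0)
    {t : ℝ} (ht : 0 < t) (hfA : ∀ v, f (lin A v) = t * f v) (v : E (n + 1)) :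
    f (lin A v) = f v := by
  -- `f` vanishes on the image of `A - t`, so this endomorphism is not onto, and `t` is an
  -- eigenvalue of `A`.
  have hnsurj : ¬ Function.Surjective (lin A - t • (LinearMap.id : E (n + 1) →ₗ[ℝ] E (n + 1))) := by
    intro hs
    apply hf
    ext w
    obtain ⟨u, rfl⟩ := hs w
    simp [hfA]
  have hninj : ¬ Function.Injective (lin A - t • (LinearMap.id : E (n + 1) →ₗ[ℝ] E (n + 1))) := fun hi =>
    hnsurj (LinearMap.injective_iff_surjective.1 hi)
  rw [← LinearMap.ker_eq_bot, Submodule.eq_bot_iff] at hninj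
  push Not at hninj
  obtain ⟨u, hu, hu0⟩ := hninj
  have h1 : lin A u = t • u := by
    rw [LinearMap.mem_ker] at hu
    simpa [sub_eq_zero] using hu
  have h2 := h.norm_eigenvalue htf hA (hasEigenvalue_complexification hu0 h1)
  rw [Complex.norm_real, Real.norm_of_nonneg ht.le] at h2
  rw [hfA, h2, one_mul]

/-- A torsion-free cusp group is virtually nilpotent. -/
theorem IsCuspGroup.isVirtuallyNilpotent {Γ : Subgroup (GL (Fin (n + 1)) ℝ)}
    {H : Submodule ℝ (E (n + 1))} {p : S n} (h : IsCuspGroup Γ U H p)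
    (htf : ∀ A ∈ Γ, IsOfFinOrder A → A = 1) : Group.IsVirtuallyNilpotent Γ := by
  let φ : Γ →* Matrix (Fin (n + 1)) (Fin (n + 1)) ℂ :=
    ((algebraMap ℝ ℂ).mapMatrix.toMonoidHom.comp
      (Units.coeHom (Matrix (Fin (n + 1)) (Fin (n + 1)) ℝ))).comp Γ.subtype
  have hφ : ∀ A : Γ, φ A =
      ((A : GL (Fin (n + 1)) ℝ) : Matrix (Fin (n + 1)) (Fin (n + 1)) ℝ).map (algebraMap ℝ ℂ) :=
    fun A => rfl
  have hφe : ∀ (A : Γ) i j, ‖φ A i j‖ =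
      |((A : GL (Fin (n + 1)) ℝ) : Matrix (Fin (n + 1)) (Fin (n + 1)) ℝ) i j| := by
    intro A i j
    rw [hφ, Matrix.map_apply]
    simp
  refine isVirtuallyNilpotent_of_eigenvalues φ ?_ ?_ ?_
  · intro A B hAB
    apply Subtype.ext
    apply Units.ext
    ext i j
    have := congrFun (congrFun hAB i) j
    rw [hφ, hφ, Matrix.map_apply, Matrix.map_apply] at this
    exact (algebraMap ℝ ℂ).injective this
  · intro R
    refine Set.Finite.of_finite_image (f := Subtype.val) ?_ Subtype.val_injective.injOn
    refine (finite_of_bounded_entries h.discrete.discrete h.discrete.det R).subset ?_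
    rintro _ ⟨A, hA, rfl⟩
    exact ⟨A.2, fun i j => (hφe A i j) ▸ hA i j⟩
  · intro A μ hμ
    exact (h.norm_eigenvalue htf A.2 hμ).le

end Cones

end ConvexCusp

/-! ### Smoothness through local diffeomorphisms. -/

section LocalDiffeomorphisms

variable {𝕜 : Type*} [NontriviallyNormedField 𝕜]
  {E₁ : Type*} [NormedAddCommGroup E₁] [NormedSpace 𝕜 E₁] {H₁ : Type*} [TopologicalSpace H₁]
  {I : ModelWithCorners 𝕜 E₁ H₁} {M : Type*} [TopologicalSpace M] [ChartedSpace H₁ M]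
  {E₂ : Type*} [NormedAddCommGroup E₂] [NormedSpace 𝕜 E₂] {H₂ : Type*} [TopologicalSpace H₂]
  {J : ModelWithCorners 𝕜 E₂ H₂} {N : Type*} [TopologicalSpace N] [ChartedSpace H₂ N]
  {E₃ : Type*} [NormedAddCommGroup E₃] [NormedSpace 𝕜 E₃] {H₃ : Type*} [TopologicalSpace H₃]
  {K : ModelWithCorners 𝕜 E₃ H₃} {P : Type*} [TopologicalSpace P] [ChartedSpace H₃ P]
  {n : ℕ∞ω}

/-- Smoothness can be checked after composing with a local diffeomorphism. -/
lemma IsLocalDiffeomorph.contMDiff_of_comp {q : M → N} {h : N → P}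
    (hq : IsLocalDiffeomorph I J n q) (hs : Function.Surjective q) (hh : ContMDiff I K n (h ∘ q)) :
    ContMDiff J K n h := by
  intro y
  obtain ⟨x, rfl⟩ := hs y
  have h2 := (hh ((hq x).localInverse (q x))).comp (q x) (hq x).localInverse_contMDiffAt
  refine h2.congr_of_eventuallyEq ?_
  filter_upwards [(hq x).localInverse_eventuallyEq_right] with z hz
  simp only [Function.comp_apply, id_eq] at hz ⊢
  rw [hz]

end LocalDiffeomorphisms

/-! ### Affine atlases on quotients of open subsets of Euclidean space. -/

namespace ConvexCusp

section AffineQuotient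

variable {k : ℕ} {T : TopologicalSpace.Opens (E k)} {Y : Type*} [TopologicalSpace Y] {q : T → Y}

/-- The chart of `Y` at the image of `x`, given by a local inverse of `q`. -/
noncomputable def quotientChart (hq : IsLocalHomeomorph q) (x : T) : OpenPartialHomeomorph Y (E k) :=
  (hq x).choose.symm.trans (T.openPartialHomeomorphSubtypeCoe ⟨x⟩)

/-- The atlas of local inverses of a local homeomorphism from an open set of Euclidean space. -/
@[reducible] noncomputable def quotientChartedSpace (hq : IsLocalHomeomorph q) (hs : Function.Surjective q) :
    ChartedSpace (E k) Y where
  atlas := range (quotientChart hq)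
  chartAt y := quotientChart hq (Function.surjInv hs y)
  mem_chart_source y := by
    have h1 := (hq (Function.surjInv hs y)).choose_spec
    have h2 := (hq (Function.surjInv hs y)).choose.map_source h1.1
    rw [← h1.2, Function.surjInv_eq hs y] at h2
    simp [quotientChart, h2]
  chart_mem_atlas y := mem_range_self _

/-- The fibres of `q` are permuted by affine maps. -/
def HasAffineDeck (q : T → Y) : Prop :=
  ∀ x x' : T, q x = q x' → ∃ A : E k →ᵃ[ℝ] E k, A x = x' ∧
    ∀ᶠ y : T in 𝓝 x, ∃ h : A y ∈ T, q ⟨A y, h⟩ = q y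

variable (hq : IsLocalHomeomorph q) (hD : HasAffineDeck q)
include hD

/-- A chart is a local inverse of `q`. At a point `x` that need not lie near `x₀`, it differs from
the inclusion of `T` by the affine deck map that carries `x` to the preimage selected by the chart.
This is why transitions between charts are affine. -/
lemma quotientChart_spec (x₀ x : T) (hx : q x ∈ (quotientChart hq x₀).source) :
    ∃ A : E k →ᵃ[ℝ] E k, (∃ h : A x ∈ T, q ⟨A x, h⟩ = q x) ∧ ∀ᶠ y : T in 𝓝 x,
      (∃ h : A y ∈ T, q ⟨A y, h⟩ = q y) ∧
      q y ∈ (quotientChart hq x₀).source ∧ quotientChart hq x₀ (q y) = A y := by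
  set e := (hq x₀).choose with he
  obtain ⟨-, hqe⟩ := (hq x₀).choose_spec
  have hsrc : (quotientChart hq x₀).source = e.target := by
    simp [quotientChart, he]
  have hval : ∀ y, quotientChart hq x₀ y = (e.symm y : E k) := fun y => rfl
  rw [hsrc] at hx ⊢
  obtain ⟨A, hA, hev⟩ := hD x (e.symm (q x)) (by
    have h := congrFun hqe (e.symm (q x))
    rw [h]
    exact (e.right_inv hx).symm)
  have hopen : IsOpen (Subtype.val '' e.source : Set (E k)) :=
    T.isOpen.isOpenMap_subtype_val _ e.open_source
  have hcont : Tendsto (fun y : T => A y) (𝓝 x) (𝓝 (A x)) :=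
    (A.continuous_of_finiteDimensional.comp continuous_subtype_val).continuousAt
  have hmem : ∀ᶠ y : T in 𝓝 x, A y ∈ (Subtype.val '' e.source : Set (E k)) :=
    hcont.eventually (hopen.mem_nhds (hA ▸ mem_image_of_mem _ (e.map_target hx)))
  refine ⟨A, hev.self_of_nhds, ?_⟩
  filter_upwards [hmem, hev] with y h1 h2
  obtain ⟨z, hz, hzA⟩ := h1
  obtain ⟨hAy, h3⟩ := h2
  have h4 : (⟨A y, hAy⟩ : T) = z := Subtype.ext hzA.symm
  rw [h4] at h3
  have h5 : e z = q y := by rw [← h3, hqe]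
  refine ⟨⟨hAy, by rw [h4, h3]⟩, by rw [← h5]; exact e.map_source hz, ?_⟩
  rw [hval, ← h5, e.left_inv hz, hzA]

omit hD in
lemma quotientChart_symm (x₀ : T) {w : E k} (hw : w ∈ (quotientChart hq x₀).target) :
    ∃ h : w ∈ T, (quotientChart hq x₀).symm w = q ⟨w, h⟩ := by
  have hwT : w ∈ T := by
    have : w ∈ (T.openPartialHomeomorphSubtypeCoe ⟨x₀⟩).target := hw.1
    simpa using this
  refine ⟨hwT, ?_⟩
  obtain ⟨-, hqe⟩ := (hq x₀).choose_spec
  have h1 : (T.openPartialHomeomorphSubtypeCoe ⟨x₀⟩).symm w = ⟨w, hwT⟩ := by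
    apply Subtype.ext
    exact (T.openPartialHomeomorphSubtypeCoe ⟨x₀⟩).right_inv hw.1
  change (hq x₀).choose ((T.openPartialHomeomorphSubtypeCoe ⟨x₀⟩).symm w) = _
  rw [h1]
  exact (congrFun hqe _).symm

omit hD in
/-- Near each point of an open set of Euclidean space, a property of the subtype gives one of the
ambient space. -/
lemma eventually_of_subtype {w : E k} (hw : w ∈ T) {Q : T → Prop} (h : ∀ᶠ y in 𝓝 (⟨w, hw⟩ : T), Q y) :
    ∀ᶠ z in 𝓝 w, ∃ hz : z ∈ T, Q ⟨z, hz⟩ := by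
  have := T.isOpen.isOpenEmbedding_subtypeVal.map_nhds_eq ⟨w, hw⟩
  change ∀ᶠ z in 𝓝 ((⟨w, hw⟩ : T) : E k), _
  rw [← this, eventually_map]
  filter_upwards [h] with y hy
  exact ⟨y.2, hy⟩

lemma transition_affine (x₀ x₁ : T) :
    ∀ w ∈ ((quotientChart hq x₀).symm.trans (quotientChart hq x₁)).source,
      ∃ A : E k →ᵃ[ℝ] E k, ∀ᶠ z in 𝓝 w,
        ((quotientChart hq x₀).symm.trans (quotientChart hq x₁)) z = A z := by
  intro w hw
  obtain ⟨hw1, hw2⟩ := hw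
  obtain ⟨hwT, hwq⟩ := quotientChart_symm hq x₀ hw1
  have hw3 : q ⟨w, hwT⟩ ∈ (quotientChart hq x₁).source := hwq ▸ hw2
  obtain ⟨A, -, hA⟩ := quotientChart_spec hq hD x₁ ⟨w, hwT⟩ hw3
  refine ⟨A, ?_⟩
  filter_upwards [eventually_of_subtype hwT hA,
    (quotientChart hq x₀).open_target.mem_nhds hw1] with z hz1 hz2
  obtain ⟨hzT, -, -, hz⟩ := hz1
  obtain ⟨_, hzq⟩ := quotientChart_symm hq x₀ hz2
  rw [OpenPartialHomeomorph.coe_trans, Function.comp_apply, hzq, hz]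

variable (hs : Function.Surjective q)

lemma hasGroupoid_quotient :
    letI := quotientChartedSpace hq hs
    HasGroupoid Y (affinePregroupoid k).groupoid := by
  let _ := quotientChartedSpace hq hs
  refine ⟨?_⟩
  rintro _ _ ⟨x₀, rfl⟩ ⟨x₁, rfl⟩
  rw [mem_groupoid_of_pregroupoid]
  constructor
  · intro w hw
    obtain ⟨A, hA⟩ := transition_affine hq hD x₀ x₁ w hw
    exact ⟨A, hA.mono fun _ h _ => h⟩
  · intro w hw
    rw [OpenPartialHomeomorph.trans_symm_eq_symm_trans_symm, OpenPartialHomeomorph.symm_symm]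
    obtain ⟨A, hA⟩ := transition_affine hq hD x₁ x₀ w (by
      rw [← OpenPartialHomeomorph.symm_source, OpenPartialHomeomorph.trans_symm_eq_symm_trans_symm,
        OpenPartialHomeomorph.symm_symm] at hw
      exact hw)
    exact ⟨A, hA.mono fun _ h _ => h⟩

lemma isManifold_quotient :
    letI := quotientChartedSpace hq hs
    IsManifold (𝓡 k) ∞ Y := by
  let _ := quotientChartedSpace hq hs
  refine isManifold_of_contDiffOn _ _ _ ?_
  rintro _ _ ⟨x₀, rfl⟩ ⟨x₁, rfl⟩
  simp only [modelWithCornersSelf_coe, modelWithCornersSelf_coe_symm, preimage_id, range_id,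
    inter_univ, Function.id_comp, Function.comp_id]
  intro w hw
  obtain ⟨A, hA⟩ := transition_affine hq hD x₀ x₁ w hw
  have h1 : ContDiff ℝ ∞ A :=
    (⟨A, A.continuous_of_finiteDimensional⟩ : E k →ᴬ[ℝ] E k).contDiff
  exact (h1.contDiffAt.congr_of_eventuallyEq hA).contDiffWithinAt

/-- In the chart at `q x`, the map `q` reads near `x` as the inclusion of `T` in Euclidean space. -/
lemma isLocalDiffeomorph_quotient :
    letI := quotientChartedSpace hq hs
    IsLocalDiffeomorph (𝓡 k) (𝓡 k) ∞ q := by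
  let _ := quotientChartedSpace hq hs
  have := isManifold_quotient hq hD hs
  intro x
  set e := (hq x).choose with he
  obtain ⟨hxe, hqe⟩ := (hq x).choose_spec
  have hmem : quotientChart hq x ∈ IsManifold.maximalAtlas (𝓡 k) ∞ Y :=
    IsManifold.subset_maximalAtlas (mem_range_self x)
  have h1 := contMDiffOn_of_mem_maximalAtlas hmem
  have h2 := contMDiffOn_symm_of_mem_maximalAtlas hmem
  refine ⟨{ toPartialEquiv := e.toPartialEquiv
            open_source := e.open_source
            open_target := e.open_target
            contMDiffOn_toFun := ?_
            contMDiffOn_invFun := ?_ }, hxe, fun y _ => congrFun hqe y⟩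
  · have h3 : ∀ y ∈ e.source, (y : E k) ∈ (quotientChart hq x).target := by
      intro y hy
      refine ⟨by simp, ?_⟩
      have h4 : (T.openPartialHomeomorphSubtypeCoe ⟨x⟩).symm (y : E k) = y :=
        (T.openPartialHomeomorphSubtypeCoe ⟨x⟩).left_inv (by simp)
      change (T.openPartialHomeomorphSubtypeCoe ⟨x⟩).symm (y : E k) ∈ e.source
      rw [h4]
      exact hy
    have h5 := h2.comp (contMDiff_subtype_val (U := T) (n := ∞) (I := 𝓡 k)).contMDiffOn
      (s := e.source) h3
    refine h5.congr fun y hy => ?_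
    obtain ⟨_, h6⟩ := quotientChart_symm hq x (h3 y hy)
    rw [Function.comp_apply, h6]
    exact (congrFun hqe y).symm
  · intro y hy
    refine (ContMDiffWithinAt.subtypeVal_comp_iff T e.symm e.target y).1 ?_
    have hy' : y ∈ (quotientChart hq x).source := by
      simpa [quotientChart, ← he] using hy
    have := h1 y hy'
    refine this.mono ?_
    intro z hz
    simpa [quotientChart, ← he] using hz

end AffineQuotient

end ConvexCusp

/-- A quotient by a free properly discontinuous action is Hausdorff. -/
lemma Topology.IsQuotientMap.t2Space_of_orbits {G T Y : Type*} [Group G] [MulAction G T]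
    [TopologicalSpace T] [TopologicalSpace Y] [T2Space T] [LocallyCompactSpace T]
    [ContinuousConstSMul G T] [ProperlyDiscontinuousSMul G T] {q : T → Y} (hq : IsQuotientMap q)
    (h : ∀ {x y}, q x = q y ↔ x ∈ MulAction.orbit G y) : T2Space Y := by
  let F : C(T, Quotient (MulAction.orbitRel G T)) := ⟨Quotient.mk _, continuous_quotient_mk'⟩
  let f : C(Y, Quotient (MulAction.orbitRel G T)) :=
    (show IsQuotientMap (⟨q, hq.continuous⟩ : C(T, Y)) from hq).lift F
      fun x y hxy => Quotient.sound (h.1 hxy)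
  have hf : ∀ x, f (q x) = F x := fun x =>
    congrFun (congrArg DFunLike.coe (IsQuotientMap.lift_comp
      (f := (⟨q, hq.continuous⟩ : C(T, Y))) hq F fun x y hxy => Quotient.sound (h.1 hxy))) x
  refine T2Space.of_injective_continuous (f := f) ?_ f.continuous
  intro y y' hyy
  obtain ⟨x, rfl⟩ := hq.surjective y
  obtain ⟨x', rfl⟩ := hq.surjective y'
  rw [hf, hf] at hyy
  exact h.2 (Quotient.exact hyy)

/-! ### Affine actions with a vertical cocycle, their cross-sections, and equivariant sections. -/

namespace ConvexCusp

/-- An affine action of a group on `E k × ℝ` that covers an affine action on `E k` and acts by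
translations on the fibres. -/
structure CuspAction (G : Type*) [Group G] (k : ℕ) where
  /-- the action on the base -/
  a : G → E k →ᵃ[ℝ] E k
  /-- the translation part on the fibres -/
  b : G → E k →ᵃ[ℝ] ℝ
  a_one : ∀ z, a 1 z = z
  a_mul : ∀ g h z, a (g * h) z = a g (a h z)
  b_mul : ∀ g h z, b (g * h) z = b h z + b g (a h z)

namespace CuspAction

variable {G : Type*} [Group G] {k : ℕ} (c : CuspAction G k)

lemma b_one (z : E k) : c.b 1 z = 0 := by
  have := c.b_mul 1 1 z
  rw [c.a_one, mul_one] at this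
  linarith

lemma a_inv_a (g : G) (z : E k) : c.a g⁻¹ (c.a g z) = z := by
  rw [← c.a_mul, inv_mul_cancel, c.a_one]

lemma b_inv (g : G) (z : E k) : c.b g⁻¹ (c.a g z) = - c.b g z := by
  have := c.b_mul g⁻¹ g z
  rw [inv_mul_cancel, c.b_one] at this
  linarith

/-- The function `s` on `T` is a smooth equivariant section. -/
structure IsSection (T : Set (E k)) (s : E k → ℝ) : Prop where
  contDiffOn : ContDiffOn ℝ ∞ s T
  equivariant : ∀ g, ∀ z ∈ T, s (c.a g z) = s z + c.b g z

/-- The action is free and properly discontinuous on the open set `T`, and preserves the domain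
above the graph of the upper semicontinuous function `τ` on `T`. -/
structure IsDomain (T : TopologicalSpace.Opens (E k)) (τ : E k → ℝ) : Prop where
  mem : ∀ g, ∀ z ∈ T, c.a g z ∈ T
  equivariant : ∀ g, ∀ z ∈ T, τ (c.a g z) = τ z + c.b g z
  usc : ∀ z ∈ T, ∀ r, τ z < r → ∀ᶠ z' in 𝓝 z, τ z' < r
  free : ∀ g, ∀ z ∈ T, c.a g z = z → g = 1
  proper : ∀ K : Set (E k), IsCompact K → K ⊆ T → {g | (c.a g '' K ∩ K).Nonempty}.Finite

namespace IsDomain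

variable {c} {T : TopologicalSpace.Opens (E k)} {τ : E k → ℝ} (hc : c.IsDomain T τ)

/-- The action on the base. -/
@[reducible] noncomputable def mulAction : MulAction G T where
  smul g z := ⟨c.a g z, hc.mem g z z.2⟩
  one_smul z := Subtype.ext (c.a_one z)
  mul_smul g h z := Subtype.ext (c.a_mul g h z)

/-- The orbit equivalence relation on the base. -/
@[reducible] def setoid : Setoid T where
  r z z' := ∃ g, (⟨c.a g z, hc.mem g z z.2⟩ : T) = z'
  iseqv :=
    { refl := fun z => ⟨1, Subtype.ext (c.a_one z)⟩
      symm := by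
        rintro z _ ⟨g, rfl⟩
        exact ⟨g⁻¹, Subtype.ext (c.a_inv_a g z)⟩
      trans := by
        rintro z _ _ ⟨g, rfl⟩ ⟨h, rfl⟩
        exact ⟨h * g, Subtype.ext (c.a_mul h g z)⟩ }

/-- The quotient of the base, which is the cross-section of the cusp. -/
@[reducible] def Cross : Type := Quotient hc.setoid

/-- The quotient map. -/
def proj (z : T) : hc.Cross := Quotient.mk hc.setoid z

lemma isQuotientMap_proj : IsQuotientMap hc.proj := isQuotientMap_quotient_mk'

lemma proj_eq_iff {z z' : T} : hc.proj z = hc.proj z' ↔ ∃ g, c.a g z = z' :=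
  Quotient.eq.trans (exists_congr fun _ => Subtype.ext_iff)

lemma proj_eq_iff_mem_orbit {z z' : T} :
    let _ := hc.mulAction
    hc.proj z = hc.proj z' ↔ z ∈ MulAction.orbit G z' := by
  let _ := hc.mulAction
  change hc.proj z = hc.proj z' ↔ _
  rw [eq_comm, proj_eq_iff]
  exact exists_congr fun g => (Subtype.ext_iff (a1 := g • z') (a2 := z)).symm

lemma continuousConstSMul :
    let _ := hc.mulAction
    ContinuousConstSMul G T := by
  let _ := hc.mulAction
  refine ⟨fun g => ?_⟩
  exact Continuous.subtype_mk
    ((c.a g).continuous_of_finiteDimensional.comp continuous_subtype_val) _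

lemma properlyDiscontinuousSMul :
    let _ := hc.mulAction
    ProperlyDiscontinuousSMul G T := by
  let _ := hc.mulAction
  refine ⟨fun {K L} hK hL => ?_⟩
  have h1 : IsCompact (Subtype.val '' (K ∪ L) : Set (E k)) :=
    (hK.union hL).image continuous_subtype_val
  refine (hc.proper _ h1 (by rintro _ ⟨z, -, rfl⟩; exact z.2)).subset ?_
  rintro g ⟨_, ⟨z, hz, rfl⟩, hz2⟩
  exact ⟨c.a g z, ⟨z, ⟨z, Or.inl hz, rfl⟩, rfl⟩, ⟨g • z, Or.inr hz2, rfl⟩⟩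

lemma isCancelSMul :
    let _ := hc.mulAction
    IsCancelSMul G T := by
  let _ := hc.mulAction
  rw [isCancelSMul_iff_eq_one_of_smul_eq]
  intro g z hz
  exact hc.free g z z.2 (congrArg Subtype.val hz)

lemma isQuotientCoveringMap_proj :
    let _ := hc.mulAction
    IsQuotientCoveringMap hc.proj G := by
  let _ := hc.mulAction
  have := hc.continuousConstSMul
  have := hc.properlyDiscontinuousSMul
  have := hc.isCancelSMul
  have : LocallyCompactSpace T := T.isOpen.locallyCompactSpace
  exact hc.isQuotientMap_proj.isQuotientCoveringMap_of_properlyDiscontinuousSMul hc.proj_eq_iff_mem_orbit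

lemma isLocalHomeomorph_proj : IsLocalHomeomorph hc.proj := by
  let _ := hc.mulAction
  exact hc.isQuotientCoveringMap_proj.isCoveringMap.isLocalHomeomorph

lemma surjective_proj : Function.Surjective hc.proj := hc.isQuotientMap_proj.surjective

instance : T2Space hc.Cross := by
  let _ := hc.mulAction
  have := hc.continuousConstSMul
  have := hc.properlyDiscontinuousSMul
  have : LocallyCompactSpace T := T.isOpen.locallyCompactSpace
  exact hc.isQuotientMap_proj.t2Space_of_orbits hc.proj_eq_iff_mem_orbit

instance : SecondCountableTopology hc.Cross := by
  let _ := hc.mulAction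
  exact hc.isQuotientMap_proj.secondCountableTopology
    hc.isQuotientCoveringMap_proj.isCoveringMap.isOpenMap

lemma hasAffineDeck_proj : HasAffineDeck hc.proj := by
  intro x x' h
  obtain ⟨g, hg⟩ := hc.proj_eq_iff.1 h
  exact ⟨c.a g, hg, Eventually.of_forall fun y => ⟨hc.mem g y y.2, (hc.proj_eq_iff.2 ⟨g, rfl⟩).symm⟩⟩

noncomputable instance : ChartedSpace (E k) hc.Cross :=
  quotientChartedSpace hc.isLocalHomeomorph_proj hc.surjective_proj

instance : IsManifold (𝓡 k) ∞ hc.Cross :=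
  isManifold_quotient hc.isLocalHomeomorph_proj hc.hasAffineDeck_proj hc.surjective_proj

lemma isLocalDiffeomorph_proj : IsLocalDiffeomorph (𝓡 k) (𝓡 k) ∞ hc.proj :=
  isLocalDiffeomorph_quotient hc.isLocalHomeomorph_proj hc.hasAffineDeck_proj hc.surjective_proj

lemma isAffineManifold : IsAffineManifold k hc.Cross :=
  ⟨inferInstance, inferInstance,
    hasGroupoid_quotient hc.isLocalHomeomorph_proj hc.hasAffineDeck_proj hc.surjective_proj⟩

instance : LocallyCompactSpace hc.Cross := ChartedSpace.locallyCompactSpace (E k) _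

/-- A function on `T` is smooth on the manifold `T` if and only if it is smooth on the set `T`. -/
lemma _root_.ConvexCusp.contMDiff_opens_iff {T : TopologicalSpace.Opens (E k)} {f : E k → ℝ} :
    ContMDiff (𝓡 k) 𝓘(ℝ, ℝ) ∞ (fun z : T => f z) ↔ ContDiffOn ℝ ∞ f T := by
  constructor
  · intro h z hz
    exact (contMDiffAt_subtype_iff.1 (h ⟨z, hz⟩)).contDiffAt.contDiffWithinAt
  · intro h z
    exact contMDiffAt_subtype_iff.2
      ((h z z.2).contDiffAt (T.isOpen.mem_nhds z.2)).contMDiffAt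

include hc in
/-- Equivariant relations that locally have constant sections have smooth equivariant sections. -/
theorem exists_section (R : E k → Set ℝ) (hconv : ∀ z ∈ T, Convex ℝ (R z))
    (hR : ∀ g, ∀ z ∈ T, ∀ r ∈ R z, r + c.b g z ∈ R (c.a g z))
    (hloc : ∀ z ∈ T, ∃ r, ∀ᶠ z' in 𝓝 z, r ∈ R z') :
    ∃ s, c.IsSection T s ∧ ∀ z ∈ T, s z ∈ R z := by
  classical
  let _ := hc.mulAction
  have hcov := hc.isQuotientCoveringMap_proj
  have hsmul : ∀ (g : G) (z : T), ((g • z : T) : E k) = c.a g z := fun _ _ => rfl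
  -- Each `U x` is a small sheet that meets none of its non-trivial translates; on it the constant
  -- `r x` satisfies the relation.
  have hU : ∀ x : hc.Cross, ∃ (U : Set T) (r : ℝ), IsOpen U ∧ (∃ z ∈ U, hc.proj z = x) ∧
      (∀ g : G, ∀ z ∈ U, g • z ∈ U → g = 1) ∧ ∀ z ∈ U, r ∈ R z := by
    intro x
    obtain ⟨z, rfl⟩ := hc.surjective_proj x
    obtain ⟨U, hU, hdisj⟩ := hcov.disjoint z
    obtain ⟨r, hr⟩ := hloc z z.2
    have hr' : ∀ᶠ z' : T in 𝓝 z, r ∈ R z' := continuousAt_subtype_val.eventually hr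
    obtain ⟨V, hV, hVo, hzV⟩ := mem_nhds_iff.1 (inter_mem hU hr')
    exact ⟨V, r, hVo, ⟨z, hzV, rfl⟩,
      fun g z hz hgz => hdisj g ⟨g • z, ⟨z, (hV hz).1, rfl⟩, (hV hgz).1⟩, fun z hz => (hV hz).2⟩
  choose U r hUo hUx hUd hUr using hU
  have hVo : ∀ x, IsOpen (hc.proj '' U x) := fun x =>
    hcov.isCoveringMap.isOpenMap _ (hUo x)
  obtain ⟨ρ, hρ⟩ := SmoothPartitionOfUnity.exists_isSubordinate (𝓡 k) (s := (univ : Set hc.Cross))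
    isClosed_univ (fun x => hc.proj '' U x) hVo fun x _ => by
      obtain ⟨z, hz, hzx⟩ := hUx x
      exact mem_iUnion.2 ⟨x, z, hz, hzx⟩
  -- The constant `r x` transported equivariantly over all translates of `U x`. The value `0`
  -- elsewhere is harmless: it only occurs where the weight `ρ x` vanishes.
  let σ : hc.Cross → T → ℝ := fun x z =>
    if h : ∃ g : G, g • z ∈ U x then r x - c.b h.choose z else 0
  have hσ : ∀ x z (g : G), g • z ∈ U x → σ x z = r x - c.b g z := by
    intro x z g hg
    have h : ∃ g : G, g • z ∈ U x := ⟨g, hg⟩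
    have h1 : h.choose = g := by
      have h2 := hUd x (h.choose * g⁻¹) (g • z) hg (by
        rw [mul_smul, inv_smul_smul]; exact h.choose_spec)
      exact mul_inv_eq_one.1 h2
    simp only [σ, dif_pos h, h1]
  have hmem : ∀ x z, hc.proj z ∈ hc.proj '' U x → ∃ g : G, g • z ∈ U x := by
    rintro x z ⟨z', hz', h⟩
    obtain ⟨g, hg⟩ := hc.proj_eq_iff.1 h.symm
    refine ⟨g, ?_⟩
    have : g • z = z' := Subtype.ext hg
    rwa [this]
  have hσR : ∀ x (z : T), hc.proj z ∈ hc.proj '' U x → σ x z ∈ R z := by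
    intro x z hz
    obtain ⟨g, hg⟩ := hmem x z hz
    rw [hσ x z g hg]
    have h1 := hR g⁻¹ (g • z : T) (g • z : T).2 _ (hUr x _ hg)
    rw [hsmul, c.b_inv, c.a_inv_a] at h1
    exact h1
  have hσs : ∀ x z, hc.proj z ∈ hc.proj '' U x → ContMDiffAt (𝓡 k) 𝓘(ℝ, ℝ) ∞ (σ x) z := by
    intro x z hz
    obtain ⟨g, hg⟩ := hmem x z hz
    have h1 : ContMDiff (𝓡 k) 𝓘(ℝ, ℝ) ∞ fun z : T => r x - c.b g z := by
      refine (contMDiff_opens_iff (f := fun z => r x - c.b g z)).2 (ContDiff.contDiffOn ?_)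
      exact contDiff_const.sub
        (⟨c.b g, (c.b g).continuous_of_finiteDimensional⟩ : E k →ᴬ[ℝ] ℝ).contDiff
    refine (h1 z).congr_of_eventuallyEq ?_
    have h2 : ∀ᶠ y in 𝓝 z, g • y ∈ U x :=
      (hcov.toContinuousConstSMul.continuous_const_smul g).continuousAt.eventually
        ((hUo x).mem_nhds hg)
    filter_upwards [h2] with y hy using hσ x y g hy
  have hσe : ∀ x z (g : G), hc.proj z ∈ hc.proj '' U x → σ x (g • z) = σ x z + c.b g z := by
    intro x z g hz
    obtain ⟨h, hh⟩ := hmem x z hz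
    have h1 : (h * g⁻¹) • (g • z) = h • z := by rw [mul_smul, inv_smul_smul]
    rw [hσ x z h hh, hσ x (g • z) (h * g⁻¹) (by rw [h1]; exact hh)]
    have h2 := c.b_mul (h * g⁻¹) g z
    rw [inv_mul_cancel_right] at h2
    rw [hsmul]
    linarith
  have hρU : ∀ x y, ρ x y ≠ 0 → y ∈ hc.proj '' U x := fun x y h =>
    hρ x (subset_tsupport _ h)
  -- The weights live on the quotient, so they are invariant. Since they sum to one, the average
  -- keeps the shift by `c.b g z` and stays in the convex set `R z`.
  let S : T → ℝ := fun z => ∑ᶠ x, ρ x (hc.proj z) • σ x z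
  have hfs : ∀ z, (Function.support fun x => ρ x (hc.proj z)).Finite := fun z =>
    ρ.toPartitionOfUnity.locallyFinite.point_finite (hc.proj z)
  have hSR : ∀ z : T, S z ∈ R z := by
    intro z
    refine (hconv z z.2).finsum_mem (fun x => ρ.nonneg x _) (ρ.sum_eq_one (mem_univ _))
      fun x hx => hσR x z (hρU x _ hx)
  have hSe : ∀ (g : G) z, S (g • z) = S z + c.b g z := by
    intro g z
    have h1 : hc.proj (g • z) = hc.proj z := (hc.proj_eq_iff.2 ⟨g, rfl⟩).symm
    have h2 : ∀ x, ρ x (hc.proj (g • z)) • σ x (g • z) =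
        ρ x (hc.proj z) • σ x z + ρ x (hc.proj z) * c.b g z := by
      intro x
      rw [h1]
      by_cases hx : ρ x (hc.proj z) = 0
      · simp [hx]
      · rw [hσe x z g (hρU x _ hx)]
        simp only [smul_eq_mul]
        ring
    simp only [S]
    simp_rw [h2]
    rw [finsum_add_distrib]
    · congr 1
      rw [← finsum_mul', ρ.sum_eq_one (mem_univ _), one_mul]
      exact hfs z
    · refine (hfs z).subset fun x hx => ?_
      exact left_ne_zero_of_mul hx
    · refine (hfs z).subset fun x hx => ?_
      exact left_ne_zero_of_mul hx
  have hSs : ContMDiff (𝓡 k) 𝓘(ℝ, ℝ) ∞ S := by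
    intro z
    obtain ⟨I, hI⟩ := ρ.toPartitionOfUnity.exists_finset_nhds (hc.proj z)
    have h1 : S =ᶠ[𝓝 z] fun y => ∑ x ∈ I, ρ x (hc.proj y) • σ x y := by
      have h2 := (hc.isQuotientMap_proj.continuous.tendsto z).eventually hI
      filter_upwards [h2] with y hy
      refine finsum_eq_sum_of_support_subset _ ?_
      refine subset_trans (fun x hx => ?_) hy.2
      exact left_ne_zero_of_mul hx
    refine ContMDiffAt.congr_of_eventuallyEq ?_ h1
    refine contMDiffAt_finsetSum fun x _ => ?_
    by_cases hx : hc.proj z ∈ tsupport (ρ x)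
    · have h5 : ContMDiffAt (𝓡 k) 𝓘(ℝ, ℝ) ∞ (fun y => ρ x (hc.proj y)) z :=
        ((ρ x).contMDiff.comp hc.isLocalDiffeomorph_proj.contMDiff) z
      exact h5.smul (hσs x z (hρ x hx))
    · have h3 : (fun y => ρ x (hc.proj y) • σ x y) =ᶠ[𝓝 z] fun _ => 0 := by
        have h4 : ∀ᶠ y in 𝓝 (hc.proj z), ρ x y = 0 := by
          filter_upwards [(isClosed_tsupport (ρ x)).isOpen_compl.mem_nhds hx] with y hy
          exact image_eq_zero_of_notMem_tsupport hy
        filter_upwards [(hc.isQuotientMap_proj.continuous.tendsto z).eventually h4] with y hy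
        rw [hy, zero_smul]
      exact contMDiffAt_const.congr_of_eventuallyEq h3
  let s : E k → ℝ := fun z => if h : z ∈ T then S ⟨z, h⟩ else 0
  have hs : ∀ z : T, s z = S z := fun z => by simp [s]
  refine ⟨s, ⟨contMDiff_opens_iff.1 (by simpa only [hs] using hSs), fun g z hz => ?_⟩,
    fun z hz => ?_⟩
  · have h1 := hSe g ⟨z, hz⟩
    rw [← hs, ← hs] at h1
    exact h1
  · rw [hs ⟨z, hz⟩]
    exact hSR ⟨z, hz⟩

end IsDomain

end CuspAction

end ConvexCusp

/-! ### Sections that descend to the lower boundary, and height functions. -/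

namespace ConvexCusp

namespace CuspAction

variable {G : Type*} [Group G] {k : ℕ} {c : CuspAction G k}

namespace IsSection

variable {T : TopologicalSpace.Opens (E k)} {s : E k → ℝ}

lemma contDiffAt (hs : c.IsSection T s) {z : E k} (hz : z ∈ T) : ContDiffAt ℝ ∞ s z :=
  (hs.contDiffOn z hz).contDiffAt (T.isOpen.mem_nhds hz)

lemma continuousAt (hs : c.IsSection T s) {z : E k} (hz : z ∈ T) : ContinuousAt s z :=
  (hs.contDiffAt hz).continuousAt

end IsSection

namespace IsDomain

variable {T : TopologicalSpace.Opens (E k)} {τ : E k → ℝ}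

/-- There is a section between `τ` and a family of obstacles that stay away from `τ`. -/
theorem exists_section_lt (hc : c.IsDomain T τ) (O : E k → Set ℝ)
    (hO : ∀ g, ∀ z ∈ T, ∀ t ∈ O (c.a g z), t - c.b g z ∈ O z)
    (hloc : ∀ z ∈ T, ∃ r, τ z < r ∧ ∀ᶠ z' in 𝓝 z, ∀ t ∈ O z', r < t) :
    ∃ s, c.IsSection T s ∧ ∀ z ∈ T, τ z < s z ∧ ∀ t ∈ O z, s z < t := by
  refine hc.exists_section (fun z => {r | τ z < r ∧ ∀ t ∈ O z, r < t}) ?_ ?_ ?_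
  · intro z _
    have h1 : {r | τ z < r ∧ ∀ t ∈ O z, r < t} = Ioi (τ z) ∩ ⋂ t ∈ O z, Iio t := by
      ext r; simp
    rw [h1]
    exact (convex_Ioi _).inter (convex_iInter₂ fun t _ => convex_Iio t)
  · rintro g z hz r ⟨h1, h2⟩
    refine ⟨by rw [hc.equivariant g z hz]; linarith, fun t ht => ?_⟩
    linarith [h2 _ (hO g z hz t ht)]
  · intro z hz
    obtain ⟨r, hr, h⟩ := hloc z hz
    refine ⟨r, ?_⟩
    filter_upwards [hc.usc z hz r hr, h] with z' h1 h2 using ⟨h1, h2⟩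

/-- There is a section through any neighbourhood of `τ`. -/
lemma exists_section_lt_at (hc : c.IsDomain T τ) {z₀ : E k} (hz₀ : z₀ ∈ T) {t₀ : ℝ}
    (ht₀ : τ z₀ < t₀) : ∃ s, c.IsSection T s ∧ (∀ z ∈ T, τ z < s z) ∧ s z₀ < t₀ := by
  -- The obstacle is the orbit of the point `(z₀, t₀)`; an equivariant section below it lies below
  -- `t₀` at `z₀`.
  let O : E k → Set ℝ := fun z => {t | ∃ g, c.a g z₀ = z ∧ t = t₀ + c.b g z₀}
  suffices H : ∃ s, c.IsSection T s ∧ ∀ z ∈ T, τ z < s z ∧ ∀ t ∈ O z, s z < t by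
    obtain ⟨s, hs, h⟩ := H
    exact ⟨s, hs, fun z hz => (h z hz).1,
      (h z₀ hz₀).2 t₀ ⟨1, c.a_one z₀, by rw [c.b_one, add_zero]⟩⟩
  refine hc.exists_section_lt O ?_ ?_
  · rintro g z hz _ ⟨h, hh, rfl⟩
    refine ⟨g⁻¹ * h, by rw [c.a_mul, hh, c.a_inv_a], ?_⟩
    rw [c.b_mul, hh, c.b_inv]
    ring
  · intro z hz
    by_cases horb : hc.proj ⟨z₀, hz₀⟩ = hc.proj ⟨z, hz⟩
    · obtain ⟨g, hg⟩ := hc.proj_eq_iff.1 horb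
      change c.a g z₀ = z at hg
      obtain ⟨r, hr1, hr2⟩ := exists_between ht₀
      refine ⟨r + c.b g z₀, by rw [← hg, hc.equivariant g z₀ hz₀]; linarith, ?_⟩
      -- Over a sheet around `z` the orbit has no point other than the translate by `g`, so a value
      -- slightly below that translate works.
      let _ := hc.mulAction
      obtain ⟨U, hU, hdisj⟩ := hc.isQuotientCoveringMap_proj.disjoint (⟨z, hz⟩ : T)
      filter_upwards [eventually_of_subtype hz hU] with z' ⟨hz', hz'U⟩
      rintro _ ⟨h, hh, rfl⟩
      have h1 : h * g⁻¹ = 1 := by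
        refine hdisj (h * g⁻¹) ⟨⟨z', hz'⟩, ⟨⟨z, hz⟩, mem_of_mem_nhds hU, ?_⟩, hz'U⟩
        refine Subtype.ext ?_
        change c.a (h * g⁻¹) z = z'
        rw [c.a_mul, ← hg, c.a_inv_a, hh]
      rw [mul_inv_eq_one.1 h1]
      linarith
    -- The orbit of `z₀` is a closed fibre that misses `z`, so there is no obstacle near `z` and any
    -- value above `τ z` will do.
    · refine ⟨τ z + 1, by linarith, ?_⟩
      have h1 : ∀ᶠ y : T in 𝓝 ⟨z, hz⟩, hc.proj ⟨z₀, hz₀⟩ ≠ hc.proj y :=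
        hc.isQuotientMap_proj.continuous.continuousAt.eventually
          (isOpen_ne.mem_nhds (Ne.symm horb)) |>.mono fun y hy => Ne.symm hy
      filter_upwards [eventually_of_subtype hz h1] with z' ⟨hz', h2⟩
      rintro _ ⟨h, hh, rfl⟩
      exact absurd (hc.proj_eq_iff.2 ⟨h, hh⟩) h2

/-- There is a strictly decreasing sequence of sections that converges to `τ`. -/
theorem exists_seq_section (hc : c.IsDomain T τ) {s₀ : E k → ℝ} (hs₀ : c.IsSection T s₀)
    (hτ : ∀ z ∈ T, τ z < s₀ z) :
    ∃ s : ℕ → E k → ℝ, s 0 = s₀ ∧ (∀ n, c.IsSection T (s n)) ∧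
      (∀ n, ∀ z ∈ T, τ z < s n z) ∧
      (∀ n, ∀ z ∈ T, s (n + 1) z < s n z) ∧ ∀ z ∈ T, ∀ t, τ z < t → ∃ n, s n z < t := by
  let D : Set (E k × ℝ) := {x | x.1 ∈ T ∧ τ x.1 < x.2}
  have hσ : ∀ x : D, ∃ s, c.IsSection T s ∧ (∀ z ∈ T, τ z < s z) ∧ s x.1.1 < x.1.2 :=
    fun x => hc.exists_section_lt_at x.2.1 x.2.2
  choose σ hσs hσ1 hσ2 using hσ
  have hopen : ∀ x : D, IsOpen {y : E k × ℝ | y.1 ∈ T ∧ σ x y.1 < y.2} := by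
    intro x
    rw [isOpen_iff_mem_nhds]
    rintro ⟨z, t⟩ ⟨hz, ht⟩
    have h1 : ContinuousAt (fun y : E k × ℝ => σ x y.1) (z, t) :=
      ((hσs x).continuousAt hz).comp continuousAt_fst
    filter_upwards [h1.eventually_lt continuousAt_snd ht,
      continuousAt_fst.preimage_mem_nhds (T.isOpen.mem_nhds hz)] with y h2 h3 using ⟨h3, h2⟩
  -- By the Lindelöf property, countably many of these sections pass below all points of the domain.
  obtain ⟨C, hC, hCU⟩ := TopologicalSpace.isOpen_iUnion_countable _ hopen
  have hcov : ∀ y ∈ D, ∃ x ∈ C, σ x y.1 < y.2 := by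
    intro y hy
    have h1 : y ∈ ⋃ i ∈ C, {y : E k × ℝ | y.1 ∈ T ∧ σ i y.1 < y.2} := by
      rw [hCU]
      exact mem_iUnion.2 ⟨⟨y, hy⟩, hy.1, hσ2 ⟨y, hy⟩⟩
    obtain ⟨x, hx, hxy⟩ := mem_iUnion₂.1 h1
    exact ⟨x, hx, hxy.2⟩
  have hρ : ∃ ρ : ℕ → E k → ℝ, (∀ n, c.IsSection T (ρ n)) ∧ (∀ n, ∀ z ∈ T, τ z < ρ n z) ∧
      ∀ y ∈ D, ∃ n, ρ n y.1 < y.2 := by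
    rcases C.eq_empty_or_nonempty with h | h
    · refine ⟨fun _ => s₀, fun _ => hs₀, fun _ => hτ, fun y hy => ?_⟩
      obtain ⟨x, hx, -⟩ := hcov y hy
      simp [h] at hx
    · obtain ⟨e, he⟩ := hC.exists_eq_range h
      refine ⟨fun n => σ (e n), fun n => hσs _, fun n => hσ1 _, fun y hy => ?_⟩
      obtain ⟨x, hx, hxy⟩ := hcov y hy
      rw [he] at hx
      obtain ⟨n, rfl⟩ := hx
      exact ⟨n, hxy⟩
  obtain ⟨ρ, hρs, hρ1, hρ2⟩ := hρ
  -- Each new section passes below its predecessor and below `ρ n`, so the sequence decreases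
  -- strictly and its limit is `τ`.
  have hnext : ∀ (n : ℕ) (s : {s : E k → ℝ // c.IsSection T s ∧ ∀ z ∈ T, τ z < s z}),
      ∃ s' : {s : E k → ℝ // c.IsSection T s ∧ ∀ z ∈ T, τ z < s z},
        ∀ z ∈ T, s'.1 z < s.1 z ∧ s'.1 z < ρ n z := by
    rintro n ⟨s, hs, hs1⟩
    suffices H : ∃ s', c.IsSection T s' ∧ ∀ z ∈ T, τ z < s' z ∧
        ∀ t ∈ ({s z, ρ n z} : Set ℝ), s' z < t by
      obtain ⟨s', hs', h⟩ := H
      exact ⟨⟨s', hs', fun z hz => (h z hz).1⟩, fun z hz =>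
        ⟨(h z hz).2 _ (by simp), (h z hz).2 _ (by simp)⟩⟩
    refine hc.exists_section_lt (fun z => {s z, ρ n z}) ?_ ?_
    · rintro g z hz t ht
      rcases ht with rfl | rfl
      · simp [hs.equivariant g z hz]
      · simp [(hρs n).equivariant g z hz]
    · intro z hz
      obtain ⟨r, hr1, hr2⟩ := exists_between (lt_min (hs1 z hz) (hρ1 n z hz))
      rw [lt_min_iff] at hr2
      refine ⟨r, hr1, ?_⟩
      filter_upwards [(hs.continuousAt hz).eventually (lt_mem_nhds hr2.1),
        ((hρs n).continuousAt hz).eventually (lt_mem_nhds hr2.2)] with z' h1 h2 t ht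
      rcases ht with rfl | rfl
      · exact h1
      · exact h2
  choose nx hnx using hnext
  let u : ℕ → {s : E k → ℝ // c.IsSection T s ∧ ∀ z ∈ T, τ z < s z} :=
    fun n => Nat.rec ⟨s₀, hs₀, hτ⟩ nx n
  refine ⟨fun n => (u n).1, rfl, fun n => (u n).2.1, fun n => (u n).2.2,
    fun n z hz => (hnx n (u n) z hz).1,
    fun z hz t ht => ?_⟩
  obtain ⟨n, hn⟩ := hρ2 (z, t) ⟨hz, ht⟩
  exact ⟨n + 1, (hnx n (u n) z hz).2.trans hn⟩

/-- The function `g` is smooth and invariant on the domain above `τ`, strictly decreasing on the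
fibres, maps each of them onto `ℝ`, and vanishes on the graph of `s₀`. -/
structure _root_.ConvexCusp.CuspAction.IsHeight (c : CuspAction G k)
    (T : TopologicalSpace.Opens (E k)) (τ s₀ : E k → ℝ) (g : E k × ℝ → ℝ) : Prop where
  contDiffAt : ∀ z ∈ T, ∀ t, τ z < t → ContDiffAt ℝ ∞ g (z, t)
  invariant : ∀ γ, ∀ z ∈ T, ∀ t, τ z < t → g (c.a γ z, t + c.b γ z) = g (z, t)
  eq_sub : ∀ z ∈ T, ∀ t, s₀ z ≤ t → g (z, t) = s₀ z - t
  le_sub : ∀ z ∈ T, ∀ t, τ z < t → ∀ t', t < t' → g (z, t') ≤ g (z, t) - (t' - t)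
  surj : ∀ z ∈ T, ∀ r, ∃ t, τ z < t ∧ g (z, t) = r

/-- Every section above `τ` is the zero set of a height function. -/
theorem exists_height (hc : c.IsDomain T τ) {s₀ : E k → ℝ} (hs₀ : c.IsSection T s₀)
    (hτ : ∀ z ∈ T, τ z < s₀ z) : ∃ g, c.IsHeight T τ s₀ g := by
  obtain ⟨s, hs0, hs, hsτ, hlt, hlim⟩ := hc.exists_seq_section hs₀ hτ
  -- A smooth step: `0` for `t ≥ s n z` and `1` for `t ≤ s (n + 1) z`. The sum of the steps is
  -- locally finite above `τ`, vanishes from `s₀` upwards, and tends to infinity towards `τ`. The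
  -- summand `s₀ z - t` makes all slopes at most `-1`.
  let F : ℕ → E k × ℝ → ℝ := fun n x =>
    Real.smoothTransition ((s n x.1 - x.2) / (s n x.1 - s (n + 1) x.1))
  have hanti : ∀ z ∈ T, ∀ m n, m ≤ n → s n z ≤ s m z := fun z hz m n h =>
    antitone_nat_of_succ_le (f := fun n => s n z) (fun n => (hlt n z hz).le) h
  have hF0 : ∀ z ∈ T, ∀ t N, s N z < t → ∀ n, N ≤ n → F n (z, t) = 0 := by
    intro z hz t N hN n hn
    refine Real.smoothTransition.zero_of_nonpos (div_nonpos_of_nonpos_of_nonneg ?_ ?_)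
    · have := hanti z hz N n hn
      simp only
      linarith
    · have := hlt n z hz
      simp only
      linarith
  have hFsum : ∀ z ∈ T, ∀ t N, s N z < t → ∑ᶠ n, F n (z, t) = ∑ n ∈ Finset.range N, F n (z, t) := by
    intro z hz t N hN
    refine finsum_eq_sum_of_support_subset _ fun n hn => ?_
    by_contra h
    exact hn (hF0 z hz t N hN n (by simpa using h))
  have hFmono : ∀ z ∈ T, ∀ n t t', t ≤ t' → F n (z, t') ≤ F n (z, t) := by
    intro z hz n t t' h
    refine Real.smoothTransition.monotone (div_le_div_of_nonneg_right ?_ ?_)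
    · simp only
      linarith
    · have := hlt n z hz
      simp only
      linarith
  have hcont : ∀ z ∈ T, ∀ N, Continuous fun t => s₀ z - t + ∑ n ∈ Finset.range N, F n (z, t) := by
    intro z hz N
    refine (continuous_const.sub continuous_id).add (continuous_finsetSum _ fun n _ => ?_)
    exact Real.smoothTransition.continuous.comp
      (show Continuous fun t => (s n z - t) / (s n z - s (n + 1) z) by fun_prop)
  refine ⟨fun x => s₀ x.1 - x.2 + ∑ᶠ n, F n x, ?_, ?_, ?_, ?_, ?_⟩
  · intro z hz t ht
    obtain ⟨N, hN⟩ := hlim z hz t ht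
    have h1 : ∀ᶠ x : E k × ℝ in 𝓝 (z, t), x.1 ∈ T ∧ s N x.1 < x.2 := by
      have h2 : ContinuousAt (fun y : E k × ℝ => s N y.1) (z, t) :=
        ((hs N).continuousAt hz).comp continuousAt_fst
      filter_upwards [h2.eventually_lt continuousAt_snd hN,
        continuousAt_fst.preimage_mem_nhds (T.isOpen.mem_nhds hz)] with y h2 h3 using ⟨h3, h2⟩
    have h3 : ∀ n, ContDiffAt ℝ ∞ (fun y : E k × ℝ => s n y.1) (z, t) := fun n =>
      ((hs n).contDiffAt hz).comp (z, t) contDiffAt_fst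
    have h4 : ContDiffAt ℝ ∞
        (fun x : E k × ℝ => s₀ x.1 - x.2 + ∑ n ∈ Finset.range N, F n x) (z, t) := by
      refine ((hs0 ▸ h3 0).sub contDiffAt_snd).add (ContDiffAt.sum fun n _ => ?_)
      refine Real.smoothTransition.contDiffAt.comp (z, t) (ContDiffAt.div ?_ ?_ ?_)
      · exact (h3 n).sub contDiffAt_snd
      · exact (h3 n).sub (h3 (n + 1))
      · have := hlt n z hz
        simp only
        linarith
    refine h4.congr_of_eventuallyEq ?_
    filter_upwards [h1] with x hx
    rw [← hFsum x.1 hx.1 x.2 N hx.2]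
  · intro γ z hz t ht
    have h1 : ∀ n, F n (c.a γ z, t + c.b γ z) = F n (z, t) := by
      intro n
      simp only [F, (hs n).equivariant γ z hz, (hs (n + 1)).equivariant γ z hz]
      congr 2 <;> ring
    simp only [h1, hs₀.equivariant γ z hz]
    ring
  · intro z hz t ht
    have h1 : ∀ n, F n (z, t) = 0 := by
      intro n
      refine Real.smoothTransition.zero_of_nonpos (div_nonpos_of_nonpos_of_nonneg ?_ ?_)
      · have := hanti z hz 0 n (Nat.zero_le n)
        rw [hs0] at this
        simp only
        linarith
      · have := hlt n z hz
        simp only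
        linarith
    simp [h1]
  · intro z hz t ht t' htt
    obtain ⟨N, hN⟩ := hlim z hz t ht
    simp only
    rw [hFsum z hz t N hN, hFsum z hz t' N (hN.trans htt)]
    have := Finset.sum_le_sum fun n (_ : n ∈ Finset.range N) => hFmono z hz n t t' htt.le
    linarith
  · intro z hz r
    obtain ⟨N, hN⟩ := exists_nat_ge r
    have hle : s N z ≤ s₀ z := hs0 ▸ hanti z hz 0 N (Nat.zero_le N)
    -- At height `s N z` the first `N` steps have been completed, so the value is at least `N ≥ r`.
    -- The range `N + 1` includes every step that can be non-zero at or above `s N z`, as `s (N + 1)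
    -- z < s N z`.
    have h1 : r ≤ s₀ z - s N z + ∑ n ∈ Finset.range (N + 1), F n (z, s N z) := by
      have h2 : ∀ n ∈ Finset.range N, F n (z, s N z) = 1 := by
        intro n hn
        refine Real.smoothTransition.one_of_one_le ?_
        have h3 := hlt n z hz
        have h4 := hanti z hz (n + 1) N (Finset.mem_range.1 hn)
        simp only
        rw [one_le_div (by linarith)]
        linarith
      have h5 : 0 ≤ F N (z, s N z) := Real.smoothTransition.nonneg _
      rw [Finset.sum_range_succ, Finset.sum_congr rfl h2]
      simp only [Finset.sum_const, Finset.card_range, nsmul_eq_mul, mul_one]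
      linarith
    have hg : ∀ t, s N z ≤ t → ∑ᶠ n, F n (z, t) = ∑ n ∈ Finset.range (N + 1), F n (z, t) :=
      fun t ht => hFsum z hz t (N + 1) ((hlt N z hz).trans_le ht)
    -- At this height no step contributes and `s₀ z - t ≤ r`: the other endpoint for the
    -- intermediate value theorem.
    have h6 : s₀ z - max (s₀ z) (s₀ z - r) +
        ∑ n ∈ Finset.range (N + 1), F n (z, max (s₀ z) (s₀ z - r)) ≤ r := by
      have h7 : ∀ n ∈ Finset.range (N + 1), F n (z, max (s₀ z) (s₀ z - r)) = 0 := by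
        intro n _
        refine Real.smoothTransition.zero_of_nonpos (div_nonpos_of_nonpos_of_nonneg ?_ ?_)
        · have h8 := hanti z hz 0 n (Nat.zero_le n)
          rw [hs0] at h8
          have := le_max_left (s₀ z) (s₀ z - r)
          simp only
          linarith
        · have := hlt n z hz
          simp only
          linarith
      rw [Finset.sum_eq_zero h7]
      linarith [le_max_right (s₀ z) (s₀ z - r)]
    obtain ⟨t, ⟨ht1, -⟩, ht⟩ := intermediate_value_Icc' (hle.trans (le_max_left _ (s₀ z - r)))
      (hcont z hz (N + 1)).continuousOn ⟨h6, h1⟩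
    refine ⟨t, (hsτ N z hz).trans_le ht1, ?_⟩
    simp only
    rw [hg t ht1]
    exact ht

end IsDomain

end CuspAction

end ConvexCusp

/-! ### Coordinates with `p` vertical and `H` at infinity. -/

/-- A linear functional that is `1` at a vector splits off a line. -/
lemma exists_linearEquiv_ker_prod {V : Type*} [AddCommGroup V] [Module ℝ V] (φ : V →ₗ[ℝ] ℝ)
    {x : V} (hx : φ x = 1) :
    ∃ e : V ≃ₗ[ℝ] LinearMap.ker φ × ℝ, e x = (0, 1) ∧
      (∀ v, (e v).2 = φ v) ∧ ∀ v : LinearMap.ker φ, e v = (v, 0) := by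
  let P : V →ₗ[ℝ] LinearMap.ker φ :=
    (LinearMap.id - φ.smulRight x).codRestrict _ fun v => by simp [hx]
  have hP : ∀ v, (P v : V) = v - φ v • x := fun v => rfl
  refine ⟨LinearEquiv.ofLinearMap (P.prod φ) ((LinearMap.ker φ).subtype.coprod
    (LinearMap.toSpanSingleton ℝ V x)) ?_ ?_, ?_, fun v => rfl, ?_⟩
  · ext v
    · simp [hP]
    · simp
    · simp [hP, hx]
    · simp [hx]
  · ext v
    simp [hP]
  · refine Prod.ext (Subtype.ext ?_) hx
    simp [hP, hx]
  · intro v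
    refine Prod.ext (Subtype.ext ?_) v.2
    simp [hP]

namespace ConvexCusp

/-- Linear coordinates in which a hyperplane and a point on it are in standard position. -/
lemma exists_coordinates {m : ℕ} {Ω : Set (S (m + 1))} (hΩ : IsProperlyConvex Ω) {p : S (m + 1)}
    {H : Submodule ℝ (E (m + 1 + 1))} (hH : IsSupportingHyperplane Ω H p) :
    ∃ e : E (m + 1 + 1) ≃L[ℝ] (E m × ℝ) × ℝ, e p = ((0, 1), 0) ∧
      (∀ v, v ∈ H ↔ (e v).2 = 0) ∧ ∀ v ∈ cone Ω, 0 < (e v).2 := by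
  obtain ⟨x, hx⟩ := hΩ.nonempty
  obtain ⟨f, hfx, hfH⟩ := Submodule.exists_le_ker_of_notMem (hH.disjoint x hx)
  have hf1 : Module.finrank ℝ (LinearMap.ker f) = m + 1 := by
    have h1 := f.finrank_range_add_finrank_ker
    have h2 : LinearMap.range f = ⊤ := LinearMap.range_eq_top.2
      (LinearMap.surjective (by rintro rfl; simp at hfx))
    rw [h2, finrank_top, finrank_euclideanSpace_fin] at h1
    simp at h1
    omega
  have hker : H = LinearMap.ker f :=
    Submodule.eq_of_le_of_finrank_eq hfH (by rw [hf1, hH.finrank])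
  set f' : E (m + 1 + 1) →ₗ[ℝ] ℝ := (f (x : E (m + 1 + 1)))⁻¹ • f with hf'
  have hx1 : f' (x : E (m + 1 + 1)) = 1 := by simp [hf', hfx]
  have hker' : LinearMap.ker f' = LinearMap.ker f := LinearMap.ker_smul _ _ (inv_ne_zero hfx)
  obtain ⟨e₁, he₁, he₁f, he₁k⟩ := exists_linearEquiv_ker_prod f' hx1
  have hp : (p : E (m + 1 + 1)) ∈ LinearMap.ker f' := by
    rw [hker', ← hker]; exact hH.mem
  -- The inner product with the unit vector `p` equals `1` at `p` and splits it off inside `H`.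
  let φ : LinearMap.ker f' →ₗ[ℝ] ℝ :=
    (innerSL ℝ (p : E (m + 1 + 1))).toLinearMap.comp (LinearMap.ker f').subtype
  have hφ : φ ⟨p, hp⟩ = 1 := by
    simp [φ]
  obtain ⟨e₂, he₂, he₂f, -⟩ := exists_linearEquiv_ker_prod φ hφ
  have hd : Module.finrank ℝ (LinearMap.ker φ) = Module.finrank ℝ (E m) := by
    have h1 := e₂.finrank_eq
    have h2 : Module.finrank ℝ (LinearMap.ker f') = m + 1 := by rw [hker', hf1]
    rw [h2] at h1
    simp only [Module.finrank_prod, Module.finrank_self, finrank_euclideanSpace_fin] at h1 ⊢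
    omega
  let e₃ := LinearEquiv.ofFinrankEq _ _ hd
  let e := (e₁.trans ((e₂.trans (e₃.prodCongr (LinearEquiv.refl ℝ ℝ))).prodCongr
    (LinearEquiv.refl ℝ ℝ))).toContinuousLinearEquiv
  have hef : ∀ v, (e v).2 = f' v := fun v => he₁f v
  refine ⟨e, ?_, fun v => ?_, fun v hv => ?_⟩
  · have h1 := he₁k ⟨p, hp⟩
    simp only [] at h1
    change ((e₃ (e₂ (e₁ p).1).1, (e₂ (e₁ p).1).2), (e₁ p).2) = _
    rw [h1, he₂]
    simp
  · rw [hef, hker, ← hker', LinearMap.mem_ker]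
  · rw [hef]
    by_contra! hneg
    -- `H` misses the cone. A negative value at `v` would produce the zero `v - f' v • x` in the
    -- convex cone.
    have hne : ∀ w ∈ cone Ω, f' w ≠ 0 := by
      intro w hw h0
      have h1 : w ∈ H := by rw [hker, ← hker']; exact h0
      refine hH.disjoint _ hw.2 ?_
      rw [coe_toSphere hw.1]
      exact H.smul_mem _ h1
    have hlt := lt_of_le_of_ne hneg (hne v hv)
    have h1 : v + (- f' v) • (x : E (m + 1 + 1)) ∈ cone Ω :=
      add_mem_cone hΩ.convex hv (smul_mem_cone (coe_mem_cone_iff.2 hx) (by linarith))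
    exact hne _ h1 (by simp [hx1])

/-- The open set `U` of rays is the cover of a cusp with fixed point `p` and holonomy `Γ` in a
quotient of `Ω`, and `e` is a system of coordinates adapted to it. -/
structure IsCuspCover {m : ℕ} (Ω U : Set (S (m + 1))) (Γ : Subgroup (GL (Fin (m + 1 + 1)) ℝ))
    (p : S (m + 1)) (e : E (m + 1 + 1) ≃L[ℝ] (E m × ℝ) × ℝ) : Prop where
  properlyConvex : IsProperlyConvex Ω
  discrete : IsDiscreteIn Γ Ω
  torsionFree : ∀ A ∈ Γ, IsOfFinOrder A → A = 1
  mem_closure : p ∈ closure Ω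
  isOpen : IsOpen U
  subset : U ⊆ Ω
  preserves : ∀ A ∈ Γ, act A '' U = U
  starshaped : ∀ v ∈ cone U, ∀ s : ℝ, 0 ≤ s → v + s • (p : E (m + 1 + 1)) ∈ cone U
  point : e p = ((0, 1), 0)
  pos : ∀ v ∈ cone Ω, 0 < (e v).2
  fix : ∀ A ∈ Γ, lin A (p : E (m + 1 + 1)) = p
  snd_lin : ∀ A ∈ Γ, ∀ v, (e (lin A v)).2 = (e v).2

namespace IsCuspCover

variable {m : ℕ} {Ω U : Set (S (m + 1))} {Γ : Subgroup (GL (Fin (m + 1 + 1)) ℝ)}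
    {p : S (m + 1)} {e : E (m + 1 + 1) ≃L[ℝ] (E m × ℝ) × ℝ} (hU : IsCuspCover Ω U Γ p e)
include hU

lemma symm_add (z : E m) (t s : ℝ) :
    e.symm ((z, t + s), 1) = e.symm ((z, t), 1) + s • (p : E (m + 1 + 1)) := by
  apply e.injective
  rw [map_add, map_smul, hU.point, e.apply_symm_apply, e.apply_symm_apply]
  simp

/-- `A` fixes the vector `p` and the last coordinate, so it commutes with vertical translations of
the affine patch: the image over the base does not depend on `t`, and `t` itself is only shifted. -/
lemma lin_symm {A : GL (Fin (m + 1 + 1)) ℝ} (hA : A ∈ Γ) (z : E m) (t : ℝ) :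
    e (lin A (e.symm ((z, t), 1))) = (((e (lin A (e.symm ((z, 0), 1)))).1.1,
      t + (e (lin A (e.symm ((z, 0), 1)))).1.2), 1) := by
  have h1 := hU.symm_add z 0 t
  rw [zero_add] at h1
  have h2 := hU.snd_lin A hA (e.symm ((z, 0), 1))
  rw [h1, map_add, map_smul, hU.fix A hA, map_add, map_smul, hU.point]
  rw [e.apply_symm_apply] at h2
  ext
  · simp
  · simp [add_comm]
  · simp [h2]

omit hU in
/-- The affine embedding of the base. -/
noncomputable def _root_.ConvexCusp.linAffine (e : E (m + 1 + 1) ≃L[ℝ] (E m × ℝ) × ℝ)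
    (A : GL (Fin (m + 1 + 1)) ℝ) : E m →ᵃ[ℝ] (E m × ℝ) × ℝ :=
  ((e : E (m + 1 + 1) →ₗ[ℝ] (E m × ℝ) × ℝ).comp ((lin A).comp
    ((e.symm : (E m × ℝ) × ℝ →ₗ[ℝ] E (m + 1 + 1)).comp
      ((LinearMap.inl ℝ (E m × ℝ) ℝ).comp (LinearMap.inl ℝ (E m) ℝ))))).toAffineMap +
    AffineMap.const ℝ (E m) (e (lin A (e.symm (0, 1))))

omit hU in
lemma _root_.ConvexCusp.linAffine_apply (A : GL (Fin (m + 1 + 1)) ℝ) (z : E m) :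
    linAffine e A z = e (lin A (e.symm ((z, 0), 1))) := by
  have h : (((z, 0), 1) : (E m × ℝ) × ℝ) = ((z, 0), 0) + (0, 1) := by ext <;> simp
  rw [h, map_add, map_add, map_add]
  rfl

/-- The affine action of the holonomy. -/
noncomputable def cuspAction : CuspAction Γ m where
  a A := (((LinearMap.fst ℝ (E m) ℝ).comp (LinearMap.fst ℝ (E m × ℝ) ℝ)).toAffineMap).comp
    (linAffine e A)
  b A := (((LinearMap.snd ℝ (E m) ℝ).comp (LinearMap.fst ℝ (E m × ℝ) ℝ)).toAffineMap).comp
    (linAffine e A)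
  a_one z := by simp [linAffine_apply, lin_one]
  a_mul A B z := by
    have h := congrArg (fun x => (e (lin (A : GL (Fin (m + 1 + 1)) ℝ) (e.symm x))).1.1)
      (hU.lin_symm B.2 z 0)
    rw [hU.lin_symm A.2] at h
    simpa [linAffine_apply, lin_mul] using h
  b_mul A B z := by
    have h := congrArg (fun x => (e (lin (A : GL (Fin (m + 1 + 1)) ℝ) (e.symm x))).1.2)
      (hU.lin_symm B.2 z 0)
    rw [hU.lin_symm A.2] at h
    simpa [linAffine_apply, lin_mul] using h

lemma lin_symm_eq (A : Γ) (z : E m) (t : ℝ) :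
    lin A (e.symm ((z, t), 1)) =
      e.symm ((hU.cuspAction.a A z, t + hU.cuspAction.b A z), 1) := by
  apply e.injective
  rw [e.apply_symm_apply, hU.lin_symm A.2]
  simp only [cuspAction]
  simp [linAffine_apply]

end IsCuspCover

end ConvexCusp

/-! ### The cover as the region above a graph, and proper discontinuity on its base. -/

namespace ConvexCusp

section Patch

variable {m : ℕ} (e : E (m + 1 + 1) ≃L[ℝ] (E m × ℝ) × ℝ) (U : Set (S (m + 1)))

/-- The set of rays `U` in the affine patch given by the coordinates `e`. -/
def patch : Set (E m × ℝ) := {x | e.symm (x, 1) ∈ cone U}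

variable {U} in
lemma isOpen_patch (hU : IsOpen U) : IsOpen (patch e U) :=
  (isOpen_cone hU).preimage (e.symm.continuous.comp (by fun_prop))

/-- The lower boundary of the patch. -/
noncomputable def lowerBoundary (z : E m) : ℝ := sInf {t | (z, t) ∈ patch e U}

/-- The projection of the patch. -/
def base (hU : IsOpen U) : TopologicalSpace.Opens (E m) :=
  ⟨Prod.fst '' patch e U, isOpenMap_fst _ (isOpen_patch e hU)⟩

end Patch

namespace IsCuspCover

variable {m : ℕ} {Ω U : Set (S (m + 1))} {Γ : Subgroup (GL (Fin (m + 1 + 1)) ℝ)}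
    {p : S (m + 1)} {e : E (m + 1 + 1) ≃L[ℝ] (E m × ℝ) × ℝ} (hU : IsCuspCover Ω U Γ p e)
include hU

lemma cone_subset : cone U ⊆ cone Ω := fun _ hv => ⟨hv.1, hU.subset hv.2⟩

/-- Convex domains are bounded below in the direction of `p`. -/
lemma exists_lower_bound : ∃ l : E m → ℝ, Continuous l ∧
    ∀ z t, (z, t) ∈ patch e Ω → l z < t := by
  obtain ⟨g, c, hc, hg, hg'⟩ := hU.properlyConvex.exists_functional
  have hp := hg' p hU.mem_closure
  -- `g` is positive on the cone and at `p`; along the vertical line over `z` it is affine in `t`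
  -- with slope `g p`, and this is its zero.
  refine ⟨fun z => - g (e.symm ((z, 0), 1)) / g p, ?_, fun z t h => ?_⟩
  · have : Continuous g := g.continuous_of_finiteDimensional
    fun_prop
  · have h1 : 0 < g (e.symm ((z, t), 1)) :=
      lt_of_lt_of_le (mul_pos hc (norm_pos_iff.2 h.1)) (hg _ h)
    have h2 := hU.symm_add z 0 t
    rw [zero_add] at h2
    rw [h2, map_add, map_smul, smul_eq_mul] at h1
    rw [div_lt_iff₀ hp]
    linarith

lemma patch_subset : patch e U ⊆ patch e Ω := fun _ h => hU.cone_subset h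

lemma patch_add {z : E m} {t s : ℝ} (h : (z, t) ∈ patch e U) (hs : 0 ≤ s) :
    (z, t + s) ∈ patch e U := by
  have := hU.starshaped _ h s hs
  rwa [← hU.symm_add] at this

lemma bddBelow (z : E m) : BddBelow {t | (z, t) ∈ patch e U} := by
  obtain ⟨l, -, hl⟩ := hU.exists_lower_bound
  exact ⟨l z, fun t ht => (hl z t (hU.patch_subset ht)).le⟩

lemma mem_patch_iff {z : E m} {t : ℝ} :
    (z, t) ∈ patch e U ↔ z ∈ base e U hU.isOpen ∧ lowerBoundary e U z < t := by
  constructor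
  · intro h
    refine ⟨⟨_, h, rfl⟩, ?_⟩
    have h1 : ∀ᶠ t' in 𝓝 t, (z, t') ∈ patch e U :=
      (Continuous.prodMk_right z).continuousAt.preimage_mem_nhds
        ((isOpen_patch e hU.isOpen).mem_nhds h)
    obtain ⟨t', h2, h3⟩ := (h1.filter_mono nhdsWithin_le_nhds |>.and
      (self_mem_nhdsWithin (s := Iio t))).exists
    exact (csInf_le (hU.bddBelow z) h2).trans_lt h3
  · rintro ⟨⟨⟨_, t₀⟩, h0, rfl⟩, ht⟩
    obtain ⟨t', ht', hlt⟩ := exists_lt_of_csInf_lt ⟨t₀, h0⟩ ht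
    have := hU.patch_add ht' (sub_nonneg.2 hlt.le)
    rwa [add_sub_cancel] at this

lemma mem_patch_act_iff {V : Set (S (m + 1))} (A : Γ) (hV : act (A : GL _ ℝ) '' V = V) {z : E m}
    {t : ℝ} :
    (hU.cuspAction.a A z, t + hU.cuspAction.b A z) ∈ patch e V ↔ (z, t) ∈ patch e V := by
  rw [patch, mem_ofPred_eq, ← hU.lin_symm_eq, lin_mem_cone_iff hV]
  rfl

lemma lowerBoundary_le_iff {z : E m} (hz : z ∈ base e U hU.isOpen) {l : ℝ} :
    l ≤ lowerBoundary e U z ↔ ∀ t, (z, t) ∈ patch e U → l ≤ t := by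
  constructor
  · intro h t ht
    exact h.trans (hU.mem_patch_iff.1 ht).2.le
  · intro h
    refine le_of_forall_gt_imp_ge_of_dense fun t ht => h t (hU.mem_patch_iff.2 ⟨hz, ht⟩)

/-- The holonomy acts freely and properly discontinuously on the base. -/
theorem isDomain : hU.cuspAction.IsDomain (base e U hU.isOpen) (lowerBoundary e U) := by
  have hmem : ∀ A, ∀ z ∈ base e U hU.isOpen, hU.cuspAction.a A z ∈ base e U hU.isOpen := by
    rintro A _ ⟨⟨z, t⟩, h, rfl⟩
    exact ⟨_, (hU.mem_patch_act_iff A (hU.preserves A A.2)).2 h, rfl⟩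
  have heq : ∀ A, ∀ z ∈ base e U hU.isOpen, lowerBoundary e U (hU.cuspAction.a A z) =
      lowerBoundary e U z + hU.cuspAction.b A z := by
    intro A z hz
    refine eq_of_forall_gt_iff fun t => ?_
    have h1 := hU.mem_patch_act_iff A (hU.preserves A A.2) (z := z)
      (t := t - hU.cuspAction.b A z)
    rw [sub_add_cancel, hU.mem_patch_iff, hU.mem_patch_iff] at h1
    simp only [hmem A z hz, hz, true_and] at h1
    rw [h1, lt_sub_iff_add_lt]
  have husc : ∀ z ∈ base e U hU.isOpen, ∀ r, lowerBoundary e U z < r →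
      ∀ᶠ z' in 𝓝 z, lowerBoundary e U z' < r := by
    intro z hz r hr
    have h1 : ∀ᶠ z' in 𝓝 z, (z', r) ∈ patch e U :=
      (Continuous.prodMk_left r).continuousAt.preimage_mem_nhds
        ((isOpen_patch e hU.isOpen).mem_nhds (hU.mem_patch_iff.2 ⟨hz, hr⟩))
    filter_upwards [h1] with z' h using (hU.mem_patch_iff.1 h).2
  refine ⟨hmem, heq, husc, ?_, ?_⟩
  · intro A z hz hfix
    -- As `τ` is equivariant, an element that fixes `z` does not shift the fibre. It fixes a point
    -- of `Ω`, hence is trivial.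
    have hb : hU.cuspAction.b A z = 0 := by
      have := heq A z hz
      rw [hfix] at this
      linarith
    have hpt : (z, lowerBoundary e U z + 1) ∈ patch e U :=
      hU.mem_patch_iff.2 ⟨hz, by linarith⟩
    have hlin := hU.lin_symm_eq A z (lowerBoundary e U z + 1)
    rw [hfix, hb, add_zero] at hlin
    refine Subtype.ext (eq_one_of_fixed hU.properlyConvex hU.discrete hU.torsionFree A.2
      (hU.subset hpt.2) ?_)
    rw [act_toSphere hpt.1, hlin]
  · intro K hK hKT
    rcases K.eq_empty_or_nonempty with rfl | hne
    · simp
    obtain ⟨l, hlc, hl⟩ := hU.exists_lower_bound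
    -- Upper semicontinuity bounds `τ` on compact sets, so the points `(z, R)` over `K` form a
    -- compact subset of the cover.
    obtain ⟨R, hR⟩ : ∃ R, ∀ z ∈ K, lowerBoundary e U z < R := by
      refine hK.induction_on (p := fun K => ∃ R, ∀ z ∈ K, lowerBoundary e U z < R) ⟨0, by simp⟩
        (fun s t hst ⟨R, hR⟩ => ⟨R, fun z hz => hR z (hst hz)⟩) ?_ ?_
      · rintro s t ⟨R, hR⟩ ⟨R', hR'⟩
        refine ⟨max R R', ?_⟩
        rintro z (hz | hz)
        · exact (hR z hz).trans_le (le_max_left _ _)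
        · exact (hR' z hz).trans_le (le_max_right _ _)
      · intro z hz
        exact ⟨_, nhdsWithin_le_nhds (husc z (hKT hz) _ (lt_add_one _)), lowerBoundary e U z + 1,
          fun z' hz' => hz'⟩
    obtain ⟨zl, hzl, hmin⟩ := hK.exists_isMinOn hne hlc.continuousOn
    -- If `z` and its image both lie in `K`, the shift is the difference of two values of `τ`, one
    -- below `R` and the other at least the minimum of `l` on `K`.
    have hb : ∀ A, ∀ z ∈ K, hU.cuspAction.a A z ∈ K → hU.cuspAction.b A z ≤ R - l zl := by
      intro A z hz haz
      have h1 := heq A z (hKT hz)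
      have h2 := hR _ haz
      have h3 : l z ≤ lowerBoundary e U z := (hU.lowerBoundary_le_iff (hKT hz)).2
        fun t ht => (hl z t (hU.patch_subset ht)).le
      have h4 : l zl ≤ l z := hmin hz
      linarith
    obtain ⟨g, c, hc, hg, hg'⟩ := hU.properlyConvex.exists_functional
    have hgc : Continuous g := g.continuous_of_finiteDimensional
    have hC : IsCompact ((fun z => e.symm ((z, R), 1)) '' K) :=
      hK.image (e.symm.continuous.comp (by fun_prop))
    obtain ⟨ε, hε, hball⟩ := hC.exists_cthickening_subset_open
      (isOpen_cone hU.properlyConvex.isOpen) (by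
        rintro _ ⟨z, hz, rfl⟩
        exact hU.patch_subset (hU.mem_patch_iff.2 ⟨hKT hz, hR z hz⟩))
    -- The bounded shift puts the image of `(z, R)` over `K` at height at most `R + (R - l zl)`,
    -- where this maximum bounds `g`. With the uniform `ε`, `norm_lin_le` bounds the whole matrix.
    obtain ⟨zu, hzu, hmax⟩ := hK.exists_isMaxOn hne
      (f := fun z => g (e.symm ((z, R + (R - l zl)), 1))) (by fun_prop)
    have hfin := (hU.discrete.finite ((c * ε)⁻¹ * g (e.symm ((zu, R + (R - l zl)), 1))))
    refine (hfin.preimage Subtype.val_injective.injOn).subset ?_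
    rintro A ⟨_, ⟨z, hz, rfl⟩, haz⟩
    refine ⟨A.2, fun v => ?_⟩
    have h1 := norm_lin_le hc hg (hU.discrete.preserves A A.2) hε
      ((Metric.closedBall_subset_cthickening (mem_image_of_mem _ hz) ε).trans hball) v
    refine h1.trans ?_
    have h2 : g (lin A (e.symm ((z, R), 1))) ≤ g (e.symm ((zu, R + (R - l zl)), 1)) := by
      refine le_trans ?_ (hmax haz)
      rw [hU.lin_symm_eq]
      simp only
      rw [hU.symm_add, hU.symm_add _ R, map_add, map_add, map_smul, map_smul]
      have := mul_le_mul_of_nonneg_right (hb A z hz haz) (hg' p hU.mem_closure).le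
      simp only [smul_eq_mul]
      linarith
    gcongr

end IsCuspCover

end ConvexCusp

/-! ### The affine chart of the cover and the quotient by the holonomy. -/

namespace ConvexCusp

/-- Coordinates on Euclidean space that split off the last one. -/
noncomputable def splitLast (m : ℕ) : E (m + 1) ≃L[ℝ] E m × ℝ :=
  ContinuousLinearEquiv.ofFinrankEq (by simp)

lemma contMDiff_opens {k : ℕ} {T : TopologicalSpace.Opens (E k)} {F : Type*} [NormedAddCommGroup F]
    [NormedSpace ℝ F] {f : E k → F} (hf : ∀ z : T, ContDiffAt ℝ ∞ f z) :
    ContMDiff (𝓡 k) 𝓘(ℝ, F) ∞ (fun z : T => f z) :=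
  fun z => contMDiffAt_subtype_iff.2 (hf z).contMDiffAt

section AffineChart

variable {m : ℕ} (e : E (m + 1 + 1) ≃L[ℝ] (E m × ℝ) × ℝ) (U : TopologicalSpace.Opens (S (m + 1)))

/-- The patch as an open subset of Euclidean space. -/
noncomputable def affineDomain : TopologicalSpace.Opens (E (m + 1)) :=
  ⟨splitLast m ⁻¹' patch e U, (isOpen_patch e U.isOpen).preimage (splitLast m).continuous⟩

/-- The affine coordinates of a ray. -/
noncomputable def affineCoord (v : E (m + 1 + 1)) : E m × ℝ := (e v).2⁻¹ • (e v).1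

variable {e}

lemma affineCoord_symm (x : E m × ℝ) : affineCoord e (e.symm (x, 1)) = x := by
  simp [affineCoord]

lemma affineCoord_smul {r : ℝ} (hr : r ≠ 0) (v : E (m + 1 + 1)) :
    affineCoord e (r • v) = affineCoord e v := by
  simp only [affineCoord, map_smul, Prod.smul_snd, Prod.smul_fst, smul_eq_mul, mul_inv, smul_smul]
  congr 1
  field_simp

lemma affineCoord_toSphere (v : E (m + 1 + 1)) (hv : v ≠ 0) :
    affineCoord e (toSphere v : E (m + 1 + 1)) = affineCoord e v := by
  rw [coe_toSphere hv, affineCoord_smul (inv_ne_zero (norm_ne_zero_iff.2 hv))]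

lemma symm_affineCoord {v : E (m + 1 + 1)} (hv : (e v).2 ≠ 0) :
    e.symm (affineCoord e v, 1) = (e v).2⁻¹ • v := by
  apply e.injective
  rw [e.apply_symm_apply, map_smul]
  ext <;> simp [affineCoord, hv]

lemma contDiffAt_affineCoord {v : E (m + 1 + 1)} (hv : (e v).2 ≠ 0) :
    ContDiffAt ℝ ∞ (affineCoord e) v := by
  have h1 : ContDiff ℝ ∞ fun v => e v := e.contDiff
  exact ((contDiff_snd.comp h1).contDiffAt.inv hv).smul (contDiff_fst.comp h1).contDiffAt

end AffineChart

namespace IsCuspCover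

variable {m : ℕ} {Ω : Set (S (m + 1))} {U : TopologicalSpace.Opens (S (m + 1))}
    {Γ : Subgroup (GL (Fin (m + 1 + 1)) ℝ)}
    {p : S (m + 1)} {e : E (m + 1 + 1) ≃L[ℝ] (E m × ℝ) × ℝ} (hU : IsCuspCover Ω U Γ p e)

include hU in
lemma snd_pos (x : U) : 0 < (e ((x : S (m + 1)) : E (m + 1 + 1))).2 :=
  hU.pos _ (coe_mem_cone_iff.2 (hU.subset x.2))

omit hU in
lemma affineCoord_mem_iff {v : E (m + 1 + 1)} (hv : 0 < (e v).2) :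
    affineCoord e v ∈ patch e U ↔ v ∈ cone (U : Set (S (m + 1))) := by
  rw [patch, mem_ofPred_eq, symm_affineCoord hv.ne', smul_mem_cone_iff (inv_pos.2 hv)]

/-- The affine chart of the cover. -/
noncomputable def affineDiffeomorph :
    affineDomain e U ≃ₘ^∞⟮𝓡 (m + 1), 𝓡 (m + 1)⟯ U where
  toFun w := ⟨toSphere (e.symm (splitLast m w, 1)), w.2.2⟩
  invFun x := ⟨(splitLast m).symm (affineCoord e (x : S (m + 1))), by
    change splitLast m _ ∈ patch e U
    rw [(splitLast m).apply_symm_apply, affineCoord_mem_iff (hU.snd_pos x)]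
    exact coe_mem_cone_iff.2 x.2⟩
  left_inv w := by
    apply Subtype.ext
    simp only
    rw [affineCoord_toSphere _ w.2.1, affineCoord_symm, (splitLast m).symm_apply_apply]
  right_inv x := by
    apply Subtype.ext
    simp only
    rw [(splitLast m).apply_symm_apply, symm_affineCoord (hU.snd_pos x).ne',
      toSphere_smul (inv_pos.2 (hU.snd_pos x)), toSphere_coe]
  contMDiff_toFun := by
    refine (ContMDiff.subtypeVal_comp_iff U _).1 ?_
    have h1 : ∀ w : affineDomain e U, e.symm (splitLast m w, 1) ≠ 0 := fun w => w.2.1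
    have h2 : ContMDiff (𝓡 (m + 1)) 𝓘(ℝ, E (m + 1 + 1)) ∞ fun w : affineDomain e U =>
        ‖e.symm (splitLast m w, 1)‖⁻¹ • e.symm (splitLast m w, 1) := by
      refine contMDiff_opens (f := fun w => ‖e.symm (splitLast m w, 1)‖⁻¹ •
        e.symm (splitLast m w, 1)) fun w => ?_
      have h3 : ContDiffAt ℝ ∞ (fun w => e.symm (splitLast m w, 1)) (w : E (m + 1)) :=
        (e.symm.contDiff.comp ((splitLast m).contDiff.prodMk contDiff_const)).contDiffAt
      exact ((h3.norm ℝ (h1 w)).inv (norm_ne_zero_iff.2 (h1 w))).smul h3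
    have : Fact (Module.finrank ℝ (E (m + 1 + 1)) = m + 1 + 1) := ⟨finrank_euclideanSpace_fin⟩
    have h4 := h2.codRestrict_sphere (n := m + 1) fun w => by
      rw [mem_sphere_zero_iff_norm, norm_smul, norm_inv, norm_norm,
        inv_mul_cancel₀ (norm_ne_zero_iff.2 (h1 w))]
    refine h4.congr fun w => ?_
    exact Subtype.ext (coe_toSphere (h1 w))
  contMDiff_invFun := by
    refine (ContMDiff.subtypeVal_comp_iff _ _).1 fun x => ?_
    have h1 : ContMDiffAt 𝓘(ℝ, E (m + 1 + 1)) (𝓡 (m + 1)) ∞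
        (fun v => (splitLast m).symm (affineCoord e v)) ((x : S (m + 1)) : E (m + 1 + 1)) :=
      ((splitLast m).symm.contDiff.contDiffAt.comp _
        (contDiffAt_affineCoord (hU.snd_pos x).ne')).contMDiffAt
    have : Fact (Module.finrank ℝ (E (m + 1 + 1)) = m + 1 + 1) := ⟨finrank_euclideanSpace_fin⟩
    have h2 : ContMDiff (𝓡 (m + 1)) 𝓘(ℝ, E (m + 1 + 1)) ∞
        (fun x : U => ((x : S (m + 1)) : E (m + 1 + 1))) :=
      contMDiff_coe_sphere.comp contMDiff_subtype_val
    exact ContMDiffAt.comp (g := fun v => (splitLast m).symm (affineCoord e v))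
      (f := fun x : U => ((x : S (m + 1)) : E (m + 1 + 1))) x h1 (h2 x)

/-- The action of the holonomy on the cover. -/
@[reducible] noncomputable def mulAction : MulAction Γ U where
  smul A x := ⟨act A x, (act_mem_iff (hU.preserves A A.2)).2 x.2⟩
  one_smul _ := Subtype.ext (act_one _)
  mul_smul _ _ _ := Subtype.ext (act_mul _ _ _)

include hU in
lemma affineCoord_lin (A : Γ) {v : E (m + 1 + 1)} (hv : 0 < (e v).2) :
    affineCoord e (lin A v) = (hU.cuspAction.a A (affineCoord e v).1,
      (affineCoord e v).2 + hU.cuspAction.b A (affineCoord e v).1) := by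
  have h1 := hU.lin_symm_eq A (affineCoord e v).1 (affineCoord e v).2
  rw [Prod.mk.eta, symm_affineCoord hv.ne', map_smul] at h1
  have h2 := congrArg (affineCoord e) h1
  rwa [affineCoord_smul (inv_ne_zero hv.ne'), affineCoord_symm] at h2

include hU in
lemma affineCoord_act (A : Γ) (x : U) :
    affineCoord e (act (A : GL (Fin (m + 1 + 1)) ℝ) x : S (m + 1)) =
      (hU.cuspAction.a A (affineCoord e (x : S (m + 1))).1,
      (affineCoord e (x : S (m + 1))).2 +
        hU.cuspAction.b A (affineCoord e (x : S (m + 1))).1) := by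
  rw [act, affineCoord_toSphere _ (lin_ne_zero (S.ne_zero _)), hU.affineCoord_lin A (hU.snd_pos x)]

include hU in
lemma affineCoord_mem_patch (x : U) : affineCoord e (x : S (m + 1)) ∈ patch e U :=
  (affineCoord_mem_iff (hU.snd_pos x)).2 (coe_mem_cone_iff.2 x.2)

lemma continuousConstSMul :
    let _ := hU.mulAction
    ContinuousConstSMul Γ U := by
  let _ := hU.mulAction
  refine ⟨fun g => ?_⟩
  exact Continuous.subtype_mk ((continuous_act _).comp continuous_subtype_val) _

/-- Inherited from the base, to which the cover projects equivariantly. -/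
lemma properlyDiscontinuousSMul :
    let _ := hU.mulAction
    ProperlyDiscontinuousSMul Γ U := by
  let _ := hU.mulAction
  refine ⟨fun {K L} hK hL => ?_⟩
  let z : U → E m := fun x => (affineCoord e (x : S (m + 1))).1
  have hz : Continuous z := by
    rw [continuous_iff_continuousAt]
    intro x
    have h1 : ContinuousAt (fun x : U => affineCoord e (x : S (m + 1))) x :=
      ContinuousAt.comp (g := affineCoord e)
        (f := fun x : U => ((x : S (m + 1)) : E (m + 1 + 1)))
        (contDiffAt_affineCoord (hU.snd_pos x).ne').continuousAt
        (continuous_subtype_val.comp continuous_subtype_val).continuousAt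
    exact continuousAt_fst.comp h1
  have h1 : IsCompact (z '' (K ∪ L)) := (hK.union hL).image hz
  refine (hU.isDomain.proper _ h1 ?_).subset ?_
  · rintro _ ⟨x, -, rfl⟩
    exact ⟨_, hU.affineCoord_mem_patch x, rfl⟩
  · rintro A ⟨_, ⟨x, hx, rfl⟩, hx2⟩
    refine ⟨hU.cuspAction.a A (z x), ⟨z x, ⟨x, Or.inl hx, rfl⟩, rfl⟩, A • x, Or.inr hx2, ?_⟩
    have := congrArg Prod.fst (hU.affineCoord_act A x)
    exact this

lemma isCancelSMul :
    let _ := hU.mulAction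
    IsCancelSMul Γ U := by
  let _ := hU.mulAction
  rw [isCancelSMul_iff_eq_one_of_smul_eq]
  intro A x hx
  exact Subtype.ext (eq_one_of_fixed hU.properlyConvex hU.discrete hU.torsionFree A.2
      (hU.subset x.2) (congrArg Subtype.val hx))

/-- The map `π` is the quotient map by the action of the holonomy. -/
structure _root_.ConvexCusp.IsHolonomyQuotient (Γ : Subgroup (GL (Fin (m + 1 + 1)) ℝ))
    {Y : Type*} [TopologicalSpace Y] (π : U → Y) : Prop where
  isQuotientMap : IsQuotientMap π
  eq_iff : ∀ x y, π x = π y ↔ ∃ A ∈ Γ, act A (x : S (m + 1)) = y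

variable {Y : Type*} [TopologicalSpace Y] {π : U → Y} (hπ : IsHolonomyQuotient Γ π)
include hπ

lemma eq_iff_mem_orbit {x y : U} :
    let _ := hU.mulAction
    π x = π y ↔ x ∈ MulAction.orbit Γ y := by
  let _ := hU.mulAction
  change π x = π y ↔ _
  rw [eq_comm, hπ.eq_iff]
  constructor
  · rintro ⟨A, hA, h⟩
    exact ⟨⟨A, hA⟩, Subtype.ext h⟩
  · rintro ⟨A, h⟩
    exact ⟨A, A.2, congrArg Subtype.val h⟩

lemma isQuotientCoveringMap :
    let _ := hU.mulAction
    IsQuotientCoveringMap π Γ := by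
  let _ := hU.mulAction
  have := hU.continuousConstSMul
  have := hU.properlyDiscontinuousSMul
  have := hU.isCancelSMul
  have : LocallyCompactSpace U := U.isOpen.locallyCompactSpace
  exact hπ.isQuotientMap.isQuotientCoveringMap_of_properlyDiscontinuousSMul
    (hU.eq_iff_mem_orbit hπ)

include hU in
lemma isLocalHomeomorph : IsLocalHomeomorph π := by
  let _ := hU.mulAction
  exact (hU.isQuotientCoveringMap hπ).isCoveringMap.isLocalHomeomorph

include hU in
lemma t2Space : T2Space Y := by
  let _ := hU.mulAction
  have := hU.continuousConstSMul
  have := hU.properlyDiscontinuousSMul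
  have : LocallyCompactSpace U := U.isOpen.locallyCompactSpace
  exact hπ.isQuotientMap.t2Space_of_orbits (hU.eq_iff_mem_orbit hπ)

include hU in
lemma secondCountableTopology : SecondCountableTopology Y :=
  hπ.isQuotientMap.secondCountableTopology (hU.isLocalHomeomorph hπ).isOpenMap

omit hπ in
variable (π) in
/-- The affine quotient map. -/
noncomputable def affineQuotient (w : affineDomain e U) : Y := π (hU.affineDiffeomorph w)

lemma isLocalHomeomorph_affineQuotient : IsLocalHomeomorph (hU.affineQuotient π) :=
  (hU.isLocalHomeomorph hπ).comp hU.affineDiffeomorph.toHomeomorph.isLocalHomeomorph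

lemma surjective_affineQuotient : Function.Surjective (hU.affineQuotient π) :=
  hπ.isQuotientMap.surjective.comp hU.affineDiffeomorph.surjective

omit hπ in
lemma affineCoord_affineDiffeomorph (w : affineDomain e U) :
    affineCoord e (hU.affineDiffeomorph w : S (m + 1)) = splitLast m w := by
  change affineCoord e (toSphere (e.symm (splitLast m w, 1)) : E (m + 1 + 1)) = _
  rw [affineCoord_toSphere _ w.2.1, affineCoord_symm]

omit hπ in
include hU in
lemma affineCoord_injective {x y : U}
    (h : affineCoord e (x : S (m + 1)) = affineCoord e (y : S (m + 1))) : x = y := by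
  apply hU.affineDiffeomorph.symm.injective
  apply Subtype.ext
  change (splitLast m).symm _ = (splitLast m).symm _
  rw [h]

lemma affineQuotient_eq_iff {w w' : affineDomain e U} :
    hU.affineQuotient π w = hU.affineQuotient π w' ↔ ∃ A : Γ,
      (hU.cuspAction.a A (splitLast m w).1,
        (splitLast m w).2 + hU.cuspAction.b A (splitLast m w).1) = splitLast m w' := by
  rw [affineQuotient, affineQuotient, hπ.eq_iff]
  constructor
  · rintro ⟨A, hA, h⟩
    refine ⟨⟨A, hA⟩, ?_⟩
    rw [← hU.affineCoord_affineDiffeomorph w', ← h, ← hU.affineCoord_affineDiffeomorph w,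
      hU.affineCoord_act ⟨A, hA⟩]
  · rintro ⟨A, h⟩
    refine ⟨A, A.2, ?_⟩
    let x : U := ⟨act A _, (act_mem_iff (hU.preserves A A.2)).2 (hU.affineDiffeomorph w).2⟩
    have h1 : x = hU.affineDiffeomorph w' := by
      apply hU.affineCoord_injective
      rw [hU.affineCoord_affineDiffeomorph w', ← h, ← hU.affineCoord_affineDiffeomorph w]
      exact hU.affineCoord_act A _
    exact congrArg Subtype.val h1

omit hπ in
/-- The affine action on Euclidean space. -/
noncomputable def deck (A : Γ) : E (m + 1) →ᵃ[ℝ] E (m + 1) :=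
  ((splitLast m).symm : E m × ℝ →ₗ[ℝ] E (m + 1)).toAffineMap.comp
    (AffineMap.prod ((hU.cuspAction.a A).comp
        ((LinearMap.fst ℝ (E m) ℝ).comp (splitLast m : E (m + 1) →ₗ[ℝ] E m × ℝ)).toAffineMap)
      (((LinearMap.snd ℝ (E m) ℝ).comp (splitLast m : E (m + 1) →ₗ[ℝ] E m × ℝ)).toAffineMap +
        (hU.cuspAction.b A).comp
          ((LinearMap.fst ℝ (E m) ℝ).comp (splitLast m : E (m + 1) →ₗ[ℝ] E m × ℝ)).toAffineMap))

omit hπ in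
lemma deck_apply (A : Γ) (w : E (m + 1)) : hU.deck A w = (splitLast m).symm
    (hU.cuspAction.a A (splitLast m w).1,
      (splitLast m w).2 + hU.cuspAction.b A (splitLast m w).1) := rfl

lemma hasAffineDeck : HasAffineDeck (hU.affineQuotient π) := by
  intro w w' h
  obtain ⟨A, hA⟩ := (hU.affineQuotient_eq_iff hπ).1 h
  refine ⟨hU.deck A, by rw [deck_apply, hA, (splitLast m).symm_apply_apply], ?_⟩
  refine Eventually.of_forall fun y => ?_
  have hmem : hU.deck A y ∈ affineDomain e U := by
    change splitLast m (hU.deck A y) ∈ patch e U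
    rw [deck_apply, (splitLast m).apply_symm_apply,
      hU.mem_patch_act_iff A (hU.preserves A A.2)]
    exact y.2
  refine ⟨hmem, ((hU.affineQuotient_eq_iff hπ).2 ⟨A, ?_⟩).symm⟩
  simp only
  rw [deck_apply, (splitLast m).apply_symm_apply]

end IsCuspCover

end ConvexCusp

/-! ### Inverting a height function on the fibres. -/

namespace ConvexCusp

namespace CuspAction.IsHeight

variable {G : Type*} [Group G] {k : ℕ} {c : CuspAction G k} {T : TopologicalSpace.Opens (E k)}
  {τ s₀ : E k → ℝ} {g : E k × ℝ → ℝ} (hg : c.IsHeight T τ s₀ g)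
include hg

lemma strictAnti {z : E k} (hz : z ∈ T) {t t' : ℝ} (ht : τ z < t) (h : t < t') :
    g (z, t') < g (z, t) := by
  linarith [hg.le_sub z hz t ht t' h]

lemma injective {z : E k} (hz : z ∈ T) {t t' : ℝ} (ht : τ z < t) (ht' : τ z < t')
    (h : g (z, t) = g (z, t')) : t = t' := by
  rcases lt_trichotomy t t' with h1 | h1 | h1
  · exact absurd h (hg.strictAnti hz ht h1).ne'
  · exact h1
  · exact absurd h (hg.strictAnti hz ht' h1).ne

lemma nonpos_iff {z : E k} (hz : z ∈ T) {t : ℝ} (ht : τ z < t) :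
    g (z, t) ≤ 0 ↔ s₀ z ≤ t := by
  have h0 : g (z, s₀ z) = 0 := by rw [hg.eq_sub z hz _ le_rfl, sub_self]
  constructor
  · intro h
    by_contra! hlt
    linarith [hg.strictAnti hz ht hlt]
  · intro h
    rw [hg.eq_sub z hz t h]
    linarith

/-- By `le_sub` the vertical difference quotients are at most `-1`. -/
lemma fderiv_ne_zero {z : E k} (hz : z ∈ T) {t : ℝ} (ht : τ z < t) :
    fderiv ℝ g (z, t) (0, 1) ≠ 0 := by
  have h1 : HasFDerivAt g (fderiv ℝ g (z, t)) (z, t) :=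
    ((hg.contDiffAt z hz t ht).differentiableAt (by simp)).hasFDerivAt
  have h2 : HasDerivAt (fun s : ℝ => ((z, s) : E k × ℝ)) (0, 1) t :=
    (hasDerivAt_const t z).prodMk (hasDerivAt_id t)
  have h3 : HasDerivAt (fun s => g (z, s)) (fderiv ℝ g (z, t) (0, 1)) t :=
    HasFDerivAt.comp_hasDerivAt (f := fun s : ℝ => ((z, s) : E k × ℝ)) t h1 h2
  have h4 := (hasDerivAt_iff_tendsto_slope.1 h3).mono_left
    (nhdsWithin_mono t (fun _ h => (mem_Ioi.1 h).ne') : 𝓝[Ioi t] t ≤ 𝓝[≠] t)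
  have h5 : fderiv ℝ g (z, t) (0, 1) ≤ -1 := by
    refine le_of_tendsto h4 ?_
    filter_upwards [self_mem_nhdsWithin] with s hs
    have hs' : t < s := hs
    rw [slope_def_field, div_le_iff₀ (by linarith)]
    linarith [hg.le_sub z hz t ht s hs']
  linarith

/-- The height function has a smooth inverse on the fibres. -/
lemma exists_inverse (husc : IsOpen {x : E k × ℝ | x.1 ∈ T ∧ τ x.1 < x.2}) :
    ∃ θ : E k × ℝ → ℝ, ∀ z ∈ T, ∀ r,
      τ z < θ (z, r) ∧ g (z, θ (z, r)) = r ∧ ContDiffAt ℝ ∞ θ (z, r) := by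
  have h1 : ∀ x : E k × ℝ, ∃ t, x.1 ∈ T → τ x.1 < t ∧ g (x.1, t) = x.2 := by
    intro x
    by_cases hx : x.1 ∈ T
    · obtain ⟨t, ht⟩ := hg.surj x.1 hx x.2
      exact ⟨t, fun _ => ht⟩
    · exact ⟨0, fun h => absurd h hx⟩
  choose θ hθ using h1
  refine ⟨θ, fun z hz r => ⟨(hθ (z, r) hz).1, (hθ (z, r) hz).2, ?_⟩⟩
  set t := θ (z, r) with htd
  have ht : τ z < t := (hθ (z, r) hz).1
  have hgt : g (z, t) = r := (hθ (z, r) hz).2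
  -- The inverse function theorem applies to this map because the vertical derivative of `g` is
  -- non-zero.
  let F : E k × ℝ → E k × ℝ := fun x => (x.1, g x)
  have hF : ContDiffAt ℝ ∞ F (z, t) := contDiffAt_fst.prodMk (hg.contDiffAt z hz t ht)
  have hc := hg.fderiv_ne_zero hz ht
  set D := fderiv ℝ g (z, t) with hD
  have hgd : HasFDerivAt g D (z, t) :=
    ((hg.contDiffAt z hz t ht).differentiableAt (by simp)).hasFDerivAt
  let L : E k × ℝ →ₗ[ℝ] E k × ℝ := ((ContinuousLinearMap.fst ℝ (E k) ℝ).prod D).toLinearMap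
  have hL : Function.Injective L := by
    rw [injective_iff_map_eq_zero]
    rintro ⟨v, s⟩ h
    have h2 : v = 0 := congrArg Prod.fst h
    have h3 : D (v, s) = 0 := congrArg Prod.snd h
    subst h2
    have h4 : ((0, s) : E k × ℝ) = s • (0, 1) := by ext <;> simp
    rw [h4, map_smul, smul_eq_mul, mul_eq_zero, or_iff_left hc] at h3
    rw [h3]
    rfl
  let Le := (LinearEquiv.ofInjectiveEndo L hL).toContinuousLinearEquiv
  have hF' : HasFDerivAt F (Le : E k × ℝ →L[ℝ] E k × ℝ) (z, t) := by
    have h2 : HasFDerivAt F ((ContinuousLinearMap.fst ℝ (E k) ℝ).prod D) (z, t) :=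
      hasFDerivAt_fst.prodMk hgd
    have h3 : (Le : E k × ℝ →L[ℝ] E k × ℝ) = (ContinuousLinearMap.fst ℝ (E k) ℝ).prod D := by
      ext x <;> rfl
    rwa [h3]
  have hn : (∞ : ℕ∞ω) ≠ 0 := by simp
  have hFz : F (z, t) = (z, r) := by simp only [F, hgt]
  have hinv := hF.to_localInverse hF' hn
  rw [hFz] at hinv
  let φ := hF.toOpenPartialHomeomorph F hF' hn
  have hφs : (z, t) ∈ φ.source := hF.mem_toOpenPartialHomeomorph_source hF' hn
  have hφt : (z, r) ∈ φ.target := by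
    have := φ.map_source hφs
    rwa [show φ (z, t) = (z, r) from hFz] at this
  have hφi : φ.symm (z, r) = (z, t) := by
    rw [← show φ (z, t) = (z, r) from hFz]
    exact φ.left_inv hφs
  -- Near `(z, r)` the local inverse stays above `τ`, where `g` is injective on fibres, so its
  -- second component is `θ`.
  have hev : ∀ᶠ y in 𝓝 (z, r), φ.symm y ∈ {x : E k × ℝ | x.1 ∈ T ∧ τ x.1 < x.2} :=
    (φ.continuousAt_symm hφt).preimage_mem_nhds (husc.mem_nhds (by rw [hφi]; exact ⟨hz, ht⟩))
  refine (contDiffAt_snd.comp (z, r) hinv).congr_of_eventuallyEq ?_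
  filter_upwards [hev, φ.open_target.mem_nhds hφt] with y h2 h3
  have h4 : F (φ.symm y) = y := φ.right_inv h3
  have h5 : (φ.symm y).1 = y.1 := by
    change (F (φ.symm y)).1 = y.1
    rw [h4]
  have h6 : g (φ.symm y) = y.2 := by
    change (F (φ.symm y)).2 = y.2
    rw [h4]
  have h7 : y.1 ∈ T := h5 ▸ h2.1
  have h8 := hθ y h7
  change θ y = (φ.symm y).2
  refine hg.injective h7 h8.1 (h5 ▸ h2.2) ?_
  rw [h8.2, ← h5, Prod.mk.eta, h6]

end CuspAction.IsHeight

end ConvexCusp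

/-! ### The affine structure of the cusp and its splitting by a height function. -/

namespace ConvexCusp

namespace IsCuspCover

variable {m : ℕ} {Ω : Set (S (m + 1))} {U : TopologicalSpace.Opens (S (m + 1))}
    {Γ : Subgroup (GL (Fin (m + 1 + 1)) ℝ)}
    {p : S (m + 1)} {e : E (m + 1 + 1) ≃L[ℝ] (E m × ℝ) × ℝ} (hU : IsCuspCover Ω U Γ p e)
    {Y : Type*} [TopologicalSpace Y] {π : U → Y} (hπ : IsHolonomyQuotient Γ π)

/-- The affine atlas of the cusp. -/
@[reducible] noncomputable def chartedSpace : ChartedSpace (E (m + 1)) Y :=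
  quotientChartedSpace (hU.isLocalHomeomorph_affineQuotient hπ) (hU.surjective_affineQuotient hπ)

include hU in
lemma isAffineManifold :
    letI := hU.chartedSpace hπ
    IsAffineManifold (m + 1) Y :=
  letI := hU.chartedSpace hπ
  ⟨hU.t2Space hπ, hU.secondCountableTopology hπ, hasGroupoid_quotient _ (hU.hasAffineDeck hπ) _⟩

include hU in
lemma isLocalDiffeomorph :
    letI := hU.chartedSpace hπ
    IsLocalDiffeomorph (𝓡 (m + 1)) (𝓡 (m + 1)) ∞ π := by
  let _ := hU.chartedSpace hπ
  intro x
  have h1 := isLocalDiffeomorph_quotient (hU.isLocalHomeomorph_affineQuotient hπ)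
    (hU.hasAffineDeck hπ) (hU.surjective_affineQuotient hπ) (hU.affineDiffeomorph.symm x)
  have h2 := (hU.affineDiffeomorph.symm.isLocalDiffeomorph x).comp _ _ h1
  have h3 : hU.affineQuotient π ∘ hU.affineDiffeomorph.symm = π := by
    funext x
    simp [affineQuotient]
  rwa [h3] at h2

include hU in
lemma isProjectiveAtlas :
    letI := hU.chartedSpace hπ
    IsProjectiveAtlas π := by
  let _ := hU.chartedSpace hπ
  rintro _ ⟨w₀, rfl⟩ x hx
  set w := hU.affineDiffeomorph.symm x with hw
  have hqx : ∀ y, hU.affineQuotient π (hU.affineDiffeomorph.symm y) = π y := fun y => by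
    simp [affineQuotient]
  obtain ⟨A, -, hA⟩ := quotientChart_spec (hU.isLocalHomeomorph_affineQuotient hπ)
    (hU.hasAffineDeck hπ) w₀ w (by rw [hw, hqx]; exact hx)
  let f : E (m + 1 + 1) →ₗ[ℝ] ℝ :=
    (LinearMap.snd ℝ (E m × ℝ) ℝ).comp (e : E (m + 1 + 1) →ₗ[ℝ] (E m × ℝ) × ℝ)
  -- The homogenization of `A`: divided by `f`, it is `A` applied to the affine coordinates.
  let L : E (m + 1 + 1) →ₗ[ℝ] E (m + 1) :=
    A.linear.comp (((splitLast m).symm : E m × ℝ →ₗ[ℝ] E (m + 1)).comp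
      ((LinearMap.fst ℝ (E m × ℝ) ℝ).comp (e : E (m + 1 + 1) →ₗ[ℝ] (E m × ℝ) × ℝ))) +
    f.smulRight (A 0)
  refine ⟨L, f, ?_⟩
  filter_upwards [hU.affineDiffeomorph.symm.continuous.continuousAt.eventually hA] with y hy
  have hpos : 0 < f ((y : S (m + 1)) : E (m + 1 + 1)) := hU.snd_pos y
  refine ⟨hpos, ?_⟩
  rw [← hqx y, hy.2.2]
  have h1 : ((hU.affineDiffeomorph.symm y : affineDomain e U) : E (m + 1)) =
      (f ((y : S (m + 1)) : E (m + 1 + 1)))⁻¹ • (splitLast m).symm (e (y : S (m + 1))).1 := by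
    rw [← map_smul]
    rfl
  rw [h1]
  have h2 : ∀ v, A v = A.linear v + A 0 := fun v => by
    have := A.map_vadd 0 v
    simpa using this
  rw [h2, map_smul]
  simp only [L, LinearMap.add_apply, smul_add, LinearMap.smulRight_apply, smul_smul,
    inv_mul_cancel₀ hpos.ne', one_smul]
  rfl

/-- The projection of the cover to the base. -/
noncomputable def toBase (x : U) : base e U hU.isOpen :=
  ⟨(affineCoord e (x : S (m + 1))).1, _, hU.affineCoord_mem_patch x, rfl⟩

lemma lowerBoundary_lt (x : U) :
    lowerBoundary e U (hU.toBase x : E m) < (affineCoord e (x : S (m + 1))).2 :=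
  (hU.mem_patch_iff.1 (hU.affineCoord_mem_patch x)).2

lemma contDiffAt_coe {F : Type*} [NormedAddCommGroup F] [NormedSpace ℝ F] {f : E (m + 1 + 1) → F}
    {x : U} (hf : ContDiffAt ℝ ∞ f ((x : S (m + 1)) : E (m + 1 + 1))) :
    ContMDiffAt (𝓡 (m + 1)) 𝓘(ℝ, F) ∞ (fun x : U => f (x : S (m + 1))) x := by
  have : Fact (Module.finrank ℝ (E (m + 1 + 1)) = m + 1 + 1) := ⟨finrank_euclideanSpace_fin⟩
  have h2 : ContMDiff (𝓡 (m + 1)) 𝓘(ℝ, E (m + 1 + 1)) ∞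
      (fun x : U => ((x : S (m + 1)) : E (m + 1 + 1))) :=
    contMDiff_coe_sphere.comp contMDiff_subtype_val
  exact ContMDiffAt.comp (g := f)
    (f := fun x : U => ((x : S (m + 1)) : E (m + 1 + 1))) x hf.contMDiffAt (h2 x)

lemma contMDiff_toBase : ContMDiff (𝓡 (m + 1)) (𝓡 m) ∞ hU.toBase := by
  refine (ContMDiff.subtypeVal_comp_iff _ _).1 fun x => ?_
  exact contDiffAt_coe (contDiffAt_fst.comp _ (contDiffAt_affineCoord (hU.snd_pos x).ne'))

/-- The projection of the cover to the cross-section. -/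
noncomputable def toCross (x : U) : hU.isDomain.Cross := hU.isDomain.proj (hU.toBase x)

lemma contMDiff_toCross : ContMDiff (𝓡 (m + 1)) (𝓡 m) ∞ hU.toCross :=
  hU.isDomain.isLocalDiffeomorph_proj.contMDiff.comp hU.contMDiff_toBase

lemma toCross_act {A : GL (Fin (m + 1 + 1)) ℝ} (hA : A ∈ Γ) {x y : U} (h : act A x = y) :
    hU.toCross x = hU.toCross y := by
  refine hU.isDomain.proj_eq_iff.2 ⟨⟨A, hA⟩, ?_⟩
  have := congrArg Prod.fst (hU.affineCoord_act ⟨A, hA⟩ x)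
  rw [h] at this
  exact this.symm

/-- A ray of the cover with given affine coordinates. -/
noncomputable def ofCoord (z : base e U hU.isOpen) (t : ℝ) (ht : lowerBoundary e U z < t) : U :=
  ⟨toSphere (e.symm ((z, t), 1)), (hU.mem_patch_iff.2 ⟨z.2, ht⟩).2⟩

lemma affineCoord_ofCoord (z : base e U hU.isOpen) (t : ℝ) (ht : lowerBoundary e U z < t) :
    affineCoord e (hU.ofCoord z t ht : S (m + 1)) = ((z : E m), t) := by
  change affineCoord e (toSphere (e.symm (((z : E m), t), 1)) : E (m + 1 + 1)) = _
  rw [affineCoord_toSphere _ (hU.mem_patch_iff.2 ⟨z.2, ht⟩).1, affineCoord_symm]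

section Height

variable {s₀ : E m → ℝ} {g : E m × ℝ → ℝ}
    (hg : hU.cuspAction.IsHeight (base e U hU.isOpen) (lowerBoundary e U) s₀ g)

include hU hg in
lemma height_act {A : GL (Fin (m + 1 + 1)) ℝ} (hA : A ∈ Γ) {x y : U} (h : act A x = y) :
    g (affineCoord e (x : S (m + 1))) = g (affineCoord e (y : S (m + 1))) := by
  rw [← h, hU.affineCoord_act ⟨A, hA⟩ x]
  exact (hg.invariant ⟨A, hA⟩ _ (hU.toBase x).2 _ (hU.lowerBoundary_lt x)).symm

include hU in
lemma isOpen_domain : IsOpen {x : E m × ℝ | x.1 ∈ base e U hU.isOpen ∧ lowerBoundary e U x.1 < x.2} := by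
  convert isOpen_patch e hU.isOpen using 1
  ext ⟨z, t⟩
  exact hU.mem_patch_iff.symm

include hg in
/-- A height function splits the cusp as a product. -/
theorem exists_diffeomorph :
    letI := hU.chartedSpace hπ
    ∃ h : Y ≃ₘ^∞⟮𝓡 (m + 1), 𝓘(ℝ, ℝ).prod (𝓡 m)⟯ (ℝ × hU.isDomain.Cross),
      ∀ x, h (π x) = (g (affineCoord e (x : S (m + 1))), hU.toCross x) := by
  let _ := hU.chartedSpace hπ
  obtain ⟨θ, hθ⟩ := hg.exists_inverse (hU.isOpen_domain)
  let f : U → ℝ × hU.isDomain.Cross :=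
    fun x => (g (affineCoord e (x : S (m + 1))), hU.toCross x)
  have hfd : ContMDiff (𝓡 (m + 1)) (𝓘(ℝ, ℝ).prod (𝓡 m)) ∞ f := by
    refine ContMDiff.prodMk (fun x => ?_) hU.contMDiff_toCross
    have h1 : ContDiffAt ℝ ∞ g (affineCoord e (x : S (m + 1))) :=
      hg.contDiffAt _ (hU.toBase x).2 _ (hU.lowerBoundary_lt x)
    exact contDiffAt_coe (h1.comp _ (contDiffAt_affineCoord (hU.snd_pos x).ne'))
  have hfπ : ∀ x y, π x = π y → f x = f y := by
    intro x y h
    obtain ⟨A, hA, hxy⟩ := (hπ.eq_iff x y).1 h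
    exact Prod.ext (hU.height_act hg hA hxy) (hU.toCross_act hA hxy)
  let F : Y → ℝ × hU.isDomain.Cross := fun y => f (Function.surjInv hπ.isQuotientMap.surjective y)
  have hF : ∀ x, F (π x) = f x := fun x => hfπ _ _ (Function.surjInv_eq _ _)
  -- The unique point over `z` at which the height function equals `r`. Invariance of the height
  -- function makes `π ∘ Φ` depend only on `r` and the class of `z`.
  let Φ : ℝ × base e U hU.isOpen → U := fun x => hU.ofCoord x.2 (θ (x.2, x.1)) (hθ x.2 x.2.2 x.1).1
  have hΦ : ContMDiff (𝓘(ℝ, ℝ).prod (𝓡 m)) (𝓡 (m + 1)) ∞ Φ := by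
    have h1 : ContMDiff (𝓘(ℝ, ℝ).prod (𝓡 m)) (𝓡 (m + 1)) ∞ fun x : ℝ × base e U hU.isOpen =>
        (⟨(splitLast m).symm (x.2, θ (x.2, x.1)), by
          change splitLast m _ ∈ patch e U
          rw [(splitLast m).apply_symm_apply]
          exact hU.mem_patch_iff.2 ⟨x.2.2, (hθ x.2 x.2.2 x.1).1⟩⟩ : affineDomain e U) := by
      refine (ContMDiff.subtypeVal_comp_iff _ _).1 fun x => ?_
      have h2 : ContMDiff (𝓘(ℝ, ℝ).prod (𝓡 m)) 𝓘(ℝ, E m × ℝ) ∞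
          fun x : ℝ × base e U hU.isOpen => ((x.2 : E m), x.1) :=
        (contMDiff_subtype_val.comp contMDiff_snd).prodMk_space contMDiff_fst
      have h3 : ContDiffAt ℝ ∞ (fun y : E m × ℝ => (splitLast m).symm (y.1, θ y))
          ((x.2 : E m), x.1) :=
        (splitLast m).symm.contDiff.contDiffAt.comp _
          (contDiffAt_fst.prodMk (hθ x.2 x.2.2 x.1).2.2)
      exact ContMDiffAt.comp (g := fun y : E m × ℝ => (splitLast m).symm (y.1, θ y))
        (f := fun x : ℝ × base e U hU.isOpen => ((x.2 : E m), x.1)) x h3.contMDiffAt (h2 x)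
    refine (hU.affineDiffeomorph.contMDiff.comp h1).congr fun x => ?_
    apply Subtype.ext
    change toSphere _ = toSphere (e.symm (splitLast m ((splitLast m).symm _), 1))
    rw [(splitLast m).apply_symm_apply]
  have hΦf : ∀ x : U, Φ ((f x).1, hU.toBase x) = x := by
    intro x
    apply hU.affineCoord_injective
    rw [hU.affineCoord_ofCoord]
    have h1 := hθ (hU.toBase x) (hU.toBase x).2 (f x).1
    refine Prod.ext rfl ?_
    exact hg.injective (hU.toBase x).2 h1.1 (hU.lowerBoundary_lt x) h1.2.1
  have hfΦ : ∀ r z, f (Φ (r, z)) = (r, hU.isDomain.proj z) := by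
    intro r z
    have h1 : affineCoord e (Φ (r, z) : S (m + 1)) = ((z : E m), θ (z, r)) :=
      hU.affineCoord_ofCoord _ _ _
    refine Prod.ext ?_ ?_
    · simp only [f, h1]
      exact (hθ z z.2 r).2.1
    · change hU.isDomain.proj _ = _
      congr 1
      exact Subtype.ext (congrArg Prod.fst h1)
  have hπΦ : ∀ r z z', hU.isDomain.proj z = hU.isDomain.proj z' → π (Φ (r, z)) = π (Φ (r, z')) := by
    intro r z z' h
    obtain ⟨A, hA⟩ := hU.isDomain.proj_eq_iff.1 h
    let x : U := ⟨act A (Φ (r, z)), (act_mem_iff (hU.preserves A A.2)).2 (Φ (r, z)).2⟩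
    have hx : hU.toBase x = z' := by
      apply Subtype.ext
      have h1 := congrArg Prod.fst (hU.affineCoord_act A (Φ (r, z)))
      rw [hU.affineCoord_ofCoord] at h1
      exact h1.trans hA
    have hfx : (f x).1 = r := by
      have h1 := hU.height_act hg A.2 (x := Φ (r, z)) (y := x) rfl
      have h2 := congrArg Prod.fst (hfΦ r z)
      exact h1.symm.trans h2
    have h3 := hΦf x
    rw [hx, hfx] at h3
    rw [h3]
    exact (hπ.eq_iff _ _).2 ⟨A, A.2, rfl⟩
  let K : ℝ × hU.isDomain.Cross → Y := fun x =>
    π (Φ (x.1, Function.surjInv hU.isDomain.surjective_proj x.2))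
  have hK : ∀ r z, K (r, hU.isDomain.proj z) = π (Φ (r, z)) := fun r z =>
    hπΦ r _ _ (Function.surjInv_eq _ _)
  have hπs := hU.isLocalDiffeomorph hπ
  refine ⟨{ toFun := F, invFun := K, left_inv := ?_, right_inv := ?_, contMDiff_toFun := ?_,
            contMDiff_invFun := ?_ }, hF⟩
  · intro y
    obtain ⟨x, rfl⟩ := hπ.isQuotientMap.surjective y
    rw [hF]
    exact (hK _ _).trans (congrArg π (hΦf x))
  · rintro ⟨r, x⟩
    obtain ⟨z, rfl⟩ := hU.isDomain.surjective_proj x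
    rw [hK, hF, hfΦ]
  · refine hπs.contMDiff_of_comp hπ.isQuotientMap.surjective ?_
    exact hfd.congr hF
  · rintro ⟨r, x⟩
    obtain ⟨z, rfl⟩ := hU.isDomain.surjective_proj x
    have hz := hU.isDomain.isLocalDiffeomorph_proj z
    -- Locally the inverse is `π ∘ Φ` after a smooth local lift from the cross-section to the base.
    have h1 : ContMDiffAt (𝓘(ℝ, ℝ).prod (𝓡 m)) (𝓘(ℝ, ℝ).prod (𝓡 m)) ∞
        (fun y : ℝ × hU.isDomain.Cross => (y.1, hz.localInverse y.2)) (r, hU.isDomain.proj z) :=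
      contMDiffAt_fst.prodMk (ContMDiffAt.comp (g := hz.localInverse)
        (f := fun y : ℝ × hU.isDomain.Cross => y.2) (r, hU.isDomain.proj z)
        hz.localInverse_contMDiffAt contMDiffAt_snd)
    have h2 := ((hπs.contMDiff.comp hΦ) _).comp _ h1
    refine h2.congr_of_eventuallyEq ?_
    have h3 := (continuous_snd.tendsto (r, hU.isDomain.proj z)).eventually
      hz.localInverse_eventuallyEq_right
    filter_upwards [h3] with y hy
    change K y = π (Φ (y.1, hz.localInverse y.2))
    rw [← hK]
    have hy' : hU.isDomain.proj (hz.localInverse y.2) = y.2 := hy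
    rw [hy']

end Height

end IsCuspCover

end ConvexCusp

/-! ### Closures of convex cones, and a criterion for cusp groups. -/

namespace ConvexCusp

section ClosedCones

variable {n : ℕ} {U : Set (S n)} {A : GL (Fin (n + 1)) ℝ} {v w : E (n + 1)}

lemma smul_mem_closure_cone (hv : v ∈ closure (cone U)) {r : ℝ} (hr : 0 < r) :
    r • v ∈ closure (cone U) :=
  map_mem_closure (continuous_const_smul r) hv fun _ h => smul_mem_cone h hr

lemma toSphere_mem_closure_iff (hv : v ≠ 0) : toSphere v ∈ closure U ↔ v ∈ closure (cone U) := by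
  constructor
  · intro h
    have h1 := map_mem_closure continuous_subtype_val h (t := cone U)
      fun x hx => coe_mem_cone_iff.2 hx
    rw [coe_toSphere hv] at h1
    have h2 := smul_mem_closure_cone h1 (norm_pos_iff.2 hv)
    rwa [smul_inv_smul₀ (norm_ne_zero_iff.2 hv)] at h2
  · intro h
    refine closure_mono ?_ ((continuousAt_toSphere hv).continuousWithinAt.mem_closure_image h)
    rintro _ ⟨w, hw, rfl⟩
    exact hw.2

lemma coe_mem_closure_cone_iff {x : S n} : (x : E (n + 1)) ∈ closure (cone U) ↔ x ∈ closure U := by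
  rw [← toSphere_mem_closure_iff (S.ne_zero x), toSphere_coe]

lemma add_mem_cone_of_mem_closure (hU : IsOpen U) (hc : Convex ℝ (cone U)) (hv : v ∈ cone U)
    (hw : w ∈ closure (cone U)) : v + w ∈ cone U := by
  have h1 := hc.combo_interior_closure_mem_interior
    (by rwa [(isOpen_cone hU).interior_eq]) hw (by norm_num : (0 : ℝ) < 1 / 2)
    (by norm_num : (0 : ℝ) ≤ 1 / 2) (by norm_num)
  rw [(isOpen_cone hU).interior_eq] at h1
  have h2 := smul_mem_cone h1 (by norm_num : (0 : ℝ) < 2)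
  rwa [smul_add, smul_smul, smul_smul, show (2 : ℝ) * (1 / 2) = 1 by norm_num, one_smul,
    one_smul] at h2

lemma add_mem_closure_cone (hc : Convex ℝ (cone U)) (hv : v ∈ closure (cone U))
    (hw : w ∈ closure (cone U)) : v + w ∈ closure (cone U) :=
  map_mem_closure₂ continuous_add hv hw fun _ ha _ hb => add_mem_cone hc ha hb

/-- Convex domains are starshaped at the points of their closure. -/
lemma add_smul_mem_cone (hU : IsOpen U) (hc : Convex ℝ (cone U)) {p : S n} (hp : p ∈ closure U)
    (hv : v ∈ cone U) {s : ℝ} (hs : 0 ≤ s) : v + s • (p : E (n + 1)) ∈ cone U := by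
  rcases hs.eq_or_lt with rfl | hs
  · simpa using hv
  · exact add_mem_cone_of_mem_closure hU hc hv
      (smul_mem_closure_cone (coe_mem_closure_cone_iff.2 hp) hs)

/-- The action of a matrix on the sphere of rays. -/
noncomputable def actHomeomorph (A : GL (Fin (n + 1)) ℝ) : S n ≃ₜ S n where
  toFun := act A
  invFun := act A⁻¹
  left_inv := act_inv_act A
  right_inv := act_act_inv A
  continuous_toFun := continuous_act A
  continuous_invFun := continuous_act A⁻¹

lemma act_image_frontier (h : act A '' U = U) : act A '' frontier U = frontier U := by
  have := (actHomeomorph A).image_frontier U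
  change act A '' frontier U = frontier (act A '' U) at this
  rw [this, h]

end ClosedCones

section CuspGroups

variable {n : ℕ} {U : Set (S n)} {Γ : Subgroup (GL (Fin (n + 1)) ℝ)}
  {H : Submodule ℝ (E (n + 1))} {p : S n} {f : E (n + 1) →ₗ[ℝ] ℝ}

lemma combo_ne_zero (hU : IsProperlyConvex U) {x : S n} (hx : x ∈ closure U) (hp : p ∈ closure U)
    {a b : ℝ} (ha : 0 ≤ a) (hb : 0 ≤ b) (hab : 0 < a + b) :
    a • (x : E (n + 1)) + b • (p : E (n + 1)) ≠ 0 := by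
  obtain ⟨g, hg⟩ := hU.patch
  intro h
  have h1 := congrArg g h
  simp only [map_add, map_smul, smul_eq_mul, map_zero] at h1
  have h2 := mul_nonneg hb (hg p hp).le
  rcases ha.eq_or_lt with rfl | ha'
  · have := mul_pos (by linarith : 0 < b) (hg p hp)
    linarith
  · have := mul_pos ha' (hg x hx)
    linarith

lemma mapsTo_radialBoundary (hU : IsProperlyConvex U) (hpU : p ∈ closure U)
    {A : GL (Fin (n + 1)) ℝ} (hA : act A '' U = U)
    (hp : lin A (p : E (n + 1)) = p) {x : S n} (hx : x ∈ radialBoundary U p) :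
    act A x ∈ radialBoundary U p := by
  obtain ⟨h1, h2, h3⟩ := hx
  have hfr := act_image_frontier hA
  have hpA : act A p = p := by rw [act, hp, toSphere_coe]
  refine ⟨(act_mem_iff hfr).2 h1, fun h => h2 ?_, fun h => h3 fun a b ha hb hab => ?_⟩
  · rw [← act_inv_act A x, h]
    nth_rewrite 1 [← hpA]
    rw [act_inv_act]
  · have h0 := combo_ne_zero hU (frontier_subset_closure h1) hpU ha hb hab
    rw [← act_mem_iff hfr, act_toSphere h0, map_add, map_smul, map_smul, hp]
    have hx0 := lin_ne_zero (A := A) (S.ne_zero x)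
    have h4 := h (‖lin A (x : E (n + 1))‖ * a) b (by positivity) hb (by
      have : 0 < ‖lin A (x : E (n + 1))‖ := norm_pos_iff.2 hx0
      rcases ha.eq_or_lt with rfl | ha
      · simpa using hab
      · positivity)
    rwa [act, coe_toSphere hx0, smul_smul, mul_right_comm,
      mul_inv_cancel₀ (norm_ne_zero_iff.2 hx0), one_mul] at h4

/-- A discrete group that preserves a convex domain starshaped at `p` and acts by matrices with
eigenvalues of modulus one is a cusp group. -/
theorem isCuspGroup_of_functional (hU : IsProperlyConvex U) (hd : IsDiscreteIn Γ U)
    (hi : Infinite Γ) (hn : ∀ A ∈ Γ, ¬ IsHyperbolic U A) (hp : p ∈ closure U)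
    (hs : IsSupportingHyperplane U H p) (hpr : Preserves Γ H p) (hfH : ∀ v ∈ H, f v = 0)
    (hfU : ∀ v ∈ cone U, 0 < f v) (hfΓ : ∀ A ∈ Γ, ∀ v, f (lin A v) = f v)
    (hpΓ : ∀ A ∈ Γ, lin A (p : E (n + 1)) = p) : IsCuspGroup Γ U H p := by
  have hpU : p ∉ U := fun h => hs.disjoint p h hs.mem
  have hpf : p ∈ frontier U := by
    rw [frontier, hU.isOpen.interior_eq]
    exact ⟨hp, hpU⟩
  have hfp : f p = 0 := hfH p hs.mem
  -- The horosphere is the image of the radial boundary under `Id + f ⊗ p`; it is invariant because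
  -- the group fixes both `f` and `p`.
  refine ⟨hU, hd, hi, hn, hpf, hs, hpr, _, ⟨f, hfH, rfl, ?_⟩, ?_⟩
  · rintro _ ⟨x, ⟨hx, hxp, hseg⟩, rfl⟩
    have hxc : (x : E (n + 1)) ∈ closure (cone U) :=
      coe_mem_closure_cone_iff.2 (frontier_subset_closure hx)
    have hpc : (p : E (n + 1)) ∈ closure (cone U) := coe_mem_closure_cone_iff.2 hp
    have hfx : 0 ≤ f x := by
      refine closure_minimal (fun v hv => (hfU v hv).le) ?_ hxc
      exact isClosed_le continuous_const f.continuous_of_finiteDimensional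
    push Not at hseg
    obtain ⟨a, b, ha, hb, hab, hnf⟩ := hseg
    have hne := combo_ne_zero hU (frontier_subset_closure hx) hp ha hb hab
    have hcl : a • (x : E (n + 1)) + b • (p : E (n + 1)) ∈ closure (cone U) := by
      rcases ha.eq_or_lt with rfl | ha'
      · rw [zero_smul, zero_add]
        exact smul_mem_closure_cone hpc (by linarith)
      rcases hb.eq_or_lt with rfl | hb'
      · rw [zero_smul, add_zero]
        exact smul_mem_closure_cone hxc ha'
      exact add_mem_closure_cone hU.convex (smul_mem_closure_cone hxc ha')
        (smul_mem_closure_cone hpc hb')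
    have hin : a • (x : E (n + 1)) + b • (p : E (n + 1)) ∈ cone U := by
      refine ⟨hne, ?_⟩
      by_contra hnot
      refine hnf ?_
      rw [frontier, hU.isOpen.interior_eq]
      exact ⟨(toSphere_mem_closure_iff hne).2 hcl, hnot⟩
    have hfpos := hfU _ hin
    rw [map_add, map_smul, map_smul, hfp, smul_zero, add_zero, smul_eq_mul] at hfpos
    have ha' : 0 < a := pos_of_mul_pos_left hfpos hfx
    have hfx' : 0 < f x := pos_of_mul_pos_right hfpos ha
    have hin' : (x : E (n + 1)) + (b / a) • (p : E (n + 1)) ∈ cone U := by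
      have := smul_mem_cone hin (inv_pos.2 ha')
      rwa [smul_add, smul_smul, smul_smul, inv_mul_cancel₀ ha'.ne', one_smul, inv_mul_eq_div] at this
    suffices h : (x : E (n + 1)) + f x • (p : E (n + 1)) ∈ cone U from h.2
    -- From `x + (b / a) • p`, which is in the open cone, larger multiples of `p` are reached by
    -- moving towards `p`, and smaller positive ones by adding a multiple of the closure point `x`.
    rcases le_total (b / a) (f x) with h | h
    · have := add_smul_mem_cone hU.isOpen hU.convex hp hin' (sub_nonneg.2 h)
      rwa [add_assoc, ← add_smul, add_sub_cancel] at this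
    · have hba : 0 < b / a := hfx'.trans_le h
      rcases h.eq_or_lt with h | h
      · rwa [h]
      have h1 := add_mem_cone_of_mem_closure hU.isOpen hU.convex
        (smul_mem_cone hin' (div_pos hfx' hba))
        (smul_mem_closure_cone hxc (sub_pos.2 ((div_lt_one hba).2 h)))
      convert h1 using 1
      rw [smul_add, smul_smul, div_mul_cancel₀ _ hba.ne', sub_smul, one_smul]
      abel
  · have key : ∀ A ∈ Γ, ∀ y ∈ (fun x : S n => toSphere ((x : E (n + 1)) +
        f (x : E (n + 1)) • (p : E (n + 1)))) '' radialBoundary U p,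
        act A y ∈ (fun x : S n => toSphere ((x : E (n + 1)) +
        f (x : E (n + 1)) • (p : E (n + 1)))) '' radialBoundary U p := by
      rintro A hA _ ⟨x, hx, rfl⟩
      refine ⟨act A x, mapsTo_radialBoundary hU hp (hd.preserves A hA) (hpΓ A hA) hx, ?_⟩
      have hx0 := lin_ne_zero (A := A) (S.ne_zero x)
      have hfx : 0 ≤ f x := by
        refine closure_minimal (fun v hv => (hfU v hv).le) ?_
          (coe_mem_closure_cone_iff.2 (frontier_subset_closure hx.1))
        exact isClosed_le continuous_const f.continuous_of_finiteDimensional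
      have hne := combo_ne_zero hU (frontier_subset_closure hx.1) hp zero_le_one hfx (by linarith)
      rw [one_smul] at hne
      simp only
      rw [act_toSphere hne, map_add, map_smul, hpΓ A hA, act, coe_toSphere hx0, map_smul,
        hfΓ A hA, smul_eq_mul, mul_smul, ← smul_add, toSphere_smul (inv_pos.2 (norm_pos_iff.2 hx0))]
    exact fun A hA => act_image_eq (key A hA) (key A⁻¹ (Γ.inv_mem hA))

end CuspGroups

end ConvexCusp

/-! ### A smaller core whose closure stays inside the given one away from `f = 0`. -/

namespace ConvexCusp

section Core

open scoped Pointwise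

variable {n : ℕ} {U : Set (S n)} {Γ : Subgroup (GL (Fin (n + 1)) ℝ)} {p : S n}
  {f : E (n + 1) →ₗ[ℝ] ℝ}

/-- Rescaled by `s⁻¹`, the vectors `v + s • p` tend to `p`. -/
lemma mem_closure_of_starshaped {v : E (n + 1)}
    (h : ∀ s : ℝ, 0 ≤ s → v + s • (p : E (n + 1)) ∈ cone U) : p ∈ closure U := by
  rw [← coe_mem_closure_cone_iff]
  have h1 : Tendsto (fun s : ℝ => s⁻¹ • v + (p : E (n + 1))) atTop
      (𝓝 ((0 : ℝ) • v + (p : E (n + 1)))) :=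
    (tendsto_inv_atTop_zero.smul_const v).add_const _
  rw [zero_smul, zero_add] at h1
  refine mem_closure_of_tendsto h1 ?_
  filter_upwards [eventually_gt_atTop 0] with s hs
  have := smul_mem_cone (h s hs.le) (inv_pos.2 hs)
  rwa [smul_add, inv_smul_smul₀ hs.ne'] at this

/-- The cone generated by a set and a ray. -/
def starCone (p : S n) (Q : Set (E (n + 1))) : Set (E (n + 1)) :=
  {v | ∃ r : ℝ, 0 < r ∧ ∃ w ∈ convexHull ℝ Q, ∃ s : ℝ, 0 ≤ s ∧ v = r • w + s • (p : E (n + 1))}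

lemma isOpen_starCone {Q : Set (E (n + 1))} (hQ : IsOpen Q) : IsOpen (starCone p Q) := by
  have h : starCone p Q = ⋃ r ∈ Ioi (0 : ℝ), ⋃ s ∈ Ici (0 : ℝ),
      (fun w => r • w + s • (p : E (n + 1))) '' convexHull ℝ Q := by
    ext v
    simp only [starCone, mem_ofPred_eq, mem_iUnion, mem_image, exists_prop, mem_Ioi, mem_Ici]
    constructor
    · rintro ⟨r, hr, w, hw, s, hs, rfl⟩
      exact ⟨r, hr, s, hs, w, hw, rfl⟩
    · rintro ⟨r, hr, s, hs, w, hw, rfl⟩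
      exact ⟨r, hr, w, hw, s, hs, rfl⟩
  rw [h]
  refine isOpen_biUnion fun r hr => isOpen_biUnion fun s _ => ?_
  exact ((Homeomorph.smulOfNeZero r (ne_of_gt hr)).trans
    (Homeomorph.addRight (s • (p : E (n + 1))))).isOpenMap _ hQ.convexHull

lemma convex_starCone (Q : Set (E (n + 1))) : Convex ℝ (starCone p Q) := by
  rintro _ ⟨r, hr, w, hw, s, hs, rfl⟩ _ ⟨r', hr', w', hw', s', hs', rfl⟩ a b ha hb hab
  have hρ : 0 < a * r + b * r' := by
    rcases ha.eq_or_lt with rfl | ha'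
    · have : b = 1 := by linarith
      subst this
      linarith
    · have := mul_pos ha' hr
      have := mul_nonneg hb hr'.le
      linarith
  refine ⟨a * r + b * r', hρ, (a * r / (a * r + b * r')) • w + (b * r' / (a * r + b * r')) • w',
    convex_convexHull ℝ Q hw hw' (by positivity) (by positivity) ?_, a * s + b * s',
    by positivity, ?_⟩
  · rw [← add_div, div_self hρ.ne']
  · rw [smul_add (a * r + b * r'), smul_smul (a * r + b * r'), smul_smul (a * r + b * r'),
      mul_div_cancel₀ _ hρ.ne', mul_div_cancel₀ _ hρ.ne']
    module

lemma smul_mem_starCone {Q : Set (E (n + 1))} {v : E (n + 1)} (hv : v ∈ starCone p Q) {c : ℝ}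
    (hc : 0 < c) : c • v ∈ starCone p Q := by
  obtain ⟨r, hr, w, hw, s, hs, rfl⟩ := hv
  exact ⟨c * r, mul_pos hc hr, w, hw, c * s, by positivity, by rw [smul_add, smul_smul, smul_smul]⟩

lemma add_mem_starCone {Q : Set (E (n + 1))} {v : E (n + 1)} (hv : v ∈ starCone p Q) {c : ℝ}
    (hc : 0 ≤ c) : v + c • (p : E (n + 1)) ∈ starCone p Q := by
  obtain ⟨r, hr, w, hw, s, hs, rfl⟩ := hv
  exact ⟨r, hr, w, hw, s + c, by positivity, by rw [add_smul, add_assoc]⟩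

lemma mem_convexHull_union {V : Type*} [AddCommGroup V] [Module ℝ V] {s t : Set V} {x : V}
    (hx : x ∈ convexHull ℝ (s ∪ t)) : x ∈ convexHull ℝ s ∨ x ∈ convexHull ℝ t ∨
      ∃ a ∈ convexHull ℝ s, ∃ b ∈ convexHull ℝ t, ∃ μ : ℝ, 0 ≤ μ ∧ μ ≤ 1 ∧
        x = (1 - μ) • a + μ • b := by
  rcases s.eq_empty_or_nonempty with rfl | hs
  · rw [empty_union] at hx
    exact Or.inr (Or.inl hx)
  rcases t.eq_empty_or_nonempty with rfl | ht
  · rw [union_empty] at hx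
    exact Or.inl hx
  rw [convexHull_union hs ht, mem_convexJoin] at hx
  obtain ⟨a, ha, b, hb, c, d, hc, hd, hcd, rfl⟩ := hx
  exact Or.inr (Or.inr ⟨a, ha, b, hb, d, hd, by linarith, by rw [← hcd, add_sub_cancel_right]⟩)

/-- Finitely many compact convex subsets of a convex set are contained in a compact convex
subset of it. -/
lemma exists_isCompact_convex {V ι : Type*} [AddCommGroup V] [Module ℝ V] [TopologicalSpace V]
    [ContinuousAdd V] [ContinuousSMul ℝ V] {C : Set V} (hC : Convex ℝ C) {N : Set ι}
    (hN : N.Finite) {K : ι → Set V} (hK : ∀ i ∈ N, IsCompact (K i) ∧ Convex ℝ (K i) ∧ K i ⊆ C) :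
    ∃ L, IsCompact L ∧ Convex ℝ L ∧ L ⊆ C ∧ ⋃ i ∈ N, K i ⊆ L := by
  induction N, hN using Set.Finite.induction_on with
  | empty => exact ⟨∅, isCompact_empty, convex_empty, empty_subset _, by simp⟩
  | @insert i N _ _ ih =>
    obtain ⟨L, hL1, hL2, hL3, hL4⟩ := ih fun j hj => hK j (mem_insert_of_mem _ hj)
    obtain ⟨hK1, hK2, hK3⟩ := hK i (mem_insert _ _)
    rw [biUnion_insert]
    rcases (K i).eq_empty_or_nonempty with h | hKn
    · rw [h, empty_union]
      exact ⟨L, hL1, hL2, hL3, hL4⟩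
    rcases L.eq_empty_or_nonempty with rfl | hLn
    · exact ⟨K i, hK1, hK2, hK3, union_subset le_rfl (hL4.trans (empty_subset _))⟩
    refine ⟨convexJoin ℝ (K i) L, ?_, hK2.convexJoin hL2, ?_,
      union_subset (subset_convexJoin_left hLn) (hL4.trans (subset_convexJoin_right hKn))⟩
    · have h1 : convexJoin ℝ (K i) L = (fun x : ℝ × V × V => (1 - x.1) • x.2.1 + x.1 • x.2.2) ''
          (Icc 0 1 ×ˢ K i ×ˢ L) := by
        ext v
        simp only [mem_convexJoin, mem_image, mem_prod, Prod.exists, segment_eq_image]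
        constructor
        · rintro ⟨a, ha, b, hb, t, ht, rfl⟩
          exact ⟨t, a, b, ⟨ht, ha, hb⟩, rfl⟩
        · rintro ⟨t, a, b, ⟨ht, ha, hb⟩, rfl⟩
          exact ⟨a, ha, b, hb, t, ht, rfl⟩
      rw [h1]
      exact (isCompact_Icc.prod (hK1.prod hL1)).image (by fun_prop)
    · intro v hv
      obtain ⟨a, ha, b, hb, hab⟩ := mem_convexJoin.1 hv
      exact hC.segment_subset (hK3 ha) (hL3 hb) hab

/-- An invariant convex domain starshaped at `p` contains a smaller one whose closure meets the
frontier only in the hyperplane `f = 0`. -/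
theorem exists_core (hU : IsProperlyConvex U) (hd : IsDiscreteIn Γ U) (hp : p ∈ closure U)
    (hfU : ∀ v ∈ cone U, 0 < f v) (hfΓ : ∀ A ∈ Γ, ∀ v, f (lin A v) = f v)
    (hpΓ : ∀ A ∈ Γ, lin A (p : E (n + 1)) = p) (hfp : f p = 0) :
    ∃ V ⊆ U, IsProperlyConvex V ∧ (∀ A ∈ Γ, act A '' V = V) ∧ p ∈ closure V ∧
      ∀ v ∈ closure (cone V), 0 < f v → v ∈ cone U := by
  obtain ⟨x₀, hx₀⟩ := hU.nonempty
  obtain ⟨ε₀, hε₀, hball₀⟩ := Metric.nhds_basis_closedBall.mem_iff.1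
    ((isOpen_cone hU.isOpen).mem_nhds (coe_mem_cone_iff.2 hx₀))
  set ε := ε₀ / 2 with hεd
  have hε : 0 < ε := by positivity
  have hballε : ∀ x ∈ Metric.closedBall (x₀ : E (n + 1)) ε, Metric.closedBall x ε ⊆ cone U := by
    intro x hx
    refine (Metric.closedBall_subset_closedBall' ?_).trans hball₀
    rw [Metric.mem_closedBall] at hx
    linarith
  have hBU : Metric.closedBall (x₀ : E (n + 1)) ε ⊆ cone U :=
    (Metric.closedBall_subset_closedBall (by linarith)).trans hball₀
  set B := Metric.ball (x₀ : E (n + 1)) ε with hB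
  have hBcl : B ⊆ Metric.closedBall (x₀ : E (n + 1)) ε := Metric.ball_subset_closedBall
  -- The new core is the cone on the hull of the orbit of a small ball, with the direction `p`
  -- added.
  set Q : Set (E (n + 1)) := ⋃ A ∈ Γ, lin A '' B with hQ
  have hlinU : ∀ A ∈ Γ, ∀ v ∈ cone U, lin A v ∈ cone U := fun A hA v hv =>
    (lin_mem_cone_iff (hd.preserves A hA)).2 hv
  have hQo : IsOpen Q := by
    refine isOpen_biUnion fun A _ => ?_
    exact LinearMap.isOpenMap_of_finiteDimensional _ (fun v => ⟨lin A⁻¹ v, lin_lin_inv A v⟩) _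
      Metric.isOpen_ball
  have hQU : Q ⊆ cone U := by
    refine iUnion₂_subset fun A hA => ?_
    rintro _ ⟨v, hv, rfl⟩
    exact hlinU A hA v (hBU (hBcl hv))
  have hhull : convexHull ℝ Q ⊆ cone U := convexHull_min hQU hU.convex
  have hCU : starCone p Q ⊆ cone U := by
    rintro _ ⟨r, hr, w, hw, s, hs, rfl⟩
    exact add_smul_mem_cone hU.isOpen hU.convex hp (smul_mem_cone (hhull hw) hr) hs
  set V : Set (S n) := {x | (x : E (n + 1)) ∈ starCone p Q} with hV
  have hcone : cone V = starCone p Q := by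
    ext v
    constructor
    · rintro ⟨h0, hv⟩
      have h1 : ((toSphere v : S n) : E (n + 1)) ∈ starCone p Q := hv
      rw [coe_toSphere h0] at h1
      have h2 := smul_mem_starCone h1 (norm_pos_iff.2 h0)
      rwa [smul_inv_smul₀ (norm_ne_zero_iff.2 h0)] at h2
    · intro hv
      have h0 := (hCU hv).1
      refine ⟨h0, ?_⟩
      change ((toSphere v : S n) : E (n + 1)) ∈ starCone p Q
      rw [coe_toSphere h0]
      exact smul_mem_starCone hv (inv_pos.2 (norm_pos_iff.2 h0))
  have hVU : V ⊆ U := fun x hx => coe_mem_cone_iff.1 (hCU hx)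
  have hx₀Q : (x₀ : E (n + 1)) ∈ Q :=
    mem_iUnion₂.2 ⟨1, Γ.one_mem, x₀, Metric.mem_ball_self hε, lin_one _⟩
  have hx₀C : (x₀ : E (n + 1)) ∈ starCone p Q :=
    ⟨1, one_pos, x₀, subset_convexHull ℝ Q hx₀Q, 0, le_rfl, by simp⟩
  have hlinQ : ∀ A ∈ Γ, ∀ w ∈ convexHull ℝ Q, lin A w ∈ convexHull ℝ Q := by
    intro A hA w hw
    have h1 : lin A w ∈ lin A '' convexHull ℝ Q := mem_image_of_mem _ hw
    rw [LinearMap.image_convexHull] at h1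
    refine convexHull_mono ?_ h1
    rintro _ ⟨v, hv, rfl⟩
    obtain ⟨A', hA', u, hu, rfl⟩ := mem_iUnion₂.1 hv
    exact mem_iUnion₂.2 ⟨A * A', Γ.mul_mem hA hA', u, hu, lin_mul _ _ _⟩
  have hactV : ∀ A ∈ Γ, ∀ x ∈ V, act A x ∈ V := by
    intro A hA x hx
    have h0 := lin_ne_zero (A := A) (S.ne_zero x)
    change ((act A x : S n) : E (n + 1)) ∈ starCone p Q
    rw [act, coe_toSphere h0]
    refine smul_mem_starCone ?_ (inv_pos.2 (norm_pos_iff.2 h0))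
    obtain ⟨r, hr, w, hw, s, hs, h⟩ := hx
    rw [h, map_add, map_smul, map_smul, hpΓ A hA]
    exact ⟨r, hr, _, hlinQ A hA w hw, s, hs, rfl⟩
  refine ⟨V, hVU, ⟨⟨x₀, hx₀C⟩, (isOpen_starCone hQo).preimage continuous_subtype_val,
    hcone ▸ convex_starCone Q, ?_⟩, fun A hA => act_image_eq (hactV A hA)
      (hactV A⁻¹ (Γ.inv_mem hA)), mem_closure_of_starshaped (v := (x₀ : E (n + 1))) ?_, ?_⟩
  · obtain ⟨g, hg⟩ := hU.patch
    exact ⟨g, fun x hx => hg x (closure_mono hVU hx)⟩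
  · intro s hs
    rw [hcone]
    exact add_mem_starCone hx₀C hs
  rw [hcone]
  intro v hv hfv
  obtain ⟨g, c, hc, hg, hg'⟩ := hU.exists_functional
  have hgp := hg' p hp
  have hfc : Continuous f := f.continuous_of_finiteDimensional
  have hgc : Continuous g := g.continuous_of_finiteDimensional
  have hgpos : ∀ v ∈ cone U, 0 < g v := fun v hv =>
    lt_of_lt_of_le (mul_pos hc (norm_pos_iff.2 hv.1)) (hg v hv)
  have hBcomp : IsCompact (Metric.closedBall (x₀ : E (n + 1)) ε) := isCompact_closedBall _ _
  obtain ⟨y₁, hy₁, hmin⟩ := hBcomp.exists_isMinOn ⟨x₀, Metric.mem_closedBall_self hε.le⟩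
    hfc.continuousOn
  obtain ⟨y₂, hy₂, hmax⟩ := hBcomp.exists_isMaxOn ⟨x₀, Metric.mem_closedBall_self hε.le⟩
    hfc.continuousOn
  set δ := f y₁ with hδd
  set Δ := f y₂ with hΔd
  have hδ : 0 < δ := hfU _ (hBU hy₁)
  have hΔ : 0 < Δ := hfU _ (hBU hy₂)
  -- `f` is invariant, so on the whole orbit it stays within its bounds on the closed ball. This
  -- controls the scale `r` of a vector `r • w + s • p` through its value of `f`.
  have hfQ : convexHull ℝ Q ⊆ f ⁻¹' Icc δ Δ := by
    refine convexHull_min ?_ ((convex_Icc δ Δ).linear_preimage f)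
    refine iUnion₂_subset fun A hA => ?_
    rintro _ ⟨v, hv, rfl⟩
    rw [mem_preimage, hfΓ A hA]
    exact ⟨hmin (hBcl hv), hmax (hBcl hv)⟩
  have hgv : 0 ≤ g v := closure_minimal (fun v hv => (hgpos v (hCU hv)).le)
    (isClosed_le continuous_const hgc) hv
  -- Near `v` one has `g < G`, and `f` is within a factor two of `f v`. For `r • w + s • p` near `v`
  -- this gives `r₀ ≤ r ≤ r₁` and then `g w < G / r₀ = R`.
  set G := g v + 1 with hGd
  have hG : 0 < G := by linarith
  set r₀ := f v / 2 / Δ with hr₀d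
  have hr₀ : 0 < r₀ := by positivity
  set r₁ := 2 * f v / δ with hr₁d
  set R := G / r₀ with hRd
  have hR : 0 < R := by positivity
  -- the orbit splits into a compact part and a part on which `g` is large
  set N : Set (GL (Fin (n + 1)) ℝ) := {A | A ∈ Γ ∧ ∃ x ∈ B, g (lin A x) ≤ 2 * R} with hN
  have hNfin : N.Finite := by
    refine (hd.finite ((c * ε)⁻¹ * (2 * R))).subset ?_
    rintro A ⟨hA, x, hx, hgx⟩
    refine ⟨hA, fun v => ?_⟩
    refine (norm_lin_le hc hg (hd.preserves A hA) hε (hballε x (hBcl hx)) v).trans ?_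
    gcongr
  set Q₁ : Set (E (n + 1)) := ⋃ A ∈ N, lin A '' Metric.closedBall (x₀ : E (n + 1)) ε with hQ₁
  obtain ⟨K, hKc, hKconv, hKU, hQ₁K⟩ : ∃ K, IsCompact K ∧ Convex ℝ K ∧ K ⊆ cone U ∧ Q₁ ⊆ K := by
    refine exists_isCompact_convex hU.convex hNfin fun A hA => ⟨hBcomp.image (continuous_lin A),
      (convex_closedBall _ _).linear_image _, ?_⟩
    rintro _ ⟨v, hv, rfl⟩
    exact hlinU A hA.1 v (hBU hv)
  have hQ₁K' : convexHull ℝ Q₁ ⊆ K := convexHull_min hQ₁K hKconv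
  set Q₂ : Set (E (n + 1)) := Q ∩ {w | 2 * R ≤ g w} with hQ₂
  have hQ₂g : convexHull ℝ Q₂ ⊆ {w | 2 * R ≤ g w} :=
    convexHull_min inter_subset_right (convex_halfSpace_ge g.isLinear _)
  have hQ₂U : convexHull ℝ Q₂ ⊆ cone U := (convexHull_mono inter_subset_left).trans hhull
  have hQsub : Q ⊆ Q₁ ∪ Q₂ := by
    intro w hw
    obtain ⟨A, hA, x, hx, rfl⟩ := mem_iUnion₂.1 hw
    by_cases h : g (lin A x) ≤ 2 * R
    · exact Or.inl (mem_iUnion₂.2 ⟨A, ⟨hA, x, hx, h⟩, x, hBcl hx, rfl⟩)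
    · exact Or.inr ⟨hw, (not_le.1 h).le⟩
  -- `Z` is compact in the open cone, so `Z + closure (cone U)` is closed and still inside the open
  -- cone. It suffices that the vectors of the new cone near `v` belong to it.
  set Z : Set (E (n + 1)) := (fun y : ℝ × E (n + 1) => y.1 • y.2) ''
    (Icc (r₀ / 2) r₁ ×ˢ K) with hZ
  have hZc : IsCompact Z := (isCompact_Icc.prod hKc).image (by fun_prop)
  have hclosed : IsClosed (Z + closure (cone U)) := isClosed_closure.add_left_of_isCompact hZc
  have hsub : Z + closure (cone U) ⊆ cone U := by
    rintro _ ⟨_, ⟨⟨r, w⟩, ⟨hr, hw⟩, rfl⟩, u, hu, rfl⟩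
    exact add_mem_cone_of_mem_closure hU.isOpen hU.convex
      (smul_mem_cone (hKU hw) (by linarith [hr.1])) hu
  refine hsub (closure_minimal ?_ hclosed (?_ :
    v ∈ closure (starCone p Q ∩ {u | f v / 2 < f u ∧ f u < 2 * f v ∧ g u < G})))
  · rintro u ⟨⟨r, hr, w, hw, s, hs, rfl⟩, hu1, hu2, hu3⟩
    have hpc : s • (p : E (n + 1)) ∈ closure (cone U) := by
      rcases hs.eq_or_lt with rfl | hs'
      · rw [zero_smul]
        have h1 : Tendsto (fun t : ℝ => t • (x₀ : E (n + 1))) (𝓝[>] 0) (𝓝 ((0 : ℝ) • (x₀ : E (n + 1)))) :=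
          (tendsto_id.smul_const _).mono_left nhdsWithin_le_nhds
        rw [zero_smul] at h1
        refine mem_closure_of_tendsto h1 ?_
        filter_upwards [self_mem_nhdsWithin] with t ht
        exact smul_mem_cone (coe_mem_cone_iff.2 hx₀) ht
      · exact smul_mem_closure_cone (coe_mem_closure_cone_iff.2 hp) hs'
    have hfw := hfQ hw
    simp only [map_add, map_smul, smul_eq_mul, hfp, mul_zero, add_zero] at hu1 hu2 hu3
    have hrl : r₀ ≤ r := by
      rw [hr₀d, div_le_iff₀ hΔ]
      have := mul_le_mul_of_nonneg_left hfw.2 hr.le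
      linarith
    have hru : r ≤ r₁ := by
      rw [hr₁d, le_div_iff₀ hδ]
      have := mul_le_mul_of_nonneg_left hfw.1 hr.le
      linarith
    have hgw : g w < R := by
      rw [hRd, lt_div_iff₀ hr₀]
      have h1 := mul_le_mul_of_nonneg_left hrl (hgpos w (hhull hw)).le
      have h2 := mul_nonneg hs hgp.le
      linarith
    rcases mem_convexHull_union (convexHull_mono hQsub hw) with h | h | ⟨a, ha, b, hb, μ, h0, h1, rfl⟩
    · exact ⟨r • w, ⟨(r, w), ⟨⟨by linarith, hru⟩, hQ₁K' h⟩, rfl⟩, _, hpc, rfl⟩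
    · have := hQ₂g h
      simp only [mem_ofPred_eq] at this
      linarith
    · have hgb := hQ₂g hb
      simp only [mem_ofPred_eq] at hgb
      -- The part of the orbit with large `g` contributes at least `μ * (2 * R)` to `g w < R`. At
      -- least half of the weight is therefore on the compact part, which explains the lower limit
      -- `r₀ / 2` in `Z`.
      have hμ : μ ≤ 1 / 2 := by
        by_contra! hμ
        simp only [map_add, map_smul, smul_eq_mul] at hgw
        have h2 := mul_nonneg (sub_nonneg.2 h1) (hgpos a (hKU (hQ₁K' ha))).le
        have h3 := mul_le_mul_of_nonneg_left hgb h0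
        nlinarith
      refine ⟨(r * (1 - μ)) • a, ⟨(r * (1 - μ), a), ⟨⟨?_, ?_⟩, hQ₁K' ha⟩, rfl⟩,
        (r * μ) • b + s • (p : E (n + 1)), ?_, ?_⟩
      · nlinarith
      · nlinarith
      · rcases h0.eq_or_lt with rfl | h0'
        · rwa [mul_zero, zero_smul, zero_add]
        · exact subset_closure (add_mem_cone_of_mem_closure hU.isOpen hU.convex
            (smul_mem_cone (hQ₂U hb) (by positivity)) hpc)
      · simp only [smul_add, smul_smul]
        abel
  · rw [inter_comm]
    refine IsOpen.inter_closure ?_ ⟨⟨by linarith, by linarith, by linarith⟩, hv⟩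
    exact (isOpen_lt continuous_const hfc).inter ((isOpen_lt hfc continuous_const).inter
      (isOpen_lt hgc continuous_const))

end Core

end ConvexCusp

/-! ### Components of preimages under the projection to the quotient. -/

namespace ConvexCusp

section Lift

variable {n : ℕ} {Ω : Set (S n)} {Γ' : Subgroup (GL (Fin (n + 1)) ℝ)}
  {V W : Set (OrbitSpace Ω Γ')}

/-- The projection of `Ω` to the quotient. -/
def orbitMk (Ω : Set (S n)) (Γ' : Subgroup (GL (Fin (n + 1)) ℝ)) (x : Ω) : OrbitSpace Ω Γ' :=
  Quotient.mk (orbitSetoid Ω Γ') x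

lemma orbitMk_eq_iff {x y : Ω} :
    orbitMk Ω Γ' x = orbitMk Ω Γ' y ↔ ∃ A ∈ Γ', act A (x : S n) = y := Quotient.eq

lemma continuous_orbitMk : Continuous (orbitMk Ω Γ') := continuous_quotient_mk'

lemma surjective_orbitMk : Function.Surjective (orbitMk Ω Γ') := Quotient.mk_surjective

lemma mem_lift_iff {x : Ω} : (x : S n) ∈ lift V ↔ orbitMk Ω Γ' x ∈ V :=
  ⟨fun h => h.2, fun h => ⟨x.2, h⟩⟩

lemma lift_subset : lift V ⊆ Ω := fun _ h => h.1

lemma lift_mono (h : V ⊆ W) : lift V ⊆ lift W := fun _ hx => ⟨hx.1, h hx.2⟩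

variable (hN : IsConvexManifold Ω Γ')
include hN

lemma isOpenMap_orbitMk : IsOpenMap (orbitMk Ω Γ') := by
  intro D hD
  have h1 : orbitMk Ω Γ' ⁻¹' (orbitMk Ω Γ' '' D) =
      Subtype.val ⁻¹' ⋃ A ∈ Γ', act A '' (Subtype.val '' D) := by
    ext x
    simp only [mem_preimage, mem_image, mem_iUnion, exists_prop]
    constructor
    · rintro ⟨y, hy, h⟩
      obtain ⟨A, hA, h2⟩ := orbitMk_eq_iff.1 h
      exact ⟨A, hA, y, ⟨y, hy, rfl⟩, h2⟩
    · rintro ⟨A, hA, _, ⟨y, hy, rfl⟩, h2⟩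
      exact ⟨y, hy, orbitMk_eq_iff.2 ⟨A, hA, h2⟩⟩
  have hq : IsQuotientMap (orbitMk Ω Γ') := isQuotientMap_quotient_mk'
  rw [← hq.isOpen_preimage, h1]
  refine IsOpen.preimage continuous_subtype_val (isOpen_biUnion fun A _ => ?_)
  exact (actHomeomorph A).isOpenMap _ (hN.properlyConvex.isOpen.isOpenMap_subtype_val _ hD)

lemma isOpen_lift (hV : IsOpen V) : IsOpen (lift V) := by
  have h : lift V = Subtype.val '' (orbitMk Ω Γ' ⁻¹' V) := by
    ext x
    constructor
    · rintro ⟨hx, h⟩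
      exact ⟨⟨x, hx⟩, h, rfl⟩
    · rintro ⟨y, hy, rfl⟩
      exact mem_lift_iff.2 hy
  rw [h]
  exact hN.properlyConvex.isOpen.isOpenMap_subtype_val _ (hV.preimage continuous_orbitMk)

lemma orbitMk_act {A : GL (Fin (n + 1)) ℝ} (hA : A ∈ Γ') (x : Ω) :
    orbitMk Ω Γ' ⟨act A x, (act_mem_iff (hN.discrete.preserves A hA)).2 x.2⟩ = orbitMk Ω Γ' x :=
  (orbitMk_eq_iff.2 ⟨A, hA, rfl⟩).symm

lemma act_image_lift {A : GL (Fin (n + 1)) ℝ} (hA : A ∈ Γ') (V : Set (OrbitSpace Ω Γ')) :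
    act A '' lift V = lift V := by
  have h : ∀ A ∈ Γ', ∀ x ∈ lift V, act A x ∈ lift V := by
    rintro A hA x ⟨hx, hxV⟩
    refine ⟨(act_mem_iff (hN.discrete.preserves A hA)).2 hx, ?_⟩
    have := orbitMk_act hN hA ⟨x, hx⟩
    change orbitMk Ω Γ' ⟨act A x, _⟩ ∈ V
    rw [this]
    exact hxV
  exact act_image_eq (h A hA) (h A⁻¹ (Γ'.inv_mem hA))

lemma act_image_connectedComponentIn {A : GL (Fin (n + 1)) ℝ} (hA : A ∈ Γ') {x : S n}
    (hx : x ∈ lift V) : act A '' connectedComponentIn (lift V) x =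
      connectedComponentIn (lift V) (act A x) := by
  have := (actHomeomorph A).image_connectedComponentIn hx
  change act A '' _ = connectedComponentIn (act A '' lift V) (act A x) at this
  rw [this, act_image_lift hN hA]

/-- A component of the preimage that meets its translate is preserved. -/
lemma act_image_component {D : Set (S n)} (hD : IsComponentOf D (lift V))
    {A : GL (Fin (n + 1)) ℝ} (hA : A ∈ Γ') {x : S n} (hx : x ∈ D) (hAx : act A x ∈ D) :
    act A '' D = D := by
  obtain ⟨x₀, hx₀, rfl⟩ := hD
  have h1 := connectedComponentIn_eq hx
  have h2 := connectedComponentIn_eq hAx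
  have hxV := connectedComponentIn_subset _ _ hx
  nth_rewrite 1 [h1]
  rw [act_image_connectedComponentIn hN hA hxV, ← h2]

omit hN in
lemma locallyConnectedSpace_sphere (m : ℕ) : LocallyConnectedSpace (S (m + 1)) := by
  have : Fact (Module.finrank ℝ (E (m + 1 + 1)) = m + 1 + 1) := ⟨finrank_euclideanSpace_fin⟩
  have : LocallyConnectedSpace (EuclideanSpace ℝ (Fin (m + 1))) := inferInstance
  exact ChartedSpace.locallyConnectedSpace (EuclideanSpace ℝ (Fin (m + 1))) _

/-- A component of the preimage of a connected open set projects onto it. -/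
lemma exists_mem_component [LocallyConnectedSpace (S n)] (hV : IsOpen V) (hVc : IsPreconnected V)
    {D : Set (S n)} (hD : IsComponentOf D (lift V)) {x : S n} (hx : x ∈ lift V) :
    ∃ A ∈ Γ', act A x ∈ D := by
  obtain ⟨x₀, hx₀, rfl⟩ := hD
  have hcomp : ∀ y ∈ lift V, IsOpen
      (orbitMk Ω Γ' '' (Subtype.val ⁻¹' connectedComponentIn (lift V) y)) :=
    fun y _ => isOpenMap_orbitMk hN _
      ((isOpen_lift hN hV).connectedComponentIn.preimage continuous_subtype_val)
  set P : S n → Prop := fun y => ∃ A ∈ Γ', act A y ∈ connectedComponentIn (lift V) x₀ with hP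
  have hPP : ∀ y ∈ lift V, ∀ z ∈ connectedComponentIn (lift V) y, P z → P y := by
    rintro y hy z hz ⟨A, hA, h⟩
    refine ⟨A, hA, ?_⟩
    have h1 : act A z ∈ connectedComponentIn (lift V) (act A y) := by
      rw [← act_image_connectedComponentIn hN hA hy]
      exact mem_image_of_mem _ hz
    rw [connectedComponentIn_eq h, ← connectedComponentIn_eq h1]
    exact mem_connectedComponentIn ((act_mem_iff (act_image_lift hN hA V)).2 hy)
  by_contra hnot
  have hnot' : ¬ P x := hnot
  -- If `P` failed at `x`, the image of the chosen component and the images of the components on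
  -- which `P` fails would be disjoint open sets that cover the connected set `V` and both meet it.
  let O₁ := orbitMk Ω Γ' '' (Subtype.val ⁻¹' connectedComponentIn (lift V) x₀)
  let O₂ := ⋃ y ∈ {y | y ∈ lift V ∧ ¬ P y},
    orbitMk Ω Γ' '' (Subtype.val ⁻¹' connectedComponentIn (lift V) y)
  have hO₁ : IsOpen O₁ := hcomp x₀ hx₀
  have hO₂ : IsOpen O₂ := isOpen_biUnion fun y hy => hcomp y hy.1
  have hcov : V ⊆ O₁ ∪ O₂ := by
    intro v hv
    obtain ⟨y, rfl⟩ := surjective_orbitMk v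
    by_cases h : P y
    · obtain ⟨A, hA, h⟩ := h
      exact Or.inl ⟨⟨act A y, lift_subset (connectedComponentIn_subset _ _ h)⟩, h,
        orbitMk_act hN hA y⟩
    · exact Or.inr (mem_iUnion₂.2 ⟨y, ⟨mem_lift_iff.2 hv, h⟩, y,
        mem_connectedComponentIn (mem_lift_iff.2 hv), rfl⟩)
  have hne₁ : (V ∩ O₁).Nonempty :=
    ⟨_, hx₀.2, ⟨x₀, hx₀.1⟩, mem_connectedComponentIn hx₀, rfl⟩
  have hne₂ : (V ∩ O₂).Nonempty :=
    ⟨_, hx.2, mem_iUnion₂.2 ⟨x, ⟨hx, hnot'⟩, ⟨x, hx.1⟩, mem_connectedComponentIn hx, rfl⟩⟩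
  obtain ⟨v, -, ⟨y, hy, rfl⟩, hv₂⟩ := hVc O₁ O₂ hO₁ hO₂ hcov hne₁ hne₂
  obtain ⟨z, ⟨hz, hzP⟩, w, hw, hwy⟩ := mem_iUnion₂.1 hv₂
  obtain ⟨A, hA, h⟩ := orbitMk_eq_iff.1 hwy
  exact hzP (hPP z hz w hw ⟨A, hA, by rw [h]; exact hy⟩)

end Lift

/-! ### An open cusp is the quotient of a cusp cover. -/

section OpenCusp

variable {m : ℕ} {Ω : Set (S (m + 1))} {Γ' : Subgroup (GL (Fin (m + 1 + 1)) ℝ)}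
  (hN : IsConvexManifold Ω Γ') {M : Set (OrbitSpace Ω Γ')}
  {Mt : TopologicalSpace.Opens (S (m + 1))} {Γ : Subgroup (GL (Fin (m + 1 + 1)) ℝ)}
  {p : S (m + 1)} (hM : IsOpenCusp M (Mt : Set (S (m + 1))) Γ p)
include hN hM

omit hN in
lemma IsOpenCusp.le : Γ ≤ Γ' := fun A hA => ((hM.holonomy A).1 hA).1

lemma IsOpenCusp.isDiscreteIn : IsDiscreteIn Γ Ω where
  det A hA := hN.discrete.det A (hM.le hA)
  preserves A hA := hN.discrete.preserves A (hM.le hA)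
  discrete := by
    have := hN.discrete.discrete
    exact DiscreteTopology.of_subset this hM.le

lemma IsOpenCusp.torsionFree : ∀ A ∈ Γ, IsOfFinOrder A → A = 1 := fun A hA =>
  hN.torsionFree A (hM.le hA)

/-- An element of `Γ'` that identifies two points of the component `Mt` preserves `Mt`, hence lies
in `Γ`. Surjectivity uses that `M` is connected. -/
lemma IsOpenCusp.isHolonomyQuotient : IsHolonomyQuotient Γ hM.proj := by
  have := locallyConnectedSpace_sphere m
  have hcont : Continuous hM.proj := by
    refine Continuous.subtype_mk (continuous_orbitMk.comp ?_) _
    exact Continuous.subtype_mk continuous_subtype_val _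
  have hval : ∀ x, (hM.proj x : OrbitSpace Ω Γ') =
    orbitMk Ω Γ' ⟨x, (hM.subset_lift x.2).1⟩ := fun _ => rfl
  have hopen : IsOpenMap hM.proj := by
    intro D hD
    have h1 : hM.proj '' D = Subtype.val ⁻¹' (orbitMk Ω Γ' ''
        (Subtype.val ⁻¹' (Subtype.val '' D : Set (S (m + 1))))) := by
      ext y
      constructor
      · rintro ⟨x, hx, rfl⟩
        exact ⟨⟨x, (hM.subset_lift x.2).1⟩, ⟨x, hx, rfl⟩, rfl⟩
      · rintro ⟨x, ⟨z, hz, hzx⟩, hxy⟩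
        refine ⟨z, hz, Subtype.ext ?_⟩
        rw [← hxy, hval]
        congr 1
        exact Subtype.ext hzx
    rw [h1]
    refine IsOpen.preimage continuous_subtype_val (isOpenMap_orbitMk hN _ ?_)
    exact (Mt.isOpen.isOpenMap_subtype_val _ hD).preimage continuous_subtype_val
  have hsurj : Function.Surjective hM.proj := by
    rintro ⟨y, hy⟩
    obtain ⟨x, rfl⟩ := surjective_orbitMk y
    obtain ⟨A, hA, h⟩ := exists_mem_component hN hM.isOpen hM.connected.isPreconnected
      hM.component (mem_lift_iff.2 hy)
    exact ⟨⟨act A x, h⟩, Subtype.ext (orbitMk_act hN hA x)⟩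
  refine ⟨hopen.isQuotientMap hcont hsurj, fun x y => ?_⟩
  rw [Subtype.ext_iff, hval, hval, orbitMk_eq_iff]
  constructor
  · rintro ⟨A, hA, h⟩
    refine ⟨A, (hM.holonomy A).2 ⟨hA, ?_⟩, h⟩
    simp only at h
    exact act_image_component hN hM.component hA x.2 (by rw [h]; exact y.2)
  · rintro ⟨A, hA, h⟩
    exact ⟨A, hM.le hA, h⟩

/-- An open cusp is the quotient of a cusp cover, in suitable coordinates. -/
theorem IsOpenCusp.isCuspCover {H : Submodule ℝ (E (m + 1 + 1))} (hΓ : Preserves Γ H p)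
    {e : E (m + 1 + 1) ≃L[ℝ] (E m × ℝ) × ℝ} (hep : e p = ((0, 1), 0))
    (heH : ∀ v, v ∈ H ↔ (e v).2 = 0) (hpos : ∀ v ∈ cone Ω, 0 < (e v).2) :
    IsCuspCover Ω Mt Γ p e := by
  obtain ⟨Ω', -, H', hcusp⟩ := hM.core
  have htf := hM.torsionFree hN
  have hd := hM.isDiscreteIn hN
  obtain ⟨x, hx⟩ := hN.properlyConvex.nonempty
  have hxc := coe_mem_cone_iff.2 hx
  let f : E (m + 1 + 1) →ₗ[ℝ] ℝ :=
    (LinearMap.snd ℝ (E m × ℝ) ℝ).comp (e : E (m + 1 + 1) →ₗ[ℝ] (E m × ℝ) × ℝ)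
  have hfx : 0 < f x := hpos _ hxc
  refine ⟨hN.properlyConvex, hd, htf, frontier_subset_closure hM.mem_frontier, Mt.isOpen,
    fun x hx => (hM.subset_lift hx).1, fun A hA => ((hM.holonomy A).1 hA).2, hM.starshaped.2, hep,
    hpos, fun A hA => hcusp.lin_eq htf hA (hΓ.point A hA), fun A hA v => ?_⟩
  have hfAx : 0 < f (lin A x) := hpos _ ((lin_mem_cone_iff (hd.preserves A hA)).2 hxc)
  -- `A` preserves `H = ker f`, so it rescales `f` by a positive factor that can be read off at `x`;
  -- the eigenvalue condition makes the factor one.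
  refine hcusp.functional_eq htf hA (f := f) (t := f (lin A x) / f x) ?_ (div_pos hfAx hfx) ?_ v
  · rintro h
    rw [h] at hfx
    simp at hfx
  · intro v
    have h1 : v - (f v / f x) • (x : E (m + 1 + 1)) ∈ H := by
      rw [heH]
      change f _ = 0
      rw [map_sub, map_smul, smul_eq_mul, div_mul_cancel₀ _ hfx.ne', sub_self]
    have h2 : lin A (v - (f v / f x) • (x : E (m + 1 + 1))) ∈ H := by
      rw [← hΓ.hyperplane A hA]
      exact Submodule.mem_map_of_mem h1
    rw [heH] at h2
    change f _ = 0 at h2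
    rw [map_sub, map_smul, map_sub, map_smul, smul_eq_mul, sub_eq_zero] at h2
    rw [h2]
    field_simp

end OpenCusp

end ConvexCusp

/-! ### The projection to the cross-section and its fibres. -/

namespace ConvexCusp

namespace IsCuspCover

variable {m : ℕ} {Ω : Set (S (m + 1))} {U : TopologicalSpace.Opens (S (m + 1))}
    {Γ : Subgroup (GL (Fin (m + 1 + 1)) ℝ)}
    {p : S (m + 1)} {e : E (m + 1 + 1) ≃L[ℝ] (E m × ℝ) × ℝ} (hU : IsCuspCover Ω U Γ p e)
    {Y : Type*} [TopologicalSpace Y] {π : U → Y} (hπ : IsHolonomyQuotient Γ π)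

/-- The projection of the cusp to its cross-section. -/
noncomputable def cuspProj (y : Y) : hU.isDomain.Cross :=
  hU.toCross (Function.surjInv hπ.isQuotientMap.surjective y)

lemma cuspProj_apply (x : U) : hU.cuspProj hπ (π x) = hU.toCross x := by
  obtain ⟨A, hA, h⟩ := (hπ.eq_iff _ _).1 (Function.surjInv_eq hπ.isQuotientMap.surjective (π x))
  exact hU.toCross_act hA h

/-- In charts this is the linear projection to the base followed by an affine deck map. -/
lemma isAffine_cuspProj :
    letI := hU.chartedSpace hπ
    IsAffine (k := m + 1) (l := m) (hU.cuspProj hπ) := by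
  let _ := hU.chartedSpace hπ
  rintro _ ⟨w₀, rfl⟩ _ ⟨z₀, rfl⟩ y hy hyd
  set c := quotientChart (hU.isLocalHomeomorph_affineQuotient hπ) w₀ with hc
  set d := quotientChart hU.isDomain.isLocalHomeomorph_proj z₀ with hd
  have hbase : ∀ w : affineDomain e U, (splitLast m w).1 ∈ base e U hU.isOpen :=
    fun w => ⟨_, w.2, rfl⟩
  have hcs : ∀ z ∈ c.target, ∃ h : (splitLast m z).1 ∈ base e U hU.isOpen,
      hU.cuspProj hπ (c.symm z) = hU.isDomain.proj ⟨(splitLast m z).1, h⟩ := by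
    intro z hz
    obtain ⟨h, hq⟩ := quotientChart_symm _ w₀ hz
    refine ⟨hbase ⟨z, h⟩, ?_⟩
    rw [hq]
    refine (hU.cuspProj_apply hπ _).trans (congrArg hU.isDomain.proj (Subtype.ext ?_))
    exact congrArg Prod.fst (hU.affineCoord_affineDiffeomorph ⟨z, h⟩)
  obtain ⟨hb, hby⟩ := hcs (c y) (c.map_source hy)
  rw [c.left_inv hy] at hby
  obtain ⟨A, -, hA⟩ := quotientChart_spec hU.isDomain.isLocalHomeomorph_proj
    hU.isDomain.hasAffineDeck_proj z₀ ⟨_, hb⟩ (by rw [← hby]; exact hyd)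
  refine ⟨A.comp ((LinearMap.fst ℝ (E m) ℝ).comp
    (splitLast m : E (m + 1) →ₗ[ℝ] E m × ℝ)).toAffineMap, ?_⟩
  have hcont : Continuous fun z => (splitLast m z).1 := by fun_prop
  filter_upwards [c.open_target.mem_nhds (c.map_source hy),
    hcont.continuousAt.eventually (eventually_of_subtype hb hA)] with z hz h
  obtain ⟨h1, h2⟩ := hcs z hz
  obtain ⟨h3, -, -, h4⟩ := h
  rw [h2]
  exact h4

include hU in
lemma mem_line_iff {x y : U} : (y : S (m + 1)) ∈ line p (x : S (m + 1)) ↔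
    (affineCoord e (x : S (m + 1))).1 = (affineCoord e (y : S (m + 1))).1 := by
  have hx := hU.snd_pos x
  have hy := hU.snd_pos y
  rw [line, mem_ofPred_eq, Submodule.mem_span_pair]
  constructor
  · rintro ⟨a, b, h⟩
    have h1 := congrArg e h
    rw [map_add, map_smul, map_smul, hU.point] at h1
    have h2 := congrArg Prod.snd h1
    have h3 := congrArg (fun v => v.1.1) h1
    simp only [Prod.snd_add, Prod.smul_snd, Prod.fst_add, Prod.smul_fst, smul_eq_mul, mul_zero,
      add_zero, smul_zero] at h2 h3
    simp only [affineCoord, Prod.smul_fst, ← h2, ← h3, smul_smul]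
    -- The last coordinate vanishes at `p` but is positive at `y`.
    have ha : a ≠ 0 := by
      rintro rfl
      rw [zero_mul] at h2
      exact hy.ne h2
    congr 1
    field_simp
  · intro h
    simp only [affineCoord, Prod.smul_fst] at h
    set fx := (e ((x : S (m + 1)) : E (m + 1 + 1))).2
    set fy := (e ((y : S (m + 1)) : E (m + 1 + 1))).2 with hfy
    refine ⟨fy / fx, (e ((y : S (m + 1)) : E (m + 1 + 1))).1.2 -
      fy / fx * (e ((x : S (m + 1)) : E (m + 1 + 1))).1.2, e.injective ?_⟩
    rw [map_add, map_smul, map_smul, hU.point]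
    refine Prod.ext (Prod.ext ?_ ?_) ?_
    · simp only [Prod.fst_add, Prod.smul_fst, smul_zero, add_zero]
      rw [div_eq_mul_inv, ← smul_smul, h, smul_smul, mul_inv_cancel₀ hy.ne', one_smul]
    · simp
    · change fy / fx * fx + _ * 0 = fy
      rw [div_mul_cancel₀ _ hx.ne', mul_zero, add_zero]

lemma preimage_cuspProj (x : U) : hU.cuspProj hπ ⁻¹' {hU.cuspProj hπ (π x)} =
    π '' {y : U | (y : S (m + 1)) ∈ line p (x : S (m + 1))} := by
  ext w
  obtain ⟨y, rfl⟩ := hπ.isQuotientMap.surjective w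
  rw [mem_preimage, mem_singleton_iff, hU.cuspProj_apply, hU.cuspProj_apply]
  constructor
  · intro h
    obtain ⟨A, hA⟩ := hU.isDomain.proj_eq_iff.1 h
    let z : U := ⟨act A y, (act_mem_iff (hU.preserves A A.2)).2 y.2⟩
    refine ⟨z, hU.mem_line_iff.2 ?_, ((hπ.eq_iff _ _).2 ⟨A, A.2, rfl⟩).symm⟩
    exact hA.symm.trans (congrArg Prod.fst (hU.affineCoord_act A y)).symm
  · rintro ⟨z, hz, hzy⟩
    obtain ⟨A, hA, h⟩ := (hπ.eq_iff _ _).1 hzy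
    rw [← hU.toCross_act hA h]
    exact congrArg hU.isDomain.proj (Subtype.ext (hU.mem_line_iff.1 hz).symm)

end IsCuspCover

end ConvexCusp

/-! ### Obstacles for sections: the convex core and a smaller cusp. -/

namespace ConvexCusp

lemma mem_closure_of_mem_closure_lift {n : ℕ} {Ω : Set (S n)} {Γ' : Subgroup (GL (Fin (n + 1)) ℝ)}
    (hN : IsConvexManifold Ω Γ') {V : Set (OrbitSpace Ω Γ')} {x : Ω}
    (hx : (x : S n) ∈ closure (lift V)) : orbitMk Ω Γ' x ∈ closure V := by
  rw [mem_closure_iff] at hx ⊢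
  intro O hO hxO
  obtain ⟨y, hyO, hyV⟩ := hx _ (isOpen_lift hN hO) (mem_lift_iff.2 hxO)
  exact ⟨_, hyO.2, hyV.2⟩

/-- A point of the upward closed set `D` at height at most `r` over `z'` would put `(z', r)` in `D`,
impossible for `z'` near `z`. -/
lemma eventually_lt_of_notMem_closure {X : Type*} [TopologicalSpace X] {D : Set (X × ℝ)}
    (hD : ∀ z t s, 0 ≤ s → (z, t) ∈ D → (z, t + s) ∈ D) {z : X} {r : ℝ} (h : (z, r) ∉ closure D) :
    ∀ᶠ z' in 𝓝 z, ∀ t, (z', t) ∈ D → r < t := by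
  have h1 : ∀ᶠ x in 𝓝 (z, r), x ∉ D :=
    Eventually.mono (isClosed_closure.isOpen_compl.mem_nhds h) fun x hx hD => hx (subset_closure hD)
  have h2 : ContinuousAt (fun z' : X => (z', r)) z := by fun_prop
  filter_upwards [h2.eventually h1] with z' h3 t ht
  by_contra! hle
  refine h3 ?_
  have := hD z' t (r - t) (by linarith) ht
  rwa [add_sub_cancel] at this

namespace IsCuspCover

variable {m : ℕ} {Ω : Set (S (m + 1))} {U : TopologicalSpace.Opens (S (m + 1))}
    {Γ : Subgroup (GL (Fin (m + 1 + 1)) ℝ)}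
    {p : S (m + 1)} {e : E (m + 1 + 1) ≃L[ℝ] (E m × ℝ) × ℝ} (hU : IsCuspCover Ω U Γ p e)
include hU

/-- There is an invariant section below every invariant set of rays that stays away from the
lower boundary. -/
lemma exists_section_lt {W : Set (S (m + 1))} (hW : ∀ A ∈ Γ, act A '' W = W)
    (hloc : ∀ z ∈ base e U hU.isOpen, ∃ r, lowerBoundary e U z < r ∧
      ∀ᶠ z' in 𝓝 z, ∀ t, (z', t) ∈ patch e W → r < t) :
    ∃ s, hU.cuspAction.IsSection (base e U hU.isOpen) s ∧ ∀ z ∈ base e U hU.isOpen,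
      lowerBoundary e U z < s z ∧ ∀ t, (z, t) ∈ patch e W → s z < t := by
  refine hU.isDomain.exists_section_lt (fun z => {t | (z, t) ∈ patch e W}) ?_ hloc
  intro A z _ t ht
  refine (hU.mem_patch_act_iff A (hW A A.2)).1 ?_
  rw [sub_add_cancel]
  exact ht

omit hU in
lemma patch_union (W W' : Set (S (m + 1))) : patch e (W ∪ W') = patch e W ∪ patch e W' := by
  ext x
  simp only [patch, cone, mem_union, mem_ofPred_eq]
  tauto

/-- There is an invariant section below two invariant sets of rays. -/
lemma exists_section_lt_union {W W' : Set (S (m + 1))} (hW : ∀ A ∈ Γ, act A '' W = W)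
    (hW' : ∀ A ∈ Γ, act A '' W' = W')
    (hloc : ∀ z ∈ base e U hU.isOpen, ∃ r, lowerBoundary e U z < r ∧
      ∀ᶠ z' in 𝓝 z, ∀ t, (z', t) ∈ patch e W → r < t)
    (hloc' : ∀ z ∈ base e U hU.isOpen, ∃ r, lowerBoundary e U z < r ∧
      ∀ᶠ z' in 𝓝 z, ∀ t, (z', t) ∈ patch e W' → r < t) :
    ∃ s, hU.cuspAction.IsSection (base e U hU.isOpen) s ∧ ∀ z ∈ base e U hU.isOpen,
      lowerBoundary e U z < s z ∧ (∀ t, (z, t) ∈ patch e W → s z < t) ∧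
        ∀ t, (z, t) ∈ patch e W' → s z < t := by
  obtain ⟨s, hs, h⟩ := hU.exists_section_lt (W := W ∪ W')
    (fun A hA => by rw [image_union, hW A hA, hW' A hA]) (by
      intro z hz
      obtain ⟨r, hr, h⟩ := hloc z hz
      obtain ⟨r', hr', h'⟩ := hloc' z hz
      refine ⟨min r r', lt_min hr hr', ?_⟩
      filter_upwards [h, h'] with z' h1 h2 t ht
      rw [patch_union] at ht
      rcases ht with ht | ht
      · exact (min_le_left _ _).trans_lt (h1 t ht)
      · exact (min_le_right _ _).trans_lt (h2 t ht))
  rw [patch_union] at h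
  exact ⟨s, hs, fun z hz => ⟨(h z hz).1, fun t ht => (h z hz).2 t (Or.inl ht),
    fun t ht => (h z hz).2 t (Or.inr ht)⟩⟩

end IsCuspCover

section OpenCusp

variable {m : ℕ} {Ω : Set (S (m + 1))} {Γ' : Subgroup (GL (Fin (m + 1 + 1)) ℝ)}
  (hN : IsConvexManifold Ω Γ') {M : Set (OrbitSpace Ω Γ')}
  {Mt : TopologicalSpace.Opens (S (m + 1))} {Γ : Subgroup (GL (Fin (m + 1 + 1)) ℝ)}
  {p : S (m + 1)} (hM : IsOpenCusp M (Mt : Set (S (m + 1))) Γ p)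
  {H : Submodule ℝ (E (m + 1 + 1))} (hH : IsSupportingHyperplane Ω H p)
  {e : E (m + 1 + 1) ≃L[ℝ] (E m × ℝ) × ℝ} (hU : IsCuspCover Ω Mt Γ p e)

include hN hM hU

include hH in
/-- An open cusp has a convex core that stays away from its lower boundary. -/
lemma IsOpenCusp.exists_core (hΓ : Preserves Γ H p) (heH : ∀ v, v ∈ H ↔ (e v).2 = 0) :
    ∃ V ⊆ (Mt : Set (S (m + 1))), IsCuspGroup Γ V H p ∧ ∀ z ∈ base e Mt hU.isOpen,
      ∃ r, lowerBoundary e Mt z < r ∧ ∀ᶠ z' in 𝓝 z, ∀ t, (z', t) ∈ patch e V → r < t := by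
  obtain ⟨W, hWM, H', hcusp⟩ := hM.core
  have htf := hM.torsionFree hN
  let f : E (m + 1 + 1) →ₗ[ℝ] ℝ :=
    (LinearMap.snd ℝ (E m × ℝ) ℝ).comp (e : E (m + 1 + 1) →ₗ[ℝ] (E m × ℝ) × ℝ)
  have hfW : ∀ v ∈ cone W, 0 < f v := fun v hv => hU.pos v ⟨hv.1, hU.subset (hWM hv.2)⟩
  have hfp : f p = 0 := by
    change (e p).2 = 0
    rw [hU.point]
  obtain ⟨V, hVW, hVc, hVΓ, hpV, hcl⟩ := ConvexCusp.exists_core hcusp.properlyConvex hcusp.discrete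
    (frontier_subset_closure hcusp.mem_frontier) hfW hU.snd_lin hU.fix hfp
  have hVcusp : IsCuspGroup Γ V H p := by
    refine isCuspGroup_of_functional (f := f) hVc
      ⟨hcusp.discrete.det, hVΓ, hcusp.discrete.discrete⟩ hcusp.infinite ?_ hpV
      ⟨hH.finrank, hH.mem, fun x hx => hH.disjoint x (hU.subset (hWM (hVW hx)))⟩ hΓ
      (fun v hv => (heH v).1 hv) (fun v hv => hfW v ⟨hv.1, hVW hv.2⟩) hU.snd_lin hU.fix
    rintro A hA ⟨-, μ, hμ, hne⟩
    exact hne (hcusp.norm_eigenvalue htf hA hμ)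
  refine ⟨V, hVW.trans hWM, hVcusp, fun z hz => ?_⟩
  have hup : ∀ z t s, 0 ≤ s → (z, t) ∈ patch e V → (z, t + s) ∈ patch e V := by
    intro z t s hs h
    rw [patch, mem_ofPred_eq, hU.symm_add]
    exact add_smul_mem_cone hVc.isOpen hVc.convex hpV h hs
  -- In the affine patch, the closure of the shrunken core lies in the old core and hence in `Mt`,
  -- while no point of the lower boundary lies in the open region `Mt`. A height slightly above the
  -- boundary is then also outside the closure.
  have hnot : (z, lowerBoundary e Mt z) ∉ closure (patch e V) := by
    intro h
    have h1 : Continuous fun x : E m × ℝ => e.symm (x, 1) := e.symm.continuous.comp (by fun_prop)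
    have h2 : e.symm ((z, lowerBoundary e Mt z), 1) ∈ closure (cone V) :=
      map_mem_closure (f := fun x : E m × ℝ => e.symm (x, 1)) h1 h fun x hx => hx
    have h3 := hcl _ h2 (by
      change 0 < (e (e.symm _)).2
      rw [e.apply_symm_apply]
      exact one_pos)
    have h4 : (z, lowerBoundary e Mt z) ∈ patch e Mt := ⟨h3.1, hWM h3.2⟩
    exact lt_irrefl _ (hU.mem_patch_iff.1 h4).2
  have h1 : ∀ᶠ r in 𝓝 (lowerBoundary e Mt z), (z, r) ∉ closure (patch e V) :=
    (Continuous.prodMk_right z).continuousAt.preimage_mem_nhds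
      (isClosed_closure.isOpen_compl.mem_nhds hnot)
  obtain ⟨r, h2, h3⟩ := ((h1.filter_mono nhdsWithin_le_nhds).and
    (self_mem_nhdsWithin (s := Ioi (lowerBoundary e Mt z)))).exists
  exact ⟨r, h3, eventually_lt_of_notMem_closure hup h2⟩

variable {V : Set (OrbitSpace Ω Γ')} {Vt : Set (S (m + 1))}
  {ΓV : Subgroup (GL (Fin (m + 1 + 1)) ℝ)} (hV : IsOpenCusp V Vt ΓV p) (hVM : Vt ⊆ Mt)
include hV hVM

/-- The preimage in `Mt` of a cusp `V` in `M` with the same fixed point is starshaped. -/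
lemma IsOpenCusp.add_mem_lift {v : E (m + 1 + 1)} (hv : v ∈ cone (lift V ∩ Mt)) {s : ℝ}
    (hs : 0 ≤ s) : v + s • (p : E (m + 1 + 1)) ∈ cone (lift V ∩ Mt) := by
  have := locallyConnectedSpace_sphere m
  -- Move the point into `Vt` by some `A` in `Γ'`. As `Vt ⊆ Mt`, this `A` preserves `Mt`, so it lies
  -- in `Γ` and fixes `p`; starshapedness of `Vt` is then pulled back by `A`.
  obtain ⟨A, hA, h⟩ := exists_mem_component hN hV.isOpen hV.connected.isPreconnected
    hV.component hv.2.1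
  have hAM : act A '' Mt = Mt :=
    act_image_component hN hM.component hA hv.2.2 (hVM h)
  have hAΓ : A ∈ Γ := (hM.holonomy A).2 ⟨hA, hAM⟩
  have h1 : v + s • (p : E (m + 1 + 1)) ∈ cone (Mt : Set (S (m + 1))) :=
    hM.starshaped.2 v ⟨hv.1, hv.2.2⟩ s hs
  refine ⟨h1.1, ?_, h1.2⟩
  have h2 : lin A v ∈ cone Vt := ⟨lin_ne_zero hv.1, by rwa [← act_toSphere hv.1]⟩
  have h3 := hV.starshaped.2 _ h2 s hs
  rw [← hU.fix A hAΓ, ← map_smul, ← map_add] at h3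
  have h4 := hV.subset_lift h3.2
  rwa [← act_toSphere h1.1, act_mem_iff (act_image_lift hN hA V)] at h4

/-- The hypothesis gives a point of `Mt` over `z` whose image is outside `closure V`. Its height
serves as `r`, because the preimage of `V` in `Mt` is upward closed. -/
lemma IsOpenCusp.exists_lt_of_cuspProj (hπ : IsHolonomyQuotient Γ hM.proj)
    (hVX : hU.cuspProj hπ '' {x : M | (x : OrbitSpace Ω Γ') ∉ closure V} = univ) :
    ∀ z ∈ base e Mt hU.isOpen, ∃ r, lowerBoundary e Mt z < r ∧
      ∀ᶠ z' in 𝓝 z, ∀ t, (z', t) ∈ patch e (lift V ∩ Mt) → r < t := by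
  intro z hz
  obtain ⟨y, hy, hyz⟩ := (eq_univ_iff_forall.1 hVX) (hU.isDomain.proj ⟨z, hz⟩)
  obtain ⟨x, rfl⟩ := hπ.isQuotientMap.surjective y
  rw [hU.cuspProj_apply] at hyz
  obtain ⟨A, hA⟩ := hU.isDomain.proj_eq_iff.1 hyz
  let x' : Mt := ⟨act A x, (act_mem_iff (hU.preserves A A.2)).2 x.2⟩
  have hx' : hM.proj x = hM.proj x' := (hπ.eq_iff _ _).2 ⟨A, A.2, rfl⟩
  have hxz : (affineCoord e (x' : S (m + 1))).1 = z := by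
    exact (congrArg Prod.fst (hU.affineCoord_act A x)).trans hA
  rw [hx', mem_ofPred_eq] at hy
  refine ⟨(affineCoord e (x' : S (m + 1))).2, ?_, ?_⟩
  · rw [← hxz]
    exact hU.lowerBoundary_lt x'
  · refine eventually_lt_of_notMem_closure ?_ ?_
    · intro z t s hs h
      rw [patch, mem_ofPred_eq, hU.symm_add]
      exact hM.add_mem_lift hN hU hV hVM h hs
    · intro h
      refine hy (mem_closure_of_mem_closure_lift hN (x := ⟨x', _⟩) ?_)
      rw [← hxz, Prod.mk.eta] at h
      have h1 : Continuous fun x : E m × ℝ => e.symm (x, 1) := e.symm.continuous.comp (by fun_prop)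
      have h2 : e.symm (affineCoord e (x' : S (m + 1)), 1) ∈ closure (cone (lift V)) :=
        map_mem_closure (f := fun x : E m × ℝ => e.symm (x, 1)) h1 h fun x hx => ⟨hx.1, hx.2.1⟩
      rw [symm_affineCoord (hU.snd_pos x').ne'] at h2
      have h3 := smul_mem_closure_cone h2 (hU.snd_pos x')
      rw [smul_inv_smul₀ (hU.snd_pos x').ne', coe_mem_closure_cone_iff] at h3
      exact h3

end OpenCusp

end ConvexCusp

/-! ### Sublevel sets, their components, and the height above a section. -/

namespace ConvexCusp

section Sublevel

variable {N : Type*} [TopologicalSpace N] {M : Set N} (hM : IsOpen M) {k : M → ℝ}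
  (hk : Continuous k) (hko : IsOpenMap k)
include hM hk hko

/-- For a continuous open map, preimages commute with interiors, so no point of the zero level is
interior. -/
lemma interior_sublevel :
    interior (Subtype.val '' {y : M | k y ≤ 0}) = Subtype.val '' {y : M | k y < 0} := by
  apply Subset.antisymm
  · intro x hx
    obtain ⟨y, -, rfl⟩ := interior_subset hx
    refine ⟨y, ?_, rfl⟩
    have h1 : Subtype.val ⁻¹' interior (Subtype.val '' {y : M | k y ≤ 0}) ⊆ k ⁻¹' Iic 0 := by
      intro z hz
      obtain ⟨w, hw, hwz⟩ := interior_subset (mem_preimage.1 hz)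
      rwa [Subtype.val_injective hwz] at hw
    have h2 : y ∈ interior (k ⁻¹' Iic 0) :=
      interior_maximal h1 (isOpen_interior.preimage continuous_subtype_val) hx
    rw [← hko.preimage_interior_eq_interior_preimage hk, interior_Iic] at h2
    exact h2
  · refine interior_maximal (image_mono fun y (hy : k y < 0) => hy.le) ?_
    exact hM.isOpenMap_subtype_val _ (isOpen_Iio.preimage hk)

lemma bdry_sublevel :
    bdry (Subtype.val '' {y : M | k y ≤ 0}) = Subtype.val '' {y : M | k y = 0} := by
  rw [bdry, closure_compl, interior_sublevel hM hk hko]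
  ext x
  constructor
  · rintro ⟨⟨y, hy, rfl⟩, h⟩
    refine ⟨y, le_antisymm hy ?_, rfl⟩
    by_contra! hlt
    exact h ⟨y, hlt, rfl⟩
  · rintro ⟨y, hy, rfl⟩
    refine ⟨⟨y, le_of_eq hy, rfl⟩, ?_⟩
    rintro ⟨z, hz, hzy⟩
    rw [Subtype.val_injective hzy] at hz
    exact (lt_irrefl _ (hz.trans_eq (Eq.symm hy)))

end Sublevel

lemma interior_lift {n : ℕ} {Ω : Set (S n)} {Γ' : Subgroup (GL (Fin (n + 1)) ℝ)}
    (hN : IsConvexManifold Ω Γ') (P : Set (OrbitSpace Ω Γ')) :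
    interior (lift P) = lift (interior P) := by
  apply Subset.antisymm
  · intro x hx
    have hxΩ := lift_subset (interior_subset hx)
    refine ⟨hxΩ, ?_⟩
    refine interior_maximal ?_ (isOpenMap_orbitMk hN _
      (isOpen_interior.preimage continuous_subtype_val)) (t := orbitMk Ω Γ' ''
        (Subtype.val ⁻¹' interior (lift P))) ⟨⟨x, hxΩ⟩, hx, rfl⟩
    rintro _ ⟨y, hy, rfl⟩
    exact mem_lift_iff.1 (interior_subset hy)
  · exact interior_maximal (lift_mono interior_subset) (isOpen_lift hN isOpen_interior)

section OpenCusp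

variable {m : ℕ} {Ω : Set (S (m + 1))} {Γ' : Subgroup (GL (Fin (m + 1 + 1)) ℝ)}
  (hN : IsConvexManifold Ω Γ') {M : Set (OrbitSpace Ω Γ')}
  {Mt : TopologicalSpace.Opens (S (m + 1))} {Γ : Subgroup (GL (Fin (m + 1 + 1)) ℝ)}
  {p : S (m + 1)} (hM : IsOpenCusp M (Mt : Set (S (m + 1))) Γ p)
  {H : Submodule ℝ (E (m + 1 + 1))}
  {e : E (m + 1 + 1) ≃L[ℝ] (E m × ℝ) × ℝ} (hU : IsCuspCover Ω Mt Γ p e)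

include hM in
lemma IsOpenCusp.mem_lift_image {B : Set M} (x : Mt) :
    (x : S (m + 1)) ∈ lift (Subtype.val '' B) ↔ hM.proj x ∈ B := by
  constructor
  · rintro ⟨_, y, hy, hyx⟩
    rwa [show hM.proj x = y from Subtype.ext hyx.symm]
  · intro h
    exact ⟨(hM.subset_lift x.2).1, _, h, rfl⟩

include hM in
-- The component of `lift Q` at a point of `Mt` cannot leave `Mt`, which is a component of the
-- larger set `lift M`.
lemma IsOpenCusp.isComponentOf_inter {Q : Set (OrbitSpace Ω Γ')} (hQ : Q ⊆ M)
    (hne : ((Mt : Set (S (m + 1))) ∩ lift Q).Nonempty)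
    (hpre : IsPreconnected ((Mt : Set (S (m + 1))) ∩ lift Q)) :
    IsComponentOf ((Mt : Set (S (m + 1))) ∩ lift Q) (lift Q) := by
  obtain ⟨x, hxM, hxQ⟩ := hne
  refine ⟨x, hxQ, Subset.antisymm
    (hpre.subset_connectedComponentIn ⟨hxM, hxQ⟩ inter_subset_right) fun y hy => ?_⟩
  refine ⟨?_, connectedComponentIn_subset _ _ hy⟩
  obtain ⟨x₀, hx₀, h⟩ := hM.component
  rw [h] at hxM ⊢
  rw [connectedComponentIn_eq hxM]
  exact connectedComponentIn_mono x (lift_mono hQ) hy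

/-- The height of a ray above a section. -/
noncomputable def heightAbove (e : E (m + 1 + 1) ≃L[ℝ] (E m × ℝ) × ℝ) (s₀ : E m → ℝ)
    (v : E (m + 1 + 1)) : ℝ := (affineCoord e v).2 - s₀ (affineCoord e v).1

variable {s₀ : E m → ℝ} (hs : hU.cuspAction.IsSection (base e Mt hU.isOpen) s₀)
  (hτ : ∀ z ∈ base e Mt hU.isOpen, lowerBoundary e Mt z < s₀ z)

include hM in
lemma IsOpenCusp.isPreconnected_base : IsPreconnected (base e Mt hU.isOpen : Set (E m)) := by
  have h1 : IsPreconnected (Mt : Set (S (m + 1))) := by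
    obtain ⟨x₀, hx₀, h⟩ := hM.component
    rw [h]
    exact isPreconnected_connectedComponentIn
  have h2 : (base e Mt hU.isOpen : Set (E m)) =
      (fun x : S (m + 1) => (affineCoord e x).1) '' Mt := by
    ext z
    constructor
    · rintro ⟨⟨z, t⟩, h, rfl⟩
      refine ⟨_, h.2, ?_⟩
      simp only
      rw [affineCoord_toSphere _ h.1, affineCoord_symm]
    · rintro ⟨x, hx, rfl⟩
      exact (hU.toBase ⟨x, hx⟩).2
  rw [h2]
  refine h1.image _ fun x hx => ContinuousAt.continuousWithinAt ?_
  have h3 := (contDiffAt_affineCoord (hU.snd_pos ⟨x, hx⟩).ne').continuousAt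
  exact continuousAt_fst.comp (ContinuousAt.comp (g := affineCoord e)
    (f := fun x : S (m + 1) => (x : E (m + 1 + 1))) h3 continuous_subtype_val.continuousAt)

include hM hs hτ in
-- The region is the continuous image of the connected base times `J` under `(z, u) ↦ (z, s₀ z +
-- u)`.
lemma IsOpenCusp.isPreconnected_above {J : Set ℝ} (hJ : IsPreconnected J) (hJ0 : J ⊆ Ici 0) :
    IsPreconnected {x : S (m + 1) | x ∈ Mt ∧ heightAbove e s₀ x ∈ J} := by
  let G : E m × ℝ → S (m + 1) := fun x => toSphere (e.symm ((x.1, s₀ x.1 + x.2), 1))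
  have hmem : ∀ z ∈ base e Mt hU.isOpen, ∀ u ∈ J, (z, s₀ z + u) ∈ patch e Mt := fun z hz u hu =>
    hU.mem_patch_iff.2 ⟨hz, by linarith [hτ z hz, show 0 ≤ u from hJ0 hu]⟩
  have h1 : {x : S (m + 1) | x ∈ Mt ∧ heightAbove e s₀ x ∈ J} =
      G '' ((base e Mt hU.isOpen : Set (E m)) ×ˢ J) := by
    ext x
    constructor
    · rintro ⟨hx, hxJ⟩
      refine ⟨(_, _), ⟨(hU.toBase ⟨x, hx⟩).2, hxJ⟩, ?_⟩
      have h2 : (((affineCoord e (x : E (m + 1 + 1))).1, s₀ (affineCoord e x).1 +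
          heightAbove e s₀ x) : E m × ℝ) = affineCoord e x := by
        rw [heightAbove, add_sub_cancel]
      change toSphere (e.symm (((affineCoord e (x : E (m + 1 + 1))).1, s₀ (affineCoord e x).1 +
          heightAbove e s₀ x), 1)) = x
      rw [h2, symm_affineCoord (hU.snd_pos ⟨x, hx⟩).ne', toSphere_smul
        (inv_pos.2 (hU.snd_pos ⟨x, hx⟩)), toSphere_coe]
    · rintro ⟨⟨z, u⟩, ⟨hz, hu⟩, rfl⟩
      have h2 := hmem z hz u hu
      refine ⟨h2.2, ?_⟩
      simp only [G, heightAbove]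
      rw [affineCoord_toSphere _ h2.1, affineCoord_symm, add_sub_cancel_left]
      exact hu
  rw [h1]
  refine ((hM.isPreconnected_base hU).prod hJ).image _ ?_
  rintro ⟨z, u⟩ ⟨hz, hu⟩
  refine ContinuousAt.continuousWithinAt ?_
  have h2 : ContinuousAt (fun x : E m × ℝ => s₀ x.1) (z, u) :=
    (hs.continuousAt hz).comp continuousAt_fst
  have h3 : ContinuousAt (fun x : E m × ℝ => e.symm ((x.1, s₀ x.1 + x.2), 1)) (z, u) :=
    e.symm.continuous.continuousAt.comp
      ((continuousAt_fst.prodMk (h2.add continuousAt_snd)).prodMk continuousAt_const)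
  exact ContinuousAt.comp (g := toSphere)
    (f := fun x : E m × ℝ => e.symm ((x.1, s₀ x.1 + x.2), 1))
    (continuousAt_toSphere (hmem z hz u hu).1) h3

include hU in
lemma IsCuspCover.affineCoord_add_smul {v : E (m + 1 + 1)} (s : ℝ) (hv : (e v).2 ≠ 0) :
    affineCoord e (v + s • (p : E (m + 1 + 1))) =
      ((affineCoord e v).1, (affineCoord e v).2 + s / (e v).2) := by
  simp only [affineCoord, map_add, map_smul, hU.point]
  ext
  · simp
  · simp
    field_simp

lemma heightAbove_toSphere {v : E (m + 1 + 1)} (hv : v ≠ 0) :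
    heightAbove e s₀ (toSphere v : E (m + 1 + 1)) = heightAbove e s₀ v := by
  rw [heightAbove, affineCoord_toSphere _ hv, heightAbove]

include hU in
lemma IsCuspCover.heightAbove_add_smul {v : E (m + 1 + 1)} (s : ℝ) (hv : (e v).2 ≠ 0) :
    heightAbove e s₀ (v + s • (p : E (m + 1 + 1))) = heightAbove e s₀ v + s / (e v).2 := by
  rw [heightAbove, hU.affineCoord_add_smul s hv, heightAbove]
  ring

include hU hs in
lemma IsCuspCover.contDiffAt_heightAbove {x : S (m + 1)} (hx : x ∈ Mt) :
    ContDiffAt ℝ ∞ (heightAbove e s₀) (x : E (m + 1 + 1)) := by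
  have h1 := contDiffAt_affineCoord (e := e) (hU.snd_pos ⟨x, hx⟩).ne'
  have h2 : ContDiffAt ℝ ∞ s₀ (affineCoord e (x : E (m + 1 + 1))).1 :=
    hs.contDiffAt (hU.toBase ⟨x, hx⟩).2
  exact (contDiffAt_snd.comp _ h1).sub
    (ContDiffAt.comp (g := s₀) _ h2 (contDiffAt_fst.comp _ h1))

include hU hs in
-- Along `x + s • p` the height is affine in `s` with this slope.
lemma IsCuspCover.fderiv_heightAbove {x : S (m + 1)} (hx : x ∈ Mt) :
    fderiv ℝ (heightAbove e s₀) (x : E (m + 1 + 1)) (p : E (m + 1 + 1)) =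
      ((e (x : E (m + 1 + 1))).2)⁻¹ := by
  have h1 := (hU.contDiffAt_heightAbove hs hx).differentiableAt (by simp)
  rw [← h1.lineDeriv_eq_fderiv, lineDeriv]
  have h2 : (fun s : ℝ => heightAbove e s₀ ((x : E (m + 1 + 1)) + s • (p : E (m + 1 + 1)))) =
      fun s => heightAbove e s₀ x + s / (e (x : E (m + 1 + 1))).2 :=
    funext fun s => hU.heightAbove_add_smul s (hU.snd_pos ⟨x, hx⟩).ne'
  rw [h2]
  simp

include hU in
/-- On a line through `p`, the height tends to infinity towards `p`. -/
lemma IsCuspCover.tendsto_affineCoord_snd :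
    Tendsto (fun y : Mt => (affineCoord e (y : S (m + 1))).2)
      (comap (fun y : Mt => (y : S (m + 1))) (𝓝 p)) atTop := by
  have h1 : Tendsto (fun y : Mt => e ((y : S (m + 1)) : E (m + 1 + 1)))
      (comap (fun y : Mt => (y : S (m + 1))) (𝓝 p)) (𝓝 ((0, 1), 0)) := by
    rw [← hU.point]
    have h2 : Tendsto (fun y : S (m + 1) => e (y : E (m + 1 + 1))) (𝓝 p) (𝓝 (e p)) :=
      (e.continuous.comp continuous_subtype_val).continuousAt
    exact h2.comp tendsto_comap
  -- Near `p` the last coordinate tends to zero through positive values while the vertical one tends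
  -- to one, so their quotient, the affine height, tends to infinity.
  have h3 : Tendsto (fun y : Mt => (e ((y : S (m + 1)) : E (m + 1 + 1))).2)
      (comap (fun y : Mt => (y : S (m + 1))) (𝓝 p)) (𝓝[>] 0) :=
    tendsto_nhdsWithin_iff.2 ⟨(continuous_snd.tendsto _).comp h1,
      Eventually.of_forall fun y => hU.snd_pos y⟩
  have h4 : Tendsto (fun y : Mt => (e ((y : S (m + 1)) : E (m + 1 + 1))).1.2)
      (comap (fun y : Mt => (y : S (m + 1))) (𝓝 p)) (𝓝 1) :=
    ((continuous_snd.comp continuous_fst).tendsto _).comp h1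
  exact (h3.inv_tendsto_nhdsGT_zero.atTop_mul_pos one_pos h4)

end OpenCusp

end ConvexCusp

/-! ### The region above a section is an open cusp, with its boundary a closed cusp. -/

namespace ConvexCusp

variable {m : ℕ} {Ω : Set (S (m + 1))} {Γ' : Subgroup (GL (Fin (m + 1 + 1)) ℝ)}
  (hN : IsConvexManifold Ω Γ') {M : Set (OrbitSpace Ω Γ')}
  {Mt : TopologicalSpace.Opens (S (m + 1))} {Γ : Subgroup (GL (Fin (m + 1 + 1)) ℝ)}
  {p : S (m + 1)} (hM : IsOpenCusp M (Mt : Set (S (m + 1))) Γ p)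
  {H : Submodule ℝ (E (m + 1 + 1))}
  {e : E (m + 1 + 1) ≃L[ℝ] (E m × ℝ) × ℝ} (hU : IsCuspCover Ω Mt Γ p e)
  {s₀ : E m → ℝ} (hs : hU.cuspAction.IsSection (base e Mt hU.isOpen) s₀)
  (hτ : ∀ z ∈ base e Mt hU.isOpen, lowerBoundary e Mt z < s₀ z)

section Height

variable {k : M → ℝ} (hk : Continuous k) (hko : IsOpenMap k)
  (hk_le : ∀ x : Mt, k (hM.proj x) ≤ 0 ↔ 0 ≤ heightAbove e s₀ ((x : S (m + 1)) : E (m + 1 + 1)))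
  (hk_lt : ∀ x : Mt, k (hM.proj x) < 0 ↔ 0 < heightAbove e s₀ ((x : S (m + 1)) : E (m + 1 + 1)))
include hN hM hU hs hτ

include hk_lt hk hko in
/-- The rays above a section form an open cusp. -/
theorem IsOpenCusp.isOpenCusp_above {V : Set (S (m + 1))} (hVM : V ⊆ Mt)
    (hV : IsCuspGroup Γ V H p)
    (hVs : ∀ x ∈ V, 0 < heightAbove e s₀ ((x : S (m + 1)) : E (m + 1 + 1)))
    (hconn : IsConnected {y | k y < 0}) :
    IsOpenCusp (interior (Subtype.val '' {y : M | k y ≤ 0}))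
      (interior ((Mt : Set (S (m + 1))) ∩ lift (Subtype.val '' {y : M | k y ≤ 0}))) Γ p := by
  rw [interior_inter, Mt.isOpen.interior_eq, interior_lift hN, interior_sublevel hM.isOpen hk hko]
  set Q : Set (OrbitSpace Ω Γ') := Subtype.val '' {y : M | k y < 0} with hQ
  have hQM : Q ⊆ M := by
    rintro _ ⟨y, -, rfl⟩
    exact y.2
  have hmem : ∀ x : S (m + 1), x ∈ (Mt : Set (S (m + 1))) ∩ lift Q ↔
      x ∈ Mt ∧ heightAbove e s₀ (x : E (m + 1 + 1)) ∈ Ioi 0 := fun x =>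
    and_congr_right fun hx => (hM.mem_lift_image ⟨x, hx⟩).trans (hk_lt ⟨x, hx⟩)
  have hpre : IsPreconnected ((Mt : Set (S (m + 1))) ∩ lift Q) := by
    have := hM.isPreconnected_above hU hs hτ isPreconnected_Ioi (Ioi_subset_Ici_self (a := (0 : ℝ)))
    convert this using 1
    ext x
    exact hmem x
  have hVQ : V ⊆ (Mt : Set (S (m + 1))) ∩ lift Q := fun x hx => (hmem x).2 ⟨hVM hx, hVs x hx⟩
  have hne : ((Mt : Set (S (m + 1))) ∩ lift Q).Nonempty := hV.properlyConvex.nonempty.mono hVQ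
  have hstar : ∀ v ∈ cone ((Mt : Set (S (m + 1))) ∩ lift Q), ∀ s : ℝ, 0 ≤ s →
      v + s • (p : E (m + 1 + 1)) ∈ cone ((Mt : Set (S (m + 1))) ∩ lift Q) := by
    intro v hv s hs0
    have h1 := hM.starshaped.2 v ⟨hv.1, hv.2.1⟩ s hs0
    have hpos := hU.pos v ⟨hv.1, hU.subset hv.2.1⟩
    refine ⟨h1.1, (hmem _).2 ⟨h1.2, ?_⟩⟩
    have h2 := ((hmem _).1 hv.2).2
    rw [heightAbove_toSphere hv.1, mem_Ioi] at h2
    rw [heightAbove_toSphere h1.1, hU.heightAbove_add_smul s hpos.ne', mem_Ioi]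
    positivity
  have hpres : ∀ A ∈ Γ, act A '' ((Mt : Set (S (m + 1))) ∩ lift Q) =
      (Mt : Set (S (m + 1))) ∩ lift Q := by
    intro A hA
    rw [image_inter (f := act A) (actHomeomorph A).injective, act_image_lift hN (hM.le hA),
      hU.preserves A hA]
  refine ⟨hM.isOpen.isOpenMap_subtype_val _ (isOpen_Iio.preimage hk),
    hconn.image _ continuous_subtype_val.continuousOn, hM.isComponentOf_inter hQM hne hpre,
    fun A => ⟨fun hA => ⟨hM.le hA, hpres A hA⟩, ?_⟩, hM.mem_frontier, ⟨?_, hstar⟩,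
    V, hVQ, H, hV⟩
  -- An element of `Γ'` that preserves the smaller region maps a point of `Mt` into `Mt`, so it
  -- preserves `Mt`: the holonomy does not change.
  · rintro ⟨hA, hAQ⟩
    obtain ⟨x, hx⟩ := hne
    refine (hM.holonomy A).2 ⟨hA, act_image_component hN hM.component hA hx.1 ?_⟩
    exact (hAQ ▸ mem_image_of_mem (act A) hx : act A x ∈ (Mt : Set (S (m + 1))) ∩ lift Q).1
  · obtain ⟨x, hx⟩ := hne
    exact mem_closure_of_starshaped fun s hs => hstar x (coe_mem_cone_iff.2 hx) s hs

include hk_le hk_lt hk hko in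
/-- The rays on or above a section form a closed cusp. -/
theorem IsOpenCusp.isClosedCusp_above {V : Set (S (m + 1))} (hVM : V ⊆ Mt)
    (hV : IsCuspGroup Γ V H p)
    (hVs : ∀ x ∈ V, 0 < heightAbove e s₀ ((x : S (m + 1)) : E (m + 1 + 1)))
    (hconn : IsConnected {y | k y < 0}) :
    IsClosedCusp (Subtype.val '' {y : M | k y ≤ 0})
      ((Mt : Set (S (m + 1))) ∩ lift (Subtype.val '' {y : M | k y ≤ 0})) Γ p := by
  set P : Set (OrbitSpace Ω Γ') := Subtype.val '' {y : M | k y ≤ 0} with hP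
  have hPM : P ⊆ M := by
    rintro _ ⟨y, -, rfl⟩
    exact y.2
  have hmem : ∀ x : S (m + 1), x ∈ (Mt : Set (S (m + 1))) ∩ lift P ↔
      x ∈ Mt ∧ heightAbove e s₀ (x : E (m + 1 + 1)) ∈ Ici 0 := fun x =>
    and_congr_right fun hx => (hM.mem_lift_image ⟨x, hx⟩).trans (hk_le ⟨x, hx⟩)
  have hbd : ∀ x : Mt, (x : S (m + 1)) ∈ lift (bdry P) ↔
      heightAbove e s₀ ((x : S (m + 1)) : E (m + 1 + 1)) = 0 := by
    intro x
    rw [hP, bdry_sublevel hM.isOpen hk hko, hM.mem_lift_image, mem_ofPred_eq]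
    have h1 := hk_le x
    have h2 := hk_lt x
    constructor
    · intro h
      rw [h] at h1 h2
      exact le_antisymm (not_lt.1 fun h3 => lt_irrefl _ (h2.2 h3)) (h1.1 le_rfl)
    · intro h
      rw [h] at h1 h2
      exact le_antisymm (h1.2 le_rfl) (not_lt.1 fun h3 => lt_irrefl _ (h2.1 h3))
  have hpre : IsPreconnected ((Mt : Set (S (m + 1))) ∩ lift P) := by
    have := hM.isPreconnected_above hU hs hτ isPreconnected_Ici (Subset.refl (Ici (0 : ℝ)))
    convert this using 1
    ext x
    exact hmem x
  have hVP : V ⊆ (Mt : Set (S (m + 1))) ∩ lift P := fun x hx => (hmem x).2 ⟨hVM hx, (hVs x hx).le⟩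
  have hne := hV.properlyConvex.nonempty.mono hVP
  -- The vertical line over `z` meets the boundary at height `s₀ z`.
  have hmeet : ∀ x : Mt, ∃ y : Mt,
      (affineCoord e (y : S (m + 1))).1 = (affineCoord e (x : S (m + 1))).1 ∧
      heightAbove e s₀ ((y : S (m + 1)) : E (m + 1 + 1)) = 0 := by
    intro x
    have h1 := hU.affineCoord_ofCoord (hU.toBase x) _ (hτ _ (hU.toBase x).2)
    refine ⟨hU.ofCoord (hU.toBase x) _ (hτ _ (hU.toBase x).2), ?_, ?_⟩
    · rw [h1]
      rfl
    · rw [heightAbove, h1, sub_self]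
  refine ⟨hM.isComponentOf_inter hPM hne hpre, ?_,
    hM.isOpenCusp_above hN hU hs hτ hk hko hk_lt hVM hV hVs hconn, ?_, ?_⟩
  · obtain ⟨x, hx⟩ := hne
    obtain ⟨y, -, hy⟩ := hmeet ⟨x, hx.1⟩
    exact ⟨_, ((hbd y).2 hy).2⟩
  · rintro x ⟨hx, -⟩
    obtain ⟨y, hyx, hy⟩ := hmeet ⟨x, hx⟩
    refine ⟨y, ⟨(hmem y).2 ⟨y.2, hy.ge⟩, (hbd y).2 hy, hU.mem_line_iff (x := ⟨x, hx⟩).2 hyx.symm⟩, ?_⟩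
    rintro w ⟨hw, hwb, hwl⟩
    have h1 := (hU.mem_line_iff (x := ⟨x, hx⟩) (y := ⟨w, hw.1⟩)).1 hwl
    have h2 := (hbd ⟨w, hw.1⟩).1 hwb
    have h3 : (⟨w, hw.1⟩ : Mt) = y := by
      apply hU.affineCoord_injective
      have h4 : (affineCoord e (w : E (m + 1 + 1))).1 = (affineCoord e (y : S (m + 1))).1 :=
        h1.symm.trans hyx.symm
      refine Prod.ext h4 ?_
      rw [heightAbove, sub_eq_zero] at hy h2
      exact h2.trans ((congrArg s₀ h4).trans hy.symm)
    exact congrArg Subtype.val h3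
  · rintro y ⟨hyM, -⟩ hyb
    have hd := hU.fderiv_heightAbove hs hyM
    have hc := hU.contDiffAt_heightAbove hs hyM
    -- The cusp lies above the section, so its defining inequality is that the negated height is at
    -- most zero; the derivative along `p` is minus the inverse of the last coordinate.
    refine ⟨fun v => - heightAbove e s₀ v, hc.neg, ?_, ?_⟩
    · have h1 : ∀ᶠ v in 𝓝 (y : E (m + 1 + 1)), toSphere v ∈ (Mt : Set (S (m + 1))) :=
        (continuousAt_toSphere (S.ne_zero y)).preimage_mem_nhds
          (Mt.isOpen.mem_nhds (by rw [toSphere_coe]; exact hyM))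
      have h2 : ∀ᶠ v in 𝓝 (y : E (m + 1 + 1)), v ≠ 0 := isOpen_ne.mem_nhds (S.ne_zero y)
      filter_upwards [h1, h2] with v hv hv0
      rw [neg_nonpos, ← heightAbove_toSphere hv0]
      exact (hM.mem_lift_image ⟨_, hv⟩).trans (hk_le ⟨_, hv⟩)
    · rw [fderiv_fun_neg, neg_apply, hd, neg_ne_zero]
      exact inv_ne_zero (hU.snd_pos ⟨y, hyM⟩).ne'

end Height

end ConvexCusp

/-! ### Splittings of the cusp, its fundamental group, and the theorem. -/

namespace ConvexCusp

variable {m : ℕ} {Ω : Set (S (m + 1))} {Γ' : Subgroup (GL (Fin (m + 1 + 1)) ℝ)}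
  (hN : IsConvexManifold Ω Γ') {M : Set (OrbitSpace Ω Γ')}
  {Mt : TopologicalSpace.Opens (S (m + 1))} {Γ : Subgroup (GL (Fin (m + 1 + 1)) ℝ)}
  {p : S (m + 1)} (hM : IsOpenCusp M (Mt : Set (S (m + 1))) Γ p)
  {H : Submodule ℝ (E (m + 1 + 1))}
  {e : E (m + 1 + 1) ≃L[ℝ] (E m × ℝ) × ℝ} (hU : IsCuspCover Ω Mt Γ p e)

include hN in
/-- Every section above the lower boundary and below a convex core gives a splitting of the cusp. -/
theorem IsOpenCusp.exists_splitting (hπ : IsHolonomyQuotient Γ hM.proj) {s₀ : E m → ℝ}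
    (hs : hU.cuspAction.IsSection (base e Mt hU.isOpen) s₀)
    (hτ : ∀ z ∈ base e Mt hU.isOpen, lowerBoundary e Mt z < s₀ z)
    {V : Set (S (m + 1))} (hVM : V ⊆ Mt) (hV : IsCuspGroup Γ V H p)
    (hVs : ∀ x ∈ V, 0 < heightAbove e s₀ ((x : S (m + 1)) : E (m + 1 + 1))) :
    letI := hU.chartedSpace hπ
    ∃ h : M ≃ₘ^∞⟮𝓡 (m + 1), 𝓘(ℝ, ℝ).prod (𝓡 m)⟯ (ℝ × hU.isDomain.Cross),
      IsCuspSplitting hM (hU.cuspProj hπ) h ∧ ∀ x : Mt, hM.proj x ∈ {y : M | (h y).1 ≤ 0} ↔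
        0 ≤ heightAbove e s₀ ((x : S (m + 1)) : E (m + 1 + 1)) := by
  let _ := hU.chartedSpace hπ
  -- This height function vanishes on the graph of `s₀` and decreases upwards, so `h₁ ≤ 0` is the
  -- region on or above the section.
  obtain ⟨g, hg⟩ := hU.isDomain.exists_height hs hτ
  obtain ⟨h, hh⟩ := hU.exists_diffeomorph hπ hg
  have hcoord : ∀ x : Mt, (affineCoord e ((x : S (m + 1)) : E (m + 1 + 1))).1 ∈
      base e Mt hU.isOpen ∧ lowerBoundary e Mt (affineCoord e (x : S (m + 1))).1 <
        (affineCoord e (x : S (m + 1))).2 := fun x => ⟨(hU.toBase x).2, hU.lowerBoundary_lt x⟩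
  let k : M → ℝ := fun y => (h y).1
  have hk : Continuous k := continuous_fst.comp h.continuous
  have hko : IsOpenMap k := isOpenMap_fst.comp h.toHomeomorph.isOpenMap
  have hkx : ∀ x, k (hM.proj x) = g (affineCoord e (x : S (m + 1))) := fun x =>
    congrArg Prod.fst (hh x)
  have hk_le : ∀ x : Mt, k (hM.proj x) ≤ 0 ↔
      0 ≤ heightAbove e s₀ ((x : S (m + 1)) : E (m + 1 + 1)) := fun x => by
    rw [hkx, heightAbove, sub_nonneg]
    exact hg.nonpos_iff (hcoord x).1 (hcoord x).2
  have hk_lt : ∀ x : Mt, k (hM.proj x) < 0 ↔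
      0 < heightAbove e s₀ ((x : S (m + 1)) : E (m + 1 + 1)) := fun x => by
    constructor
    · intro h1
      refine lt_of_le_of_ne ((hk_le x).1 h1.le) fun h2 => h1.ne ?_
      rw [heightAbove, eq_comm, sub_eq_zero] at h2
      have := hg.eq_sub _ (hcoord x).1 _ h2.ge
      rw [hkx, ← Prod.mk.eta (p := affineCoord e ((x : S (m + 1)) : E (m + 1 + 1))), this, h2,
        sub_self]
    · intro h1
      rw [heightAbove, sub_pos] at h1
      have := hg.eq_sub _ (hcoord x).1 _ h1.le
      rw [hkx, ← Prod.mk.eta (p := affineCoord e ((x : S (m + 1)) : E (m + 1 + 1))), this]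
      linarith
  have hsnd : ∀ y, (h y).2 = hU.cuspProj hπ y := by
    intro y
    obtain ⟨x, rfl⟩ := hπ.isQuotientMap.surjective y
    rw [hU.cuspProj_apply, hh]
  -- Through `h` this set is `(-∞, 0) × X`, and `X` is connected as an image of `M`.
  have hconn : IsConnected {y | k y < 0} := by
    have hX : IsConnected (univ : Set hU.isDomain.Cross) := by
      have : ConnectedSpace M := isConnected_iff_connectedSpace.1 hM.connected
      have h1 := (isConnected_univ (α := M)).image (fun y => (h y).2)
        (continuous_snd.comp h.continuous).continuousOn
      have h3 : Function.Surjective fun y => (h y).2 := Prod.snd_surjective.comp h.surjective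
      rwa [image_univ, h3.range_eq] at h1
    have h2 := ((isConnected_Iio (a := (0 : ℝ))).prod hX).image h.symm h.symm.continuous.continuousOn
    convert h2 using 1
    ext y
    constructor
    · intro hy
      exact ⟨h y, ⟨hy, mem_univ _⟩, h.symm_apply_apply y⟩
    · rintro ⟨x, ⟨hx, -⟩, rfl⟩
      change (h (h.symm x)).1 < 0
      rw [h.apply_symm_apply]
      exact hx
  have hbd : bdry (sublevel h) = Subtype.val '' {y : M | k y = 0} :=
    bdry_sublevel hM.isOpen hk hko
  have hbd' : ∀ y : M, (y : OrbitSpace Ω Γ') ∈ bdry (sublevel h) ↔ k y = 0 := by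
    intro y
    rw [hbd]
    exact Subtype.val_injective.mem_set_image
  have hinj : ∀ y y', k y = k y' → hU.cuspProj hπ y = hU.cuspProj hπ y' → y = y' := by
    intro y y' h1 h2
    rw [← hsnd, ← hsnd] at h2
    exact h.injective (Prod.ext h1 h2)
  have hinv : ∀ x, k (h.symm (0, x)) = 0 ∧ hU.cuspProj hπ (h.symm (0, x)) = x := by
    intro x
    rw [← hsnd]
    simp only [k, h.apply_symm_apply, and_self]
  refine ⟨h, ⟨hsnd, fun x => ?_, ⟨_, inter_subset_left, hM.isClosedCusp_above hN hU hs hτ hk hko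
    hk_le hk_lt hVM hV hVs hconn⟩, ?_, ⟨fun _ _ => mem_univ _, ?_, ?_⟩, ?_⟩, hk_le⟩
  · set z := (affineCoord e ((x : S (m + 1)) : E (m + 1 + 1))).1 with hz
    have h1 : Tendsto (fun t => g (z, t)) atTop atBot := by
      refine Tendsto.congr' (f₁ := fun t => s₀ z - t) ?_ ?_
      · filter_upwards [eventually_ge_atTop (s₀ z)] with t ht
        exact (hg.eq_sub z (hcoord x).1 t ht).symm
      · exact tendsto_const_nhds.add_atBot tendsto_neg_atTop_atBot
    have h2 := (h1.comp hU.tendsto_affineCoord_snd).mono_left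
      (inf_le_left (b := 𝓟 {y : Mt | (y : S (m + 1)) ∈ line p (x : S (m + 1))}))
    refine h2.congr' ?_
    filter_upwards [mem_inf_of_right (mem_principal_self _)] with y hy
    have h3 := hU.mem_line_iff.1 hy
    change g (z, _) = k (hM.proj y)
    rw [hkx, hz, h3]
  · rw [hbd]
    rintro _ ⟨y, -, rfl⟩
    exact y.2
  · intro y hy y' hy' hyy
    exact hinj y y' (((hbd' y).1 hy).trans ((hbd' y').1 hy').symm) hyy
  · intro x _
    exact ⟨h.symm (0, x), (hbd' _).2 (hinv x).1, (hinv x).2⟩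
  · refine ⟨fun x => h.symm (0, x), ?_, fun x => ⟨(hinv x).2, (hbd' _).2 (hinv x).1⟩⟩
    exact h.symm.contMDiff.comp (contMDiff_const.prodMk contMDiff_id)

lemma heightAbove_pos_of_patch (hU : IsCuspCover Ω Mt Γ p e) {s₀ : E m → ℝ} 
    {W : Set (S (m + 1))} (hWM : W ⊆ (Mt : Set (S (m + 1))))
    (h : ∀ z ∈ base e Mt hU.isOpen, ∀ t, (z, t) ∈ patch e W → s₀ z < t) {x : S (m + 1)}
    (hx : x ∈ W) : 0 < heightAbove e s₀ (x : E (m + 1 + 1)) := by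
  have hpos := hU.snd_pos ⟨x, hWM hx⟩
  refine sub_pos.2 (h _ (hU.toBase ⟨x, hWM hx⟩).2 _ ?_)
  change e.symm (affineCoord e (x : E (m + 1 + 1)), 1) ∈ cone W
  rw [symm_affineCoord hpos.ne', smul_mem_cone_iff (inv_pos.2 hpos)]
  exact coe_mem_cone_iff.2 hx

lemma isVirtuallyNilpotent_of_mulEquiv {G K : Type*} [Group G] [Group K] (φ : G ≃* K)
    (h : Group.IsVirtuallyNilpotent G) : Group.IsVirtuallyNilpotent K := by
  obtain ⟨N, hN, hfin⟩ := h
  refine ⟨N.map φ.toMonoidHom, Group.nilpotent_of_mulEquiv (φ.subgroupMap N), ⟨?_⟩⟩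
  rw [Subgroup.index_map_of_bijective φ.bijective]
  exact hfin.index_ne_zero

include hN hM in
lemma IsOpenCusp.isVirtuallyNilpotent : Group.IsVirtuallyNilpotent Γ := by
  obtain ⟨W, -, H', hcusp⟩ := hM.core
  exact hcusp.isVirtuallyNilpotent (hM.torsionFree hN)

include hN hM hU in
-- `Mt → M` is a covering with deck group `Γ`. For simply connected `Mt` it identifies the
-- fundamental group with the opposite group of `Γ`; inversion removes the opposite.
lemma IsOpenCusp.isVirtuallyNilpotent_fundamentalGroup [SimplyConnectedSpace Mt] (x : M) :
    Group.IsVirtuallyNilpotent (FundamentalGroup M x) := by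
  have hπ := hM.isHolonomyQuotient hN
  let _ := hU.mulAction
  have hq := hU.isQuotientCoveringMap hπ
  obtain ⟨y, rfl⟩ := hπ.isQuotientMap.surjective x
  exact isVirtuallyNilpotent_of_mulEquiv
    ((MulEquiv.inv' Γ).trans (hq.fundamentalGroupEquiv ⟨y, rfl⟩).symm) (hM.isVirtuallyNilpotent hN)

end ConvexCusp

theorem mainTheorem6 {m : ℕ}
    {Ω : Set (ConvexCusp.S (m + 1))} {Γ' : Subgroup (GL (Fin (m + 1 + 1)) ℝ)}
    (hN : ConvexCusp.IsConvexManifold Ω Γ')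
    {M : Set (ConvexCusp.OrbitSpace Ω Γ')} {Mt : TopologicalSpace.Opens (ConvexCusp.S (m + 1))}
    {Γ : Subgroup (GL (Fin (m + 1 + 1)) ℝ)} {p : ConvexCusp.S (m + 1)}
    (hM : ConvexCusp.IsOpenCusp M (Mt : Set (ConvexCusp.S (m + 1))) Γ p)
    {H : Submodule ℝ (ConvexCusp.E (m + 1 + 1))}
    (hH : ConvexCusp.IsSupportingHyperplane Ω H p) (hΓ : ConvexCusp.Preserves Γ H p) :
    (∃ (X : Type) (_ : TopologicalSpace X) (_ : ChartedSpace (ConvexCusp.E m) X)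
      (_ : ChartedSpace (ConvexCusp.E (m + 1)) M) (h₂ : M → X),
      -- the smooth structure of `M` is the one induced from `N = Ω / Γ'`
      IsLocalDiffeomorph (𝓡 (m + 1)) (𝓡 (m + 1)) ∞ hM.proj ∧
      -- `M` and `X` are affine manifolds, compatibly with the projective structure of `M`
      ConvexCusp.IsAffineManifold (m + 1) M ∧ ConvexCusp.IsProjectiveAtlas hM.proj ∧
      ConvexCusp.IsAffineManifold m X ∧ ConvexCusp.IsAffine (k := m + 1) (l := m) h₂ ∧
      -- the fibres of `h₂` are the rays in `M` asymptotic to `p`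
      (∀ x : Mt, h₂ ⁻¹' {h₂ (hM.proj x)} =
        hM.proj '' {y : Mt | (y : ConvexCusp.S (m + 1)) ∈ ConvexCusp.line p x}) ∧
      -- there is a diffeomorphism `h = (h₁, h₂)` such that `h₁ ≤ 0` is a closed cusp
      (∃ h : M ≃ₘ^∞⟮𝓡 (m + 1), 𝓘(ℝ, ℝ).prod (𝓡 m)⟯ (ℝ × X),
        ConvexCusp.IsCuspSplitting hM h₂ h) ∧
      -- and this cusp can be chosen to contain a given open cusp `V` whose closure contains no ray
      (∀ (V : Set (ConvexCusp.OrbitSpace Ω Γ')) (Vt : Set (ConvexCusp.S (m + 1)))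
          (ΓV : Subgroup (GL (Fin (m + 1 + 1)) ℝ)),
        ConvexCusp.IsOpenCusp V Vt ΓV p → V ⊆ M → Vt ⊆ Mt →
        h₂ '' {x : M | (x : ConvexCusp.OrbitSpace Ω Γ') ∉ closure V} = Set.univ →
        ∃ h : M ≃ₘ^∞⟮𝓡 (m + 1), 𝓘(ℝ, ℝ).prod (𝓡 m)⟯ (ℝ × X),
          ConvexCusp.IsCuspSplitting hM h₂ h ∧ V ⊆ ConvexCusp.sublevel h)) ∧
    -- the holonomy of `M`, which is its fundamental group if `Mt` is the universal cover of `M`,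
    -- is virtually nilpotent
    Group.IsVirtuallyNilpotent Γ ∧
    (SimplyConnectedSpace Mt → ∀ x : M, Group.IsVirtuallyNilpotent (FundamentalGroup M x)) := by
  obtain ⟨e, hep, heH, hpos⟩ := ConvexCusp.exists_coordinates hN.properlyConvex hH
  have hU := hM.isCuspCover hN hΓ hep heH hpos
  have hπ := hM.isHolonomyQuotient hN
  obtain ⟨W, hWM, hW, hWloc⟩ := hM.exists_core hN hH hU hΓ heH
  refine ⟨⟨hU.isDomain.Cross, inferInstance, inferInstance, hU.chartedSpace hπ, hU.cuspProj hπ,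
    hU.isLocalDiffeomorph hπ, hU.isAffineManifold hπ, hU.isProjectiveAtlas hπ,
    hU.isDomain.isAffineManifold, hU.isAffine_cuspProj hπ, hU.preimage_cuspProj hπ, ?_, ?_⟩,
    hM.isVirtuallyNilpotent hN, fun _ => hM.isVirtuallyNilpotent_fundamentalGroup hN hU⟩
  -- The section runs between the lower boundary and the shrunken core `W`, so that `W` is a convex
  -- core of the region above it.
  · obtain ⟨s, hs, h⟩ := hU.exists_section_lt hW.discrete.preserves hWloc
    obtain ⟨h, hh, -⟩ := hM.exists_splitting hN hU hπ hs (fun z hz => (h z hz).1) hWM hW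
      fun x hx => ConvexCusp.heightAbove_pos_of_patch hU hWM (fun z hz => (h z hz).2) hx
    exact ⟨h, hh⟩
  · intro V Vt ΓV hV hVM hVt hVX
    -- The second obstacle is the full preimage of `V` in `Mt`, which is `Γ`-invariant; the
    -- component `Vt` alone need not be.
    have hΓV : ∀ A ∈ Γ, ConvexCusp.act A '' (ConvexCusp.lift V ∩ Mt) = ConvexCusp.lift V ∩ Mt := by
      intro A hA
      rw [image_inter (f := ConvexCusp.act A) (ConvexCusp.actHomeomorph A).injective,
        ConvexCusp.act_image_lift hN (hM.le hA), hU.preserves A hA]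
    obtain ⟨s, hs, h⟩ := hU.exists_section_lt_union hW.discrete.preserves hΓV hWloc
      (hM.exists_lt_of_cuspProj hN hU hV hVt hπ hVX)
    obtain ⟨h', hh, hsub⟩ := hM.exists_splitting hN hU hπ hs (fun z hz => (h z hz).1) hWM hW
      fun x hx => ConvexCusp.heightAbove_pos_of_patch hU hWM (fun z hz => (h z hz).2.1) hx
    refine ⟨h', hh, fun y hy => ?_⟩
    obtain ⟨x, hx⟩ := hπ.isQuotientMap.surjective ⟨y, hVM hy⟩
    refine ⟨_, (hsub x).2 ?_, congrArg Subtype.val hx⟩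
    refine (ConvexCusp.heightAbove_pos_of_patch hU inter_subset_right (fun z hz => (h z hz).2.2)
      ⟨⟨(hM.subset_lift x.2).1, ?_⟩, x.2⟩).le
    change (hM.proj x : ConvexCusp.OrbitSpace Ω Γ') ∈ V
    rw [hx]
    exact hy
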